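/- Let $n\ge 1$ and let $V:\mathbb R\to\mathbb R$ be real analytic with $V(x)/\log(1+|x|)\to+\infty$ as $x\to\pm\infty$. Let $p_{j,n}$ ($j\ge 0$) be the orthonormal polynomials for the weight $e^{-nV(x)}$ on $\mathbb R$, that is, $p_{j,n}$ has degree $j$ and positive leading coefficient, and $\int_{\mathbb R}p_{j,n}p_{k,n}e^{-nV}\,dx=\delta_{j,k}$. Put $$K_n^{\mathrm{PE}}(z,w)=e^{-nV(w)}\sum_{j=0}^{n-1}p_{j,n}(z)\,p_{j,n}(w),\qquad z\in\mathbb C,\ w\in\mathbb R .$$ Let $\mathbf X(t)=(x_1(t),\dots,x_n(t))$, $t\in[0,1]$, consist of $n$ nonintersecting Brownian paths with diffusion parameter $n^{-1/2}$, with confluent ending points $0$ at $t=1$, and with random starting points $a_1<\dots<a_n$ of law $$\frac1{Z_n}\,\Delta_n(a)^2\prod_{j=1}^n e^{-nV(a_j)}\,da_1\cdots da_n,\qquad \Delta_n(a)=\prod_{1\le i<j\le n}(a_j-a_i).$$ This means that $\mathbf X$ has continuous paths and that, given the starting points $a$, its law is the limit, in the sense of finite-dimensional distributions, as $b_1<\dots<b_n$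 all tend to $0$, of the law of $n$ independent Brownian bridges with diffusion parameter $n^{-1/2}$ from $a_j$ (at time $0$) to $b_j$ (at time $1$), conditioned not to intersect during $[0,1]$. Fix $m\in\mathbb N$ and $0<t_1<\dots<t_m<1$, and let $c\in\mathbb R$ be arbitrary. Then $\mathbf X(t_1),\dots,\mathbf X(t_m)$ form a multi-time determinantal process with kernel $$K_n^{\mathbf X}(x,y;t,t')=-1_{t<t'}\,G_n(x,y;t,t')+\widetilde K_n^{\mathbf X}(x,y;t,t'),$$ where $$G_n(x,y;t,t')=\frac{\sqrt n}{\sqrt{2\pi(t'-t)}}\exp\Big(-\frac{n(x-y)^2}{2(t'-t)}+\frac{nx^2}{2(1-t)}-\frac{ny^2}{2(1-t')}\Big),$$ $$\widetilde K_n^{\mathbf X}(x,y;t,t')=\frac{n}{2\pi i\sqrt{tt'}}\int_{c-i\infty}^{c+i\infty}dz\int_{-\infty}^{\infty}dw\;K_n^{\mathrm{PE}}(z,w)\,\exp\Big(\frac{n(x-(1-t)z)^2}{2t(1-t)}-\frac{n(y-(1-t')w)^2}{2t'(1-t')}\Big),$$ the double integral being absolutely convergent for all real $x,y$ and all $t,t'\in\{t_1,\dots,t_m\}$.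 That is, for every $k\ge 0$ and all $s_1,\dots,s_k\in\{1,\dots,m\}$, the $k$-point correlation function of the particles is $$R_k\big((x_1,t_{s_1}),\dots,(x_k,t_{s_k})\big)=\det\big(K_n^{\mathbf X}(x_i,x_j;t_{s_i},t_{s_j})\big)_{i,j=1}^k ,$$ which means that for every bounded measurable $f:\mathbb R^k\to\mathbb R$ the function $f\cdot R_k$ is integrable on $\mathbb R^k$ and $$\int_{\mathbb R^k}f(x)\,R_k\big((x_1,t_{s_1}),\dots,(x_k,t_{s_k})\big)\,dx=\mathbb E\sum_{q}f\big(x_{q_1}(t_{s_1}),\dots,x_{q_k}(t_{s_k})\big),$$ the sum being over all $q\in\{1,\dots,n\}^k$ for which the pairs $(s_1,q_1),\dots,(s_k,q_k)$ are distinct. -/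

import Mathlib

open MeasureTheory ProbabilityTheory Filter Topology
open scoped NNReal unitInterval BoundedContinuousFunction

namespace NIBM

noncomputable section

/-! ### The unitary ensemble -/

/-- The Vandermonde product `Δ_n(a) = ∏_{i < j} (a_j - a_i)`. -/
def vandermonde {n : ℕ} (a : Fin n → ℝ) : ℝ :=
  ∏ i, ∏ j ∈ Finset.Ioi i, (a j - a i)

/-- The ordered configurations `a_1 < ⋯ < a_n`. -/
def chamber (n : ℕ) : Set (Fin n → ℝ) := {a | StrictMono a}

/-- The unnormalized density `Δ_n(a)² ∏_j e^{-n V(a_j)}`. -/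
def ueWeight (n : ℕ) (V : ℝ → ℝ) (a : Fin n → ℝ) : ℝ :=
  vandermonde a ^ 2 * ∏ j, Real.exp (-(n * V (a j)))

/-- The normalization constant `Z_n`, for ordered configurations. -/
def ueZ (n : ℕ) (V : ℝ → ℝ) : ℝ := ∫ a in chamber n, ueWeight n V a

/-- The unitary ensemble law `Z_n⁻¹ Δ_n(a)² ∏_j e^{-n V(a_j)} da_1 ⋯ da_n` of ordered points
`a_1 < ⋯ < a_n`. -/
def ueLaw (n : ℕ) (V : ℝ → ℝ) : Measure (Fin n → ℝ) :=
  (volume.restrict (chamber n)).withDensity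
    fun a => ENNReal.ofReal ((ueZ n V)⁻¹ * ueWeight n V a)

/-- `p j` is the orthonormal polynomial `p_{j,n}` for the weight `e^{-n V(x)}` on the real line:
it has degree `j`, positive leading coefficient, and `∫ p_j p_k e^{-n V} = δ_{j,k}`. -/
structure IsOrthonormalPolynomials (n : ℕ) (V : ℝ → ℝ) (p : ℕ → Polynomial ℝ) : Prop where
  natDegree_eq : ∀ j, (p j).natDegree = j
  leadingCoeff_pos : ∀ j, 0 < (p j).leadingCoeff
  integral_eq : ∀ j k,
    ∫ x : ℝ, (p j).eval x * (p k).eval x * Real.exp (-(n * V x)) = if j = k then 1 else 0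

/-! ### Nonintersecting Brownian paths with confluent ending points -/

/-- `B_1, …, B_n` are independent standard Brownian motions. -/
structure IsIndepBrownian {n : ℕ} {Ω₀ : Type*} [MeasurableSpace Ω₀]
    (B : Fin n → ℝ≥0 → Ω₀ → ℝ) (P₀ : Measure Ω₀) : Prop where
  isBrownian : ∀ j, IsBrownianReal (B j) P₀
  indep : iIndepFun (fun (j : Fin n) (ω : Ω₀) (t : ℝ≥0) => B j t ω) P₀

/-- The positions at time `t ∈ [0, 1]` of `n` independent Brownian bridges with diffusion
parameter `n^{-1/2}`, the `j`-th one going from `a_j` at time `0` to `b_j` at time `1`. -/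
def bridge {n : ℕ} {Ω₀ : Type*} (B : Fin n → ℝ≥0 → Ω₀ → ℝ) (a b : Fin n → ℝ)
    (t : I) (ω : Ω₀) (j : Fin n) : ℝ :=
  (1 - (t : ℝ)) * a j + (t : ℝ) * b j
    + (B j (unitInterval.toNNReal t) ω - (t : ℝ) * B j 1 ω) / √(n : ℝ)

/-- The event that the bridges from `a` to `b` do not intersect during `[0, 1]`. -/
def nonintersecting {n : ℕ} {Ω₀ : Type*} (B : Fin n → ℝ≥0 → Ω₀ → ℝ) (a b : Fin n → ℝ) :
    Set Ω₀ :=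
  {ω | ∀ t : I, StrictMono (bridge B a b t ω)}

/-- The path measure `μ` is the confluent limit, as the ordered ending points `b_1 < ⋯ < b_n`
all tend to `0`, of the law of the bridges from `a` to `b` conditioned not to intersect. The limit
is weak convergence of all finite-dimensional distributions. -/
def IsConfluentLimit {n : ℕ} {Ω₀ : Type*} [MeasurableSpace Ω₀]
    (B : Fin n → ℝ≥0 → Ω₀ → ℝ) (P₀ : Measure Ω₀) (a : Fin n → ℝ)
    (μ : Measure (I → Fin n → ℝ)) : Prop :=
  ∀ (m : ℕ) (t : Fin m → I) (f : (Fin m → Fin n → ℝ) →ᵇ ℝ),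
    Tendsto
      (fun b : Fin n → ℝ => ∫ ω, f (fun i => bridge B a b (t i) ω) ∂P₀[|nonintersecting B a b])
      (𝓝[chamber n] 0) (𝓝 (∫ γ, f (fun i => γ (t i)) ∂μ))

/-- `X(t)`, `t ∈ [0, 1]`, consists of `n` nonintersecting Brownian paths with confluent ending
points `0` at `t = 1` and with random starting points of law `ν`: the paths are continuous, and
given the starting points `a_1 < ⋯ < a_n`, drawn from `ν`, the law of the paths is the confluent
limit of the conditioned Brownian bridges starting at `a`. -/
structure IsConfluentNIBM {n : ℕ} {Ω₀ Ω : Type*} [MeasurableSpace Ω₀] [MeasurableSpace Ω]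
    (B : Fin n → ℝ≥0 → Ω₀ → ℝ) (P₀ : Measure Ω₀) (ν : Measure (Fin n → ℝ))
    (X : I → Ω → Fin n → ℝ) (P : Measure Ω) : Prop where
  measurable : ∀ t, Measurable (X t)
  continuous : ∀ᵐ ω ∂P, Continuous fun t => X t ω
  law : ∃ κ : Kernel (Fin n → ℝ) (I → Fin n → ℝ), IsMarkovKernel κ ∧
    (∀ a ∈ chamber n, IsConfluentLimit B P₀ a (κ a)) ∧
    P.map (fun ω t => X t ω) = ν.bind κ

/-! ### Multi-time correlation functions -/

/-- The particles `X(t_1), …, X(t_m)` form a multi-time determinantal process with correlation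
kernel `K(x, y; t, t')`: for all `k` and all `s_1, …, s_k`, the function
`det (K (x_i, x_j; t_{s_i}, t_{s_j}))_{i,j = 1}^k` of `x_1, …, x_k` is the `k`-point correlation
function at the times `t_{s_1}, …, t_{s_k}`. That is, its integral against a bounded test function
`f` is the expected sum of `f` over all `k`-tuples of distinct particles, the `l`-th being the
particle `q_l` at time `t_{s_l}`. -/
def IsMultiTimeDeterminantal {n m : ℕ} {Ω : Type*} [MeasurableSpace Ω] (P : Measure Ω)
    (X : I → Ω → Fin n → ℝ) (t : Fin m → I) (K : ℝ → ℝ → ℝ → ℝ → ℂ) : Prop :=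
  ∀ (k : ℕ) (s : Fin k → Fin m) (f : (Fin k → ℝ) → ℝ), Measurable f → (∃ C, ∀ x, |f x| ≤ C) →
    Integrable (fun x : Fin k → ℝ =>
      (f x : ℂ) * (Matrix.of fun i j => K (x i) (x j) (t (s i)) (t (s j))).det) ∧
    ∫ x : Fin k → ℝ,
        (f x : ℂ) * (Matrix.of fun i j => K (x i) (x j) (t (s i)) (t (s j))).det =
      ((∫ ω, ∑ q : Fin k → Fin n with Function.Injective (fun l => (s l, q l)),
        f (fun l => X (t (s l)) ω (q l)) ∂P : ℝ) : ℂ)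

/-! ### The kernel -/

/-- The polynomial ensemble kernel
`K_n^{PE}(z, w) = e^{-n V(w)} ∑_{j < n} p_{j,n}(z) p_{j,n}(w)`, for complex `z` and real `w`. -/
def kernelPE (n : ℕ) (V : ℝ → ℝ) (p : ℕ → Polynomial ℝ) (z : ℂ) (w : ℝ) : ℂ :=
  (Real.exp (-(n * V w)) : ℂ) *
    ∑ j ∈ Finset.range n, Polynomial.aeval z (p j) * (((p j).eval w : ℝ) : ℂ)

/-- The integrand of the double contour integral. -/
def integrand (n : ℕ) (V : ℝ → ℝ) (p : ℕ → Polynomial ℝ) (x y t t' : ℝ) (z : ℂ) (w : ℝ) : ℂ :=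
  kernelPE n V p z w *
    Complex.exp (n * (x - (1 - t) * z) ^ 2 / (2 * t * (1 - t))
      - n * (y - (1 - t') * w) ^ 2 / (2 * t' * (1 - t')))

/-- `∫_{c - i∞}^{c + i∞} F(z) dz`. -/
def verticalIntegral (c : ℝ) (F : ℂ → ℂ) : ℂ := ∫ u : ℝ, F (c + u * Complex.I) * Complex.I

/-- `K̃_n(x, y; t, t')`, with the `z`-integral over the vertical line through `c`. -/
def kernelTilde (n : ℕ) (V : ℝ → ℝ) (p : ℕ → Polynomial ℝ) (c : ℝ) (x y t t' : ℝ) : ℂ :=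
  n / (2 * Real.pi * Complex.I * (√(t * t') : ℝ)) *
    verticalIntegral c fun z => ∫ w : ℝ, integrand n V p x y t t' z w

/-- The Gaussian part `G_n(x, y; t, t')`, used for `t < t'`. -/
def gaussianPart (n : ℕ) (x y t t' : ℝ) : ℝ :=
  √(n : ℝ) / √(2 * Real.pi * (t' - t)) *
    Real.exp (-(n * (x - y) ^ 2 / (2 * (t' - t))) + n * x ^ 2 / (2 * (1 - t))
      - n * y ^ 2 / (2 * (1 - t')))

/-- The multi-time kernel `-1_{t < t'} G_n(x, y; t, t') + K̃_n(x, y; t, t')`. -/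
def kernelX (n : ℕ) (V : ℝ → ℝ) (p : ℕ → Polynomial ℝ) (c : ℝ) (x y t t' : ℝ) : ℂ :=
  -(if t < t' then (gaussianPart n x y t t' : ℂ) else 0) + kernelTilde n V p c x y t t'

end

end NIBM

/-! ### Determinant identities -/

namespace NIBM

/-! The proof follows the Eynard–Mehta scheme, with the starting time `0` kept as an extra layer of
particles.

Probabilistic half. By Karlin–McGregor, ordered Brownian paths started at `a` and killed at their
first collision have, at successive times, a density that is a product of determinants of Gaussian
densities (`integral_prod_noCollision`). It is obtained without stopping times: the heat flow of an
antisymmetric function vanishes wherever two coordinates agree, so the paths that collide contribute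
nothing. A free Brownian path is a bridge to an independent Gaussian endpoint, so the law of bridges
conditioned not to intersect is, for almost every `b`, a ratio of two such densities
(`ae_integral_bridge_nonintersecting`). Numerator and denominator both contain the Vandermonde
product of `b`. Once it is cancelled, everything but the conditional expectation extends
continuously to `b = 0` through divided differences of the exponential. The confluent law then
carries a Vandermonde product of the last positions in the numerator and one of `a` in the
denominator (`exists_integral_confluentLimit`). The latter removes one of the two Vandermonde
factors in the law of `a`. The starting points and the positions at `t_1, …, t_m` together have
density proportional to `Δ(x_0) ∏ e^{-nV(x_0)} · ∏_i det G(x_i, x_{i+1}) · Δ(x_m)`, where the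
Gaussian factors of `G` telescope (`prod_det_gaussianPart`).

Algebraic half. Let `φ_l` at time `t` be `p_l e^{-nV}` transported forward by `G`, and let `ψ_l` be
the polynomial in space that `G` transports backward to `p_l` at time `0`. The transport preserves
the pairing of `φ_l` with `ψ_k`, so orthonormality at time `0` becomes biorthogonality at every
time. The kernel `K = ∑ ψ_l φ_l - 1_{i<j} G` therefore reproduces itself under integration, up to
explicit integer coefficients (`integral_extKernel_mul`). By a Schur complement, its determinant
over all particles is a constant times the density above (`exists_fullDet_extKernel`). Integrating
one point of layer `j` out of a correlation determinant multiplies it by `n` minus the number of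
points left in that layer, so a descending induction from the full configuration gives every
correlation function (`correlationIdentity`). The case of no points says that the total mass is one;
hence no normalizing constant has to be evaluated.

Contour half. For each `l` the integrand of the double integral factors into a function of `z` and a
function of `w`. The `w`-integral gives `φ_l`. The vertical integral is the integral representation
of Hermite-type polynomials and gives `ψ_l` for every `c` (`kernelTilde_eq`). -/

theorem det_bordered {k : ℕ} (M : Matrix (Fin (k + 1)) (Fin (k + 1)) ℝ) :
    M.det = M 0 0 * (M.submatrix Fin.succ Fin.succ).det -
      ∑ a : Fin k, ∑ b : Fin k,
        M a.succ 0 * M 0 b.succ * (M.submatrix Fin.succ Fin.succ).adjugate b a := by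
  -- Expand along the first column and then expand each minor along its first row: the double minors
  -- are the cofactors of the remaining block. No inverse of that block is used, so it may be
  -- singular.
  rw [Matrix.det_succ_column_zero, Fin.sum_univ_succ]
  simp only [Fin.val_zero, pow_zero, one_mul]
  have hsub : M.submatrix (Fin.succAbove 0) Fin.succ = M.submatrix Fin.succ Fin.succ := by
    ext i j; simp
  rw [sub_eq_add_neg, ← Finset.sum_neg_distrib]
  congr 1
  refine Finset.sum_congr rfl fun a _ => ?_
  cases k with
  | zero => exact a.elim0
  | succ k =>
    rw [Matrix.det_succ_row_zero, Finset.mul_sum, ← Finset.sum_neg_distrib]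
    refine Finset.sum_congr rfl fun b _ => ?_
    rw [Matrix.adjugate_fin_succ_eq_det_submatrix, Matrix.submatrix_submatrix,
      Matrix.submatrix_submatrix]
    have h1 : (a.succ.succAbove ∘ Fin.succ : Fin k → Fin (k + 2)) = Fin.succ ∘ a.succAbove := by
      ext i; simp
    rw [h1]
    simp only [Matrix.submatrix_apply, Fin.succ_succAbove_zero, Fin.val_succ]
    change _ = -(_ * _ * (_ * (M.submatrix (Fin.succ ∘ a.succAbove) (Fin.succ ∘ b.succAbove)).det))
    ring

/-- Pigeonhole in the Leibniz formula: no permutation can send all columns of `S` into the smaller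
set of rows `T`. -/
theorem det_eq_zero_of_card_lt {ι : Type*} [Fintype ι] [DecidableEq ι] (M : Matrix ι ι ℝ)
    (S T : Finset ι) (hST : T.card < S.card) (h : ∀ i ∉ T, ∀ j ∈ S, M i j = 0) : M.det = 0 := by
  rw [Matrix.det_apply]
  refine Finset.sum_eq_zero fun τ _ => ?_
  obtain ⟨j, hj, hjT⟩ : ∃ j ∈ S, τ j ∉ T := by
    by_contra! hc
    have := Finset.card_le_card_of_injOn τ hc (τ.injective.injOn)
    omega
  have h0 : ∏ i, M (τ i) i = 0 := Finset.prod_eq_zero (Finset.mem_univ j) (h _ hjT _ hj)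
  rw [h0, smul_zero]

/-- The Eynard–Mehta determinant. The matrix is `BA - D` with `D` strictly block upper triangular,
hence up to sign a Schur complement of the identity block in `[[1, A], [B, D]]`. Shifting the block
columns by one puts the superdiagonal blocks of `D` on the diagonal and makes the bordered matrix
block triangular. -/
theorem exists_det_block (m n : ℕ) : ∃ ε : ℝ, ε ≠ 0 ∧
    ∀ (Ψ Φ : Fin (m + 1) → Matrix (Fin n) (Fin n) ℝ)
      (G : Fin (m + 1) → Fin (m + 1) → Matrix (Fin n) (Fin n) ℝ),
      (Matrix.of fun p q : Fin (m + 1) × Fin n =>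
        ∑ l, Ψ p.1 p.2 l * Φ q.1 l q.2 - if p.1 < q.1 then G p.1 q.1 p.2 q.2 else 0).det =
      ε * ((Φ 0).det * (∏ i : Fin m, (G i.castSucc i.succ).det) * (Ψ (Fin.last m)).det) := by
  -- The rows carry the identity block first (`e`), the columns carry it last (`f`). The diagonal
  -- blocks are then `Φ 0`, the `G i (i+1)`, and `Ψ` of the last layer.
  let e : Fin (m + 2) × Fin n ≃ Fin n ⊕ Fin (m + 1) × Fin n :=
    { toFun := fun p => Fin.cases (motive := fun _ => Fin n ⊕ Fin (m + 1) × Fin n)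
        (Sum.inl p.2) (fun i => Sum.inr (i, p.2)) p.1
      invFun := Sum.elim (fun k => (0, k)) (fun q => (q.1.succ, q.2))
      left_inv := by
        rintro ⟨i, k⟩
        refine Fin.cases ?_ (fun i => ?_) i <;> simp
      right_inv := by rintro (k | ⟨i, k⟩) <;> simp }
  let f : Fin (m + 2) × Fin n ≃ Fin n ⊕ Fin (m + 1) × Fin n :=
    { toFun := fun p => Fin.lastCases (motive := fun _ => Fin n ⊕ Fin (m + 1) × Fin n)
        (Sum.inl p.2) (fun i => Sum.inr (i, p.2)) p.1
      invFun := Sum.elim (fun k => (Fin.last _, k)) (fun q => (q.1.castSucc, q.2))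
      left_inv := by
        rintro ⟨i, k⟩
        refine Fin.lastCases ?_ (fun i => ?_) i <;> simp
      right_inv := by rintro (k | ⟨i, k⟩) <;> simp }
  have hes : ∀ i k, e (Fin.succ i, k) = Sum.inr (i, k) := fun i k => by simp [e]
  have hfc : ∀ i k, f (Fin.castSucc i, k) = Sum.inr (i, k) := fun i k => by simp [f]
  have hfl : ∀ k, f (Fin.last _, k) = Sum.inl k := fun k => by simp [f]
  let τ : Equiv.Perm (Fin n ⊕ Fin (m + 1) × Fin n) := f.symm.trans e
  -- The signs of the negation and of the column shift; both depend on `m` and `n` only.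
  refine ⟨(-1) ^ (Fintype.card (Fin (m + 1) × Fin n)) * ((Equiv.Perm.sign τ : ℤ) : ℝ), ?_, ?_⟩
  · refine mul_ne_zero (by simp) ?_
    exact_mod_cast (Equiv.Perm.sign τ).ne_zero
  intro Ψ Φ G
  let A : Matrix (Fin n) (Fin (m + 1) × Fin n) ℝ := Matrix.of fun k q => Φ q.1 k q.2
  let B : Matrix (Fin (m + 1) × Fin n) (Fin n) ℝ := Matrix.of fun p k => Ψ p.1 p.2 k
  let D : Matrix (Fin (m + 1) × Fin n) (Fin (m + 1) × Fin n) ℝ :=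
    Matrix.of fun p q => if p.1 < q.1 then G p.1 q.1 p.2 q.2 else 0
  have h1 : (Matrix.of fun p q : Fin (m + 1) × Fin n =>
        ∑ l, Ψ p.1 p.2 l * Φ q.1 l q.2 - if p.1 < q.1 then G p.1 q.1 p.2 q.2 else 0) =
        -(D - B * A) := by
    ext p q
    simp [D, A, B, Matrix.mul_apply]
  rw [h1, Matrix.det_neg, ← Matrix.det_fromBlocks_one₁₁ A B D]
  set M := Matrix.fromBlocks (1 : Matrix (Fin n) (Fin n) ℝ) A B D with hM
  have h2 : (M.submatrix e f).det = ((Equiv.Perm.sign τ : ℤ) : ℝ) * M.det := by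
    have : M.submatrix e f = (M.submatrix τ id).submatrix f f := by
      ext p q; simp [τ]
    rw [this, Matrix.det_submatrix_equiv_self, Matrix.det_permute]
  have hsq : ((Equiv.Perm.sign τ : ℤ) : ℝ) * ((Equiv.Perm.sign τ : ℤ) : ℝ) = 1 := by
    rcases Int.units_eq_one_or (Equiv.Perm.sign τ) with h | h <;> simp [h]
  have h3 : M.det = ((Equiv.Perm.sign τ : ℤ) : ℝ) * (M.submatrix e f).det := by
    rw [h2, ← mul_assoc, hsq, one_mul]
  rw [h3, mul_assoc, ]
  congr 2
  have htri : (M.submatrix e f).BlockTriangular Prod.fst := by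
    rintro ⟨i, k⟩ ⟨j, l⟩ hij
    simp only at hij
    revert hij
    refine Fin.cases (fun h => absurd h (by simp)) (fun i => ?_) i
    refine Fin.lastCases (fun h => absurd h ?_) (fun j h => ?_) j
    · simp [Fin.le_last]
    · have : ¬ i < j := by
        simp only [Fin.lt_def, Fin.val_castSucc, Fin.val_succ] at h ⊢; omega
      simp [M, e, f, D, this]
  rw [htri.det_fintype]
  have hblock : ∀ i : Fin (m + 2), ((M.submatrix e f).toSquareBlock Prod.fst i).det =
      (Matrix.of fun k l : Fin n => M (e (i, k)) (f (i, l))).det := by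
    intro i
    let g : Fin n ≃ {p : Fin (m + 2) × Fin n // p.1 = i} :=
      { toFun := fun k => ⟨(i, k), rfl⟩
        invFun := fun p => p.1.2
        left_inv := fun k => rfl
        right_inv := by rintro ⟨⟨j, k⟩, rfl⟩; rfl }
    rw [← Matrix.det_submatrix_equiv_self g]
    rfl
  simp only [hblock]
  rw [Fin.prod_univ_succ, Fin.prod_univ_castSucc, ← mul_assoc]
  congr 1
  · congr 1
    · congr 1
      ext k l
      have hf : f ((0 : Fin (m + 2)), l) = Sum.inr (0, l) := hfc 0 l
      simp [M, e, hf, A]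
    · refine Finset.prod_congr rfl fun i _ => ?_
      congr 1
      ext k l
      have hf : f (i.castSucc.succ, l) = Sum.inr (i.succ, l) := hfc i.succ l
      have hi : i.castSucc < i.succ := Fin.castSucc_lt_succ
      simp only [Matrix.of_apply, hf, hes, M, D, Matrix.fromBlocks_apply₂₂, hi, if_true]
  · congr 1
    ext k l
    have hf : f ((Fin.last m).succ, l) = Sum.inl l := hfl l
    simp only [Matrix.of_apply, hf, hes, M, B, Matrix.fromBlocks_apply₂₁]

end NIBM

/-! ### Reproducing kernels: integrating out one point -/

namespace NIBM

/-- Relabelling a family of vectors by a bijection of the index sets. -/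
def flattenEquiv {ι L κ : Type*} (e : ι ≃ L × κ) : (L → κ → ℝ) ≃ᵐ (ι → ℝ) where
  toFun x l := x (e l).1 (e l).2
  invFun y i k := y (e.symm (i, k))
  left_inv x := by ext i k; simp
  right_inv y := by ext l; simp
  measurable_toFun := by
    refine measurable_pi_lambda _ fun l => ?_
    exact (measurable_pi_apply (e l).2).comp (measurable_pi_apply (X := fun _ => κ → ℝ) (e l).1)
  measurable_invFun := by
    refine measurable_pi_lambda _ fun i => measurable_pi_lambda _ fun k => ?_
    exact measurable_pi_apply _

theorem volume_preserving_flattenEquiv {ι L κ : Type*} [Fintype ι] [Fintype L] [Fintype κ]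
    (e : ι ≃ L × κ) : MeasurePreserving (flattenEquiv e) := by
  refine ⟨(flattenEquiv e).measurable, ?_⟩
  refine (Measure.pi_eq fun s hs => ?_).symm
  rw [Measure.map_apply (flattenEquiv e).measurable (MeasurableSet.univ_pi hs)]
  have : flattenEquiv e ⁻¹' Set.univ.pi s =
      Set.univ.pi fun i => Set.univ.pi fun k => s (e.symm (i, k)) := by
    ext x
    simp only [Set.mem_preimage, Set.mem_univ_pi]
    constructor
    · intro h i k
      simpa [flattenEquiv] using h (e.symm (i, k))
    · intro h l
      simpa [flattenEquiv] using h (e l).1 (e l).2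
  rw [this, volume_pi, Measure.pi_pi]
  simp_rw [volume_pi, Measure.pi_pi]
  rw [← Fintype.prod_prod_type', ← Equiv.prod_comp e]
  simp

variable {L : Type*}

/-- The determinant `det (K_{s_a s_b}(x_a, x_b))`. -/
noncomputable def corr {ι : Type*} [Fintype ι] [DecidableEq ι] (K : L → L → ℝ → ℝ → ℝ)
    (s : ι → L) (x : ι → ℝ) : ℝ :=
  (Matrix.of fun a b => K (s a) (s b) (x a) (x b)).det

/-- Kernels on finitely many layers whose correlation determinants reproduce under integration
of one variable. -/
structure IsReproducing [Fintype L] [LinearOrder L] (n : ℕ) (K : L → L → ℝ → ℝ → ℝ) : Prop where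
  measurable : ∀ i j, Measurable fun p : ℝ × ℝ => K i j p.1 p.2
  bound : ∃ g h : L → ℝ → ℝ, (∀ i j x y, |K i j x y| ≤ g i x * h j y) ∧
    ∀ i, Integrable fun x => g i x * h i x
  integral_diag : ∀ i, ∫ x, K i i x x = n
  integral_mul : ∀ i j l x z, ∫ y, K i j x y * K j l y z =
    ((if j ≤ i then 1 else 0) + (if l ≤ j then 1 else 0) - 1) * K i l x z
  corr_eq_zero : ∀ (k : ℕ) (s : Fin k → L) (x : Fin k → ℝ) (j : L),
    n < (Finset.univ.filter fun a => s a = j).card → corr K s x = 0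

theorem corr_comp {ι κ : Type*} [Fintype ι] [DecidableEq ι] [Fintype κ] [DecidableEq κ]
    (K : L → L → ℝ → ℝ → ℝ) (e : ι ≃ κ) (s : κ → L) (x : κ → ℝ) :
    corr K (s ∘ e) (x ∘ e) = corr K s x := by
  unfold corr
  rw [← Matrix.det_submatrix_equiv_self e]
  rfl

namespace IsReproducing

variable [Fintype L] [LinearOrder L] {n : ℕ} {K : L → L → ℝ → ℝ → ℝ}

theorem measurable_corr (hK : IsReproducing n K) {ι : Type*} [Fintype ι] [DecidableEq ι]
    (s : ι → L) : Measurable (corr K s) := by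
  unfold corr
  simp only [Matrix.det_apply, Matrix.of_apply]
  refine Finset.measurable_sum _ fun τ _ => ?_
  refine Measurable.const_smul (Finset.measurable_prod _ fun a _ => ?_) _
  have h : Measurable fun x : ι → ℝ => (x (τ a), x a) :=
    (measurable_pi_apply (τ a)).prodMk (measurable_pi_apply a)
  exact (hK.measurable (s (τ a)) (s a)).comp h

/-- Each term of the Leibniz formula is bounded by a product of values of `g` at permuted points and
of `h` at the original ones. Reindexing the `g` factors gives `∏ g h` for every permutation, so
integrability of the diagonal products `g i * h i` suffices. -/
theorem exists_abs_corr_le (hK : IsReproducing n K) {ι : Type*} [Fintype ι] [DecidableEq ι]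
    (s : ι → L) : ∃ F : ι → ℝ → ℝ, (∀ a, Integrable (F a)) ∧
      ∃ C, ∀ x, |corr K s x| ≤ C * ∏ a, F a (x a) := by
  obtain ⟨g, h, hb, hi⟩ := hK.bound
  refine ⟨fun a x => g (s a) x * h (s a) x, fun a => hi _, Fintype.card (Equiv.Perm ι), ?_⟩
  intro x
  unfold corr
  rw [Matrix.det_apply, Fintype.card, ← nsmul_eq_mul]
  refine (Finset.abs_sum_le_sum_abs _ _).trans (Finset.sum_le_card_nsmul _ _ _ fun τ _ => ?_)
  have : |Equiv.Perm.sign τ • ∏ i, (Matrix.of fun a b => K (s a) (s b) (x a) (x b)) (τ i) i| =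
      ∏ i, |K (s (τ i)) (s i) (x (τ i)) (x i)| := by
    rw [← Finset.abs_prod]
    rcases Int.units_eq_one_or (Equiv.Perm.sign τ) with h | h <;> simp [h]
  rw [this, Finset.prod_mul_distrib]
  rw [← Equiv.prod_comp τ fun a => g (s a) (x a), ← Finset.prod_mul_distrib]
  exact Finset.prod_le_prod (fun _ _ => abs_nonneg _) fun a _ => hb _ _ _ _

theorem integrable_corr (hK : IsReproducing n K) {ι : Type*} [Fintype ι] [DecidableEq ι]
    (s : ι → L) : Integrable (corr K s) := by
  obtain ⟨F, hF, C, hC⟩ := hK.exists_abs_corr_le s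
  exact ((Integrable.fintype_prod hF).const_mul C).mono'
    (hK.measurable_corr s).aestronglyMeasurable (ae_of_all _ hC)

theorem integrable_mul_corr (hK : IsReproducing n K) {ι : Type*} [Fintype ι] [DecidableEq ι]
    (s : ι → L) {f : (ι → ℝ) → ℝ} (hf : Measurable f) {C : ℝ} (hC : ∀ x, |f x| ≤ C) :
    Integrable fun x => f x * corr K s x :=
  (hK.integrable_corr s).bdd_mul hf.aestronglyMeasurable (ae_of_all _ hC)

theorem integrable_mul (hK : IsReproducing n K) (i j l : L) (x z : ℝ) :
    Integrable fun y => K i j x y * K j l y z := by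
  obtain ⟨g, h, hb, hi⟩ := hK.bound
  refine ((hi j).const_mul (g i x * h l z)).mono' ?_ (ae_of_all _ fun y => ?_)
  · exact ((hK.measurable i j).comp measurable_prodMk_left).mul
      ((hK.measurable j l).comp (measurable_id.prodMk measurable_const)) |>.aestronglyMeasurable
  · rw [Real.norm_eq_abs, abs_mul]
    calc _ ≤ (g i x * h j y) * (g j y * h l z) :=
          mul_le_mul (hb _ _ _ _) (hb _ _ _ _) (abs_nonneg _) ((abs_nonneg _).trans (hb _ _ _ _))
      _ = _ := by ring

theorem integrable_diag (hK : IsReproducing n K) (i : L) : Integrable fun y => K i i y y := by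
  obtain ⟨g, h, hb, hi⟩ := hK.bound
  refine (hi i).mono' ?_ (ae_of_all _ fun y => hb _ _ _ _)
  exact ((hK.measurable i i).comp (measurable_id.prodMk measurable_id)).aestronglyMeasurable

/-- Border by the new point and integrate. The diagonal term gives `n`. In the double sum the
reproducing coefficient splits into a part depending on the row and one depending on the column, so
Laplace expansion of `∑ A a b * adj b a` along a row or a column turns each into a multiple of `det
A`. What remains at index `a` is `1` exactly when `s a = j`. -/
theorem integral_corr_cons (hK : IsReproducing n K) {k : ℕ} (j : L) (s : Fin k → L)
    (x : Fin k → ℝ) :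
    ∫ y, corr K (Fin.cons j s : Fin (k + 1) → L) (Fin.cons y x : Fin (k + 1) → ℝ) =
      ((n : ℝ) - (Finset.univ.filter fun a => s a = j).card) * corr K s x := by
  set A : Matrix (Fin k) (Fin k) ℝ := Matrix.of fun a b => K (s a) (s b) (x a) (x b) with hA
  have h1 : ∀ y, corr K (Fin.cons j s : Fin (k + 1) → L) (Fin.cons y x : Fin (k + 1) → ℝ) =
      K j j y y * A.det - ∑ a, ∑ b, (K (s a) j (x a) y * K j (s b) y (x b)) * A.adjugate b a := by
    intro y
    rw [corr, det_bordered]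
    have : (Matrix.of fun a b : Fin (k + 1) =>
        K ((Fin.cons j s : Fin (k + 1) → L) a) ((Fin.cons j s : Fin (k + 1) → L) b)
        ((Fin.cons y x : Fin (k + 1) → ℝ) a)
          ((Fin.cons y x : Fin (k + 1) → ℝ) b)).submatrix Fin.succ Fin.succ = A := by
      ext a b; simp [A]
    rw [this]
    simp
  simp only [h1]
  have hi : ∀ a b, Integrable fun y =>
      (K (s a) j (x a) y * K j (s b) y (x b)) * A.adjugate b a :=
    fun a b => (hK.integrable_mul _ _ _ _ _).mul_const _
  rw [integral_sub ((hK.integrable_diag j).mul_const _)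
    (integrable_finsetSum _ fun a _ => integrable_finsetSum _ fun b _ => hi a b),
    integral_mul_const, hK.integral_diag, integral_finsetSum _ fun a _ =>
      integrable_finsetSum _ fun b _ => hi a b]
  simp_rw [integral_finsetSum Finset.univ fun b _ => hi _ b, integral_mul_const, hK.integral_mul]
  have h2 : ∀ a, ∑ b, A a b * A.adjugate b a = A.det := fun a =>
    (Matrix.det_eq_sum_mul_adjugate_row A a).symm
  have h3 : ∀ b, ∑ a, A a b * A.adjugate b a = A.det := fun b =>
    (Matrix.det_eq_sum_mul_adjugate_col A b).symm
  have h4 : ∑ a, ∑ b, ((if j ≤ s a then (1 : ℝ) else 0) + (if s b ≤ j then 1 else 0) - 1) *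
      K (s a) (s b) (x a) (x b) * A.adjugate b a =
      ∑ a, ((if j ≤ s a then (1 : ℝ) else 0) - 1) * A.det +
        ∑ b, (if s b ≤ j then (1 : ℝ) else 0) * A.det := by
    have : ∑ b, (if s b ≤ j then (1 : ℝ) else 0) * A.det =
        ∑ a, ∑ b, (if s b ≤ j then (1 : ℝ) else 0) * (A a b * A.adjugate b a) := by
      rw [Finset.sum_comm]
      refine Finset.sum_congr rfl fun b _ => ?_
      rw [← Finset.mul_sum, h3]
    rw [this, ← Finset.sum_add_distrib]
    refine Finset.sum_congr rfl fun a _ => ?_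
    rw [← h2 a, Finset.mul_sum, ← Finset.sum_add_distrib]
    refine Finset.sum_congr rfl fun b _ => ?_
    simp only [A, Matrix.of_apply]
    ring
  rw [h4, ← Finset.sum_add_distrib]
  have h5 : ∀ a, ((if j ≤ s a then (1 : ℝ) else 0) - 1) * A.det +
      (if s a ≤ j then (1 : ℝ) else 0) * A.det = (if s a = j then 1 else 0) * A.det := by
    intro a
    rcases lt_trichotomy (s a) j with h | h | h
    · simp [h.le, h.ne, not_le.2 h]
    · simp [h]
    · simp [h.le, h.ne', not_le.2 h]
  simp_rw [h5, ← Finset.sum_mul]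
  rw [Finset.sum_boole]
  change _ = _ * A.det
  ring

theorem integral_mul_corr_cons (hK : IsReproducing n K) {k : ℕ} (j : L) (s : Fin k → L)
    {f : (Fin k → ℝ) → ℝ} (hf : Measurable f) {C : ℝ} (hC : ∀ x, |f x| ≤ C) :
    ∫ z : Fin (k + 1) → ℝ, f (Fin.tail z) * corr K (Fin.cons j s : Fin (k + 1) → L) z =
      ((n : ℝ) - (Finset.univ.filter fun a => s a = j).card) * ∫ x, f x * corr K s x := by
  have hmp := (volume_preserving_piFinSuccAbove (fun _ : Fin (k + 1) => ℝ) 0).symm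
  have hint : Integrable fun z : Fin (k + 1) → ℝ =>
      f (Fin.tail z) * corr K (Fin.cons j s : Fin (k + 1) → L) z :=
    hK.integrable_mul_corr _ (hf.comp (measurable_pi_lambda _ fun a => measurable_pi_apply _))
      fun z => hC _
  have hval : ∀ p : ℝ × (Fin k → ℝ),
      (MeasurableEquiv.piFinSuccAbove (fun _ : Fin (k + 1) => ℝ) 0).symm p =
        (Fin.cons p.1 p.2 : Fin (k + 1) → ℝ) := fun p => by
    simp [MeasurableEquiv.piFinSuccAbove, Fin.insertNthEquiv]
  rw [← hmp.integral_comp' (g := fun z : Fin (k + 1) → ℝ =>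
      f (Fin.tail z) * corr K (Fin.cons j s : Fin (k + 1) → L) z)]
  have hint2 := (hmp.integrable_comp_emb (MeasurableEquiv.measurableEmbedding _)).2 hint
  simp only [hval, Function.comp_def, Fin.tail_cons] at hint2 ⊢
  rw [Measure.volume_eq_prod] at hint2 ⊢
  rw [integral_prod_symm _ hint2]
  simp only [integral_const_mul, hK.integral_corr_cons]
  rw [← integral_const_mul]
  congr 1 with x
  ring

end IsReproducing

end NIBM

/-! ### From the full determinant to all correlation functions -/

namespace NIBM

theorem ae_injective (ι : Type*) [Fintype ι] : ∀ᵐ y : ι → ℝ, Function.Injective y := by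
  have h : ∀ a b : ι, a ≠ b → ∀ᵐ y : ι → ℝ, y a ≠ y b := by
    intro a b hab
    let S : Submodule ℝ (ι → ℝ) :=
      LinearMap.ker ((LinearMap.proj a : (ι → ℝ) →ₗ[ℝ] ℝ) - LinearMap.proj b)
    have hS : S ≠ ⊤ := by
      classical
      intro h
      have : (Pi.single a 1 : ι → ℝ) ∈ S := h ▸ Submodule.mem_top
      simp [S, hab.symm] at this
    have := Measure.addHaar_submodule volume S hS
    rw [ae_iff]
    convert! this using 2
    ext y
    simp [S, sub_eq_zero]
  have h' : ∀ᵐ y : ι → ℝ, ∀ a b : ι, a ≠ b → y a ≠ y b := by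
    rw [ae_all_iff]; intro a; rw [ae_all_iff]; intro b
    by_cases hab : a = b
    · simp [hab]
    · simpa [hab] using h a b hab
  filter_upwards [h'] with y hy a b hab
  by_contra hne
  exact hy a b hne hab

variable {L : Type*}

/-- The labels `q` are increasing along the points `y` of each layer. -/
def LabelsSorted {k n : ℕ} (s : Fin k → L) (y : Fin k → ℝ) (q : Fin k → Fin n) : Prop :=
  ∀ l l', s l = s l' → q l < q l' → y l < y l'

/-- The label of a point must be its rank within its layer, that is, the number of points of the
layer strictly below it. -/
theorem existsUnique_labelsSorted [DecidableEq L] {k n : ℕ} {s : Fin k → L}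
    (hs : ∀ j, (Finset.univ.filter fun a => s a = j).card = n) {y : Fin k → ℝ}
    (hy : Function.Injective y) :
    ∃! q : Fin k → Fin n, Function.Injective (fun l => (s l, q l)) ∧ LabelsSorted s y q := by
  let R : Fin k → Finset (Fin k) := fun l => Finset.univ.filter fun l' => s l' = s l ∧ y l' < y l
  have hR : ∀ l, (R l).card < n := by
    intro l
    rw [← hs (s l)]
    refine Finset.card_lt_card (Finset.ssubset_iff_of_subset ?_ |>.2 ⟨l, by simp, by simp [R]⟩)
    intro l' hl'
    simp only [R, Finset.mem_filter, Finset.mem_univ, true_and] at hl' ⊢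
    exact hl'.1
  have hmono : ∀ l l', s l = s l' → y l < y l' → (R l).card < (R l').card := by
    intro l l' hl hlt
    refine Finset.card_lt_card (Finset.ssubset_iff_of_subset ?_ |>.2 ⟨l, ?_, by simp [R]⟩)
    · intro a ha
      simp only [R, Finset.mem_filter, Finset.mem_univ, true_and] at ha ⊢
      exact ⟨ha.1.trans hl, ha.2.trans hlt⟩
    · simp [R, hl, hlt]
  refine ⟨fun l => ⟨(R l).card, hR l⟩, ⟨?_, ?_⟩, ?_⟩
  · intro l l' h
    simp only [Prod.mk.injEq, Fin.mk.injEq] at h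
    by_contra hne
    rcases lt_or_gt_of_ne (hy.ne hne) with hlt | hlt
    · exact absurd h.2 (hmono l l' h.1 hlt).ne
    · exact absurd h.2 (hmono l' l h.1.symm hlt).ne'
  · intro l l' hl hlt
    by_contra! hle
    rcases hle.eq_or_lt with h | h
    · rw [hy h] at hlt; exact absurd hlt (lt_irrefl _)
    · exact absurd (hmono l' l hl.symm h) (not_lt.2 (le_of_lt hlt))
  · rintro q ⟨hq, hA⟩
    ext l
    have hsurj : ∀ j (v : Fin n), ∃ l', s l' = j ∧ q l' = v := by
      intro j v
      have hinj : Set.InjOn q (Finset.univ.filter fun a => s a = j : Finset (Fin k)) := by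
        intro a ha b hb hab
        simp only [Finset.coe_filter, Finset.mem_univ, true_and, Set.mem_ofPred_eq] at ha hb
        exact hq (Prod.ext (ha.trans hb.symm) hab)
      have himg : (Finset.univ.filter fun a => s a = j).image q = Finset.univ :=
        Finset.eq_univ_of_card _ (by rw [Finset.card_image_of_injOn hinj, hs j, Fintype.card_fin])
      have hv : v ∈ (Finset.univ.filter fun a => s a = j).image q := himg ▸ Finset.mem_univ v
      obtain ⟨l', hl', rfl⟩ := Finset.mem_image.1 hv
      exact ⟨l', (Finset.mem_filter.1 hl').2, rfl⟩
    have himg : (R l).image q = Finset.Iio (q l) := by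
      ext v
      simp only [Finset.mem_image, R, Finset.mem_filter, Finset.mem_univ, true_and,
        Finset.mem_Iio]
      constructor
      · rintro ⟨l', ⟨hl', hlt⟩, rfl⟩
        by_contra! hle
        rcases hle.eq_or_lt with h | h
        · have : l = l' := hq (Prod.ext hl'.symm h)
          rw [this] at hlt; exact lt_irrefl _ hlt
        · exact absurd (hA l l' hl'.symm h) (not_lt.2 hlt.le)
      · intro hv
        obtain ⟨l', hl', rfl⟩ := hsurj (s l) v
        exact ⟨l', ⟨hl', hA l' l hl' hv⟩, rfl⟩
    have hinj : Set.InjOn q (R l) := by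
      intro a ha b hb hab
      simp only [R, Finset.coe_filter, Finset.mem_univ, true_and, Set.mem_ofPred_eq] at ha hb
      exact hq (Prod.ext (ha.1.trans hb.1.symm) hab)
    change (q l : ℕ) = (R l).card
    rw [← Finset.card_image_of_injOn hinj, himg, Fin.card_Iio]

/-- Configurations with ordered points in each layer. -/
def configs (L : Type*) (n : ℕ) : Set (L → Fin n → ℝ) := {x | ∀ i, x i ∈ chamber n}

theorem measurableSet_chamber (n : ℕ) : MeasurableSet (chamber n) := by
  have : chamber n = ⋂ i : Fin n, ⋂ j : Fin n, ⋂ _ : i < j, {a | a i < a j} := by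
    ext a; simp [chamber, StrictMono]
  rw [this]
  exact MeasurableSet.iInter fun i => MeasurableSet.iInter fun j => MeasurableSet.iInter fun _ =>
    measurableSet_lt (measurable_pi_apply i) (measurable_pi_apply j)

theorem measurableSet_configs (L : Type*) [Countable L] (n : ℕ) :
    MeasurableSet (configs L n) := by
  have : configs L n = ⋂ i, (fun x : L → Fin n → ℝ => x i) ⁻¹' chamber n := by
    ext x; simp [configs]
  rw [this]
  exact MeasurableSet.iInter fun i => measurable_pi_apply i (measurableSet_chamber n)

/-- The determinant over all points of a configuration. -/
noncomputable def fullDet [Fintype L] [DecidableEq L] {n : ℕ} (K : L → L → ℝ → ℝ → ℝ)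
    (x : L → Fin n → ℝ) : ℝ :=
  corr K (fun p : L × Fin n => p.1) (fun p => x p.1 p.2)

/-- The expected sum of `f` over tuples of distinct particles equals the integral of `f` against
the correlation determinant. -/
def CorrelationIdentity [Fintype L] [DecidableEq L] (n : ℕ) (K : L → L → ℝ → ℝ → ℝ) {k : ℕ}
    (s : Fin k → L) : Prop :=
  ∀ f : (Fin k → ℝ) → ℝ, Measurable f → (∃ C, ∀ x, |f x| ≤ C) →
    ∫ x in configs L n,
      (∑ q : Fin k → Fin n with Function.Injective (fun l => (s l, q l)),
        f (fun l => x (s l) (q l))) * fullDet K x = ∫ x, f x * corr K s x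

namespace IsReproducing

variable [Fintype L] [LinearOrder L] {n : ℕ} {K : L → L → ℝ → ℝ → ℝ}

theorem integrable_mul_fullDet (hK : IsReproducing n K) {f : (L → Fin n → ℝ) → ℝ}
    (hf : Measurable f) {C : ℝ} (hC : ∀ x, |f x| ≤ C) :
    Integrable fun x => f x * fullDet K x := by
  have hmp := volume_preserving_flattenEquiv (Equiv.refl (L × Fin n))
  have h := (hmp.integrable_comp_emb (MeasurableEquiv.measurableEmbedding _)).2
    (hK.integrable_corr (fun p : L × Fin n => p.1))
  exact h.bdd_mul hf.aestronglyMeasurable (ae_of_all _ hC)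

/-- When every particle is listed, an admissible `q` is a bijection onto `L × Fin n`, hence a
measure-preserving relabelling of coordinates. Ordered configurations become the region of `y` for
which `q` is sorted, and these regions tile the space up to a null set. -/
theorem correlationIdentity_of_card_eq (hK : IsReproducing n K) {k : ℕ} {s : Fin k → L}
    (hs : ∀ j, (Finset.univ.filter fun a => s a = j).card = n) : CorrelationIdentity n K s := by
  rintro f hf ⟨C, hC⟩
  have hcard : Fintype.card (Fin k) = Fintype.card (L × Fin n) := by
    rw [← Finset.card_univ, Finset.card_eq_sum_card_fiberwise (f := s) (t := Finset.univ)
      (fun _ _ => Finset.mem_univ _)]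
    simp [hs]
  classical
  have hmeasx : ∀ q : Fin k → Fin n, Measurable fun x : L → Fin n → ℝ => fun l => x (s l) (q l) :=
    fun q => measurable_pi_lambda _ fun l =>
      (measurable_pi_apply (q l)).comp (measurable_pi_apply (X := fun _ => Fin n → ℝ) (s l))
  have key : ∀ q : Fin k → Fin n, Function.Injective (fun l => (s l, q l)) →
      ∫ x in configs L n, f (fun l => x (s l) (q l)) * fullDet K x =
        ∫ y, (if LabelsSorted s y q then 1 else 0) * (f y * corr K s y) := by
    intro q hq
    let e : Fin k ≃ L × Fin n :=
      Equiv.ofBijective _ ((Fintype.bijective_iff_injective_and_card _).2 ⟨hq, hcard⟩)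
    have he : ∀ l, e l = (s l, q l) := fun l => rfl
    rw [← integral_indicator (measurableSet_configs L n),
      ← (volume_preserving_flattenEquiv e).integral_comp']
    congr 1 with x
    have h1 : (flattenEquiv e) x = fun l => x (s l) (q l) := rfl
    have h2 : fullDet K x = corr K s (flattenEquiv e x) := by
      have := corr_comp K e (fun p : L × Fin n => p.1) (fun p => x p.1 p.2)
      exact this.symm
    have h3 : LabelsSorted s (flattenEquiv e x) q ↔ x ∈ configs L n := by
      rw [h1]
      constructor
      · intro h i a b hab
        have ha := h (e.symm (i, a)) (e.symm (i, b))
        have h4 : ∀ c, s (e.symm (i, c)) = i ∧ q (e.symm (i, c)) = c := by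
          intro c
          have := he (e.symm (i, c))
          rw [Equiv.apply_symm_apply, Prod.mk.injEq] at this
          exact ⟨this.1.symm, this.2.symm⟩
        simp only [(h4 a).1, (h4 a).2, (h4 b).1, (h4 b).2] at ha
        exact ha trivial hab
      · intro h l l' hl hlt
        change x (s l) (q l) < x (s l') (q l')
        rw [hl]
        exact h (s l') hlt
    by_cases hx : x ∈ configs L n
    · rw [Set.indicator_of_mem hx, if_pos (h3.2 hx), h2, h1, one_mul]
    · rw [Set.indicator_of_notMem hx, if_neg (fun h => hx (h3.1 h)), zero_mul]
  simp_rw [Finset.sum_mul]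
  have hint : ∀ q : Fin k → Fin n,
      IntegrableOn (fun x => f (fun l => x (s l) (q l)) * fullDet K x) (configs L n) := fun q =>
    (hK.integrable_mul_fullDet (hf.comp (hmeasx q)) fun x => hC _).integrableOn
  rw [integral_finsetSum _ fun q _ => hint q]
  rw [Finset.sum_congr rfl fun q hq => key q (Finset.mem_filter.1 hq).2]
  have hmeasA : ∀ q : Fin k → Fin n, MeasurableSet {y | LabelsSorted s y q} := by
    intro q
    have : {y | LabelsSorted s y q} = ⋂ l, ⋂ l', ⋂ _ : s l = s l', ⋂ _ : q l < q l',
        {y : Fin k → ℝ | y l < y l'} := by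
      ext y; simp [LabelsSorted]
    rw [this]
    exact MeasurableSet.iInter fun l => MeasurableSet.iInter fun l' => MeasurableSet.iInter
      fun _ => MeasurableSet.iInter fun _ =>
        measurableSet_lt (measurable_pi_apply l) (measurable_pi_apply l')
  -- For almost every `y` the coordinates are distinct, so exactly one admissible `q` is sorted and
  -- the indicators add up to `1`.
  rw [← integral_finsetSum]
  · refine integral_congr_ae ?_
    filter_upwards [ae_injective (Fin k)] with y hy
    obtain ⟨q₀, ⟨hq₀, hA₀⟩, huniq⟩ := existsUnique_labelsSorted (n := n) hs hy
    rw [← Finset.sum_mul, Finset.sum_eq_single q₀]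
    · rw [if_pos hA₀, one_mul]
    · intro q hq hne
      rw [if_neg]
      intro h
      exact hne (huniq q ⟨(Finset.mem_filter.1 hq).2, h⟩)
    · intro h
      refine absurd ?_ h
      rw [Finset.mem_filter]
      exact ⟨Finset.mem_univ _, hq₀⟩
  · intro q _
    refine (hK.integrable_mul_corr s hf hC).bdd_mul (c := 1) ?_ (ae_of_all _ fun y => ?_)
    · exact (Measurable.ite (hmeasA q) measurable_const measurable_const).aestronglyMeasurable
    · split_ifs <;> simp

/-- Apply the identity with one more point to a function that ignores it. The integral side gains
the factor `n - c` by `integral_mul_corr_cons`; on the particle side each `q` extends in `n - c`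
ways, one for each unused particle of layer `j`. The factor is positive and cancels. -/
theorem correlationIdentity_of_cons (hK : IsReproducing n K) {k : ℕ} {s : Fin k → L} {j : L}
    (hj : (Finset.univ.filter fun a => s a = j).card < n)
    (h : CorrelationIdentity n K (Fin.cons j s : Fin (k + 1) → L)) :
    CorrelationIdentity n K s := by
  rintro f hf ⟨C, hC⟩
  have h1 := h (fun z => f (Fin.tail z))
    (hf.comp (measurable_pi_lambda _ fun a => measurable_pi_apply _)) ⟨C, fun z => hC _⟩
  rw [hK.integral_mul_corr_cons j s hf hC] at h1
  set c := (Finset.univ.filter fun a => s a = j).card with hc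
  have hpos : (0 : ℝ) < (n : ℝ) - c := sub_pos.2 (by exact_mod_cast hj)
  refine mul_left_cancel₀ hpos.ne' (Eq.trans ?_ h1)
  rw [← integral_const_mul]
  congr 1 with x
  rw [← mul_assoc]
  congr 1
  classical
  rw [Finset.sum_filter, Finset.sum_filter, ← (Fin.consEquiv fun _ : Fin (k + 1) => Fin n).sum_comp,
    Fintype.sum_prod_type_right, Finset.mul_sum]
  refine Finset.sum_congr rfl fun q _ => ?_
  have hiff : ∀ q0 : Fin n, Function.Injective (fun l : Fin (k + 1) =>
      ((Fin.cons j s : Fin (k + 1) → L) l, (Fin.cons q0 q : Fin (k + 1) → Fin n) l)) ↔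
      Function.Injective (fun l => (s l, q l)) ∧
        q0 ∉ (Finset.univ.filter fun a => s a = j).image q := by
    intro q0
    have : (fun l : Fin (k + 1) =>
      ((Fin.cons j s : Fin (k + 1) → L) l, (Fin.cons q0 q : Fin (k + 1) → Fin n) l)) =
      (Fin.cons (j, q0) (fun l => (s l, q l)) : Fin (k + 1) → L × Fin n) := by
      ext l <;> refine Fin.cases ?_ (fun l => ?_) l <;> simp
    rw [this, Fin.cons_injective_iff, and_comm]
    simp [Set.mem_range]
  by_cases hq : Function.Injective (fun l => (s l, q l))
  · rw [if_pos hq]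
    have hterm : ∀ q0 : Fin n, (if Function.Injective (fun l : Fin (k + 1) =>
        ((Fin.cons j s : Fin (k + 1) → L) l,
          ((Fin.consEquiv fun _ : Fin (k + 1) => Fin n) (q0, q)) l)) then
        f (Fin.tail fun l => x ((Fin.cons j s : Fin (k + 1) → L) l)
          (((Fin.consEquiv fun _ : Fin (k + 1) => Fin n) (q0, q)) l)) else 0) =
        if q0 ∈ ((Finset.univ.filter fun a => s a = j).image q)ᶜ then
          f (fun l => x (s l) (q l)) else 0 := by
      intro q0
      have h2 : (Fin.tail fun l => x ((Fin.cons j s : Fin (k + 1) → L) l)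
          (((Fin.consEquiv fun _ : Fin (k + 1) => Fin n) (q0, q)) l)) =
          fun l => x (s l) (q l) := by
        ext l; simp [Fin.tail, Fin.consEquiv]
      rw [h2]
      refine if_congr ?_ rfl rfl
      rw [Finset.mem_compl]
      exact (hiff q0).trans (and_iff_right hq)
    rw [Finset.sum_congr rfl fun q0 _ => hterm q0, ← Finset.sum_filter, Finset.sum_const,
      nsmul_eq_mul]
    congr 1
    rw [Finset.filter_mem_eq_inter, Finset.univ_inter, Finset.card_compl,
      Finset.card_image_of_injOn, Fintype.card_fin, Nat.cast_sub hj.le]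
    intro a ha b hb hab
    simp only [Finset.coe_filter, Finset.mem_univ, true_and, Set.mem_ofPred_eq] at ha hb
    exact hq (Prod.ext (ha.trans hb.symm) hab)
  · rw [if_neg hq, mul_zero]
    symm
    refine Finset.sum_eq_zero fun q0 _ => if_neg fun h => hq ?_
    exact ((hiff q0).1 h).1

/-- Induction on the number of particles missing from the list. If some layer is asked for more than
`n` points, the determinant vanishes and no admissible `q` exists, so both sides are `0`. -/
theorem correlationIdentity (hK : IsReproducing n K) {k : ℕ} (s : Fin k → L) :
    CorrelationIdentity n K s := by
  by_cases hs : ∀ j, (Finset.univ.filter fun a => s a = j).card ≤ n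
  · obtain ⟨r, hr⟩ : ∃ r, r = ∑ j, (n - (Finset.univ.filter fun a => s a = j).card) := ⟨_, rfl⟩
    induction r generalizing k s with
    | zero =>
      refine hK.correlationIdentity_of_card_eq fun j => le_antisymm (hs j) ?_
      have := (Finset.sum_eq_zero_iff.1 hr.symm) j (Finset.mem_univ j)
      omega
    | succ r ih =>
      obtain ⟨j, hj⟩ : ∃ j, (Finset.univ.filter fun a => s a = j).card < n := by
        by_contra! hc
        have : ∑ j, (n - (Finset.univ.filter fun a => s a = j).card) = 0 :=
          Finset.sum_eq_zero fun j _ => Nat.sub_eq_zero_of_le (hc j)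
        omega
      have hcard : ∀ i, (Finset.univ.filter fun a => (Fin.cons j s : Fin (k + 1) → L) a = i).card =
          (Finset.univ.filter fun a => s a = i).card + if j = i then 1 else 0 := by
        intro i
        rw [Finset.card_filter, Fin.sum_univ_succ, Finset.card_filter]
        simp [add_comm]
      refine hK.correlationIdentity_of_cons hj (ih _ (fun i => ?_) ?_)
      · rw [hcard]
        split_ifs with h
        · subst h; omega
        · simpa using hs i
      · have h1 : ∀ i, n - (Finset.univ.filter fun a => s a = i).card =
            (n - (Finset.univ.filter fun a => (Fin.cons j s : Fin (k + 1) → L) a = i).card) +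
              if j = i then 1 else 0 := by
          intro i
          rw [hcard]
          split_ifs with h
          · subst h; omega
          · simp
        simp_rw [h1, Finset.sum_add_distrib] at hr
        simp only [Finset.sum_ite_eq, Finset.mem_univ, if_true] at hr
        omega
  · push Not at hs
    obtain ⟨j, hj⟩ := hs
    rintro f hf -
    have h1 : ∀ x, f x * corr K s x = 0 := fun x => by rw [hK.corr_eq_zero k s x j hj, mul_zero]
    have h2 : (Finset.univ.filter fun q : Fin k → Fin n =>
        Function.Injective (fun l => (s l, q l))) = ∅ := by
      rw [Finset.filter_eq_empty_iff]
      intro q _ hq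
      have : (Finset.univ.filter fun a => s a = j).card ≤ (Finset.univ : Finset (Fin n)).card := by
        refine Finset.card_le_card_of_injOn q (fun _ _ => Finset.mem_univ _) ?_
        intro a ha b hb hab
        simp only [Finset.coe_filter, Finset.mem_univ, true_and, Set.mem_ofPred_eq] at ha hb
        exact hq (Prod.ext (ha.trans hb.symm) hab)
      rw [Finset.card_univ, Fintype.card_fin] at this
      omega
    simp only [h1, h2, Finset.sum_empty, zero_mul, integral_zero]

end IsReproducing

end NIBM

namespace NIBM

open Polynomial

/-! ### Polynomial weights -/

theorem one_add_abs_pow_mul_exp_le {a : ℝ} (ha : 0 < a) (N : ℕ) (z : ℝ) :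
    (1 + |z|) ^ N * Real.exp (-(a * z ^ 2)) ≤ Real.exp (N ^ 2 / (4 * a)) := by
  have h1 : (1 + |z|) ^ N ≤ Real.exp (N * |z|) := by
    rw [Real.exp_nat_mul]
    refine pow_le_pow_left₀ (by positivity) ?_ N
    linarith [Real.add_one_le_exp |z|]
  calc _ ≤ Real.exp (N * |z|) * Real.exp (-(a * z ^ 2)) := by gcongr
    _ = Real.exp (N * |z| - a * z ^ 2) := by rw [← Real.exp_add, sub_eq_add_neg]
    _ ≤ _ := by
      refine Real.exp_le_exp.2 ?_
      rw [le_div_iff₀ (by positivity), ← sq_abs z]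
      nlinarith [sq_nonneg (2 * a * |z| - N)]

theorem one_add_abs_le_mul (y u : ℝ) : 1 + |y| ≤ (1 + |y - u|) * (1 + |u|) := by
  have : |y| ≤ |y - u| + |u| := by simpa using abs_add_le (y - u) u
  nlinarith [abs_nonneg (y - u), abs_nonneg u, mul_nonneg (abs_nonneg (y - u)) (abs_nonneg u)]

theorem exp_neg_sq_sub_le {a : ℝ} (ha : 0 < a) (N : ℕ) (y u : ℝ) :
    Real.exp (-(a * (y - u) ^ 2)) ≤
      Real.exp (N ^ 2 / (4 * a)) * (1 + |u|) ^ N * ((1 + |y|) ^ N)⁻¹ := by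
  rw [← div_eq_mul_inv, le_div_iff₀ (by positivity)]
  calc _ ≤ Real.exp (-(a * (y - u) ^ 2)) * ((1 + |y - u|) * (1 + |u|)) ^ N := by
        gcongr; exact one_add_abs_le_mul y u
    _ = ((1 + |y - u|) ^ N * Real.exp (-(a * (y - u) ^ 2))) * (1 + |u|) ^ N := by
        rw [mul_pow]; ring
    _ ≤ _ := by gcongr; exact one_add_abs_pow_mul_exp_le ha N _

theorem integrable_one_add_abs_inv : Integrable fun x : ℝ => ((1 + |x|) ^ 2)⁻¹ := by
  have := integrable_one_add_norm (E := ℝ) (μ := volume) (r := 2) (by simp)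
  refine this.congr (ae_of_all _ fun x => ?_)
  simp only [Real.norm_eq_abs]
  rw [Real.rpow_neg (by positivity)]
  norm_num

theorem exists_abs_eval_le (p : ℝ[X]) (N : ℕ) (hN : p.natDegree ≤ N) :
    ∃ C, 0 ≤ C ∧ ∀ x, |p.eval x| ≤ C * (1 + |x|) ^ N := by
  refine ⟨∑ k ∈ Finset.range (p.natDegree + 1), |p.coeff k|,
    Finset.sum_nonneg fun _ _ => abs_nonneg _, fun x => ?_⟩
  rw [eval_eq_sum_range, Finset.sum_mul]
  refine (Finset.abs_sum_le_sum_abs _ _).trans (Finset.sum_le_sum fun k hk => ?_)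
  rw [abs_mul, abs_pow]
  gcongr
  calc |x| ^ k ≤ (1 + |x|) ^ k := by gcongr; linarith
    _ ≤ (1 + |x|) ^ N := by
      refine pow_le_pow_right₀ (by linarith [abs_nonneg x]) ?_
      have := Finset.mem_range.1 hk
      omega

/-- A function decaying faster than every power. -/
def RapidDecay (f : ℝ → ℝ) : Prop :=
  ∀ N : ℕ, ∃ C, 0 ≤ C ∧ ∀ x, |f x| ≤ C * ((1 + |x|) ^ N)⁻¹

theorem RapidDecay.mul_poly {f : ℝ → ℝ} (hf : RapidDecay f) (p : ℝ[X]) :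
    RapidDecay fun x => f x * p.eval x := by
  intro N
  obtain ⟨C, hC0, hC⟩ := hf (N + p.natDegree)
  obtain ⟨D, hD0, hD⟩ := exists_abs_eval_le p _ le_rfl
  refine ⟨C * D, by positivity, fun x => ?_⟩
  rw [abs_mul]
  calc _ ≤ (C * ((1 + |x|) ^ (N + p.natDegree))⁻¹) * (D * (1 + |x|) ^ p.natDegree) := by
        gcongr; exacts [hC x, hD x]
    _ = _ := by
      have : (0 : ℝ) < 1 + |x| := by positivity
      rw [pow_add]; field_simp

theorem RapidDecay.integrable {f : ℝ → ℝ} (hf : RapidDecay f)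
    (hm : AEStronglyMeasurable f) : Integrable f := by
  obtain ⟨C, -, hC⟩ := hf 2
  exact (integrable_one_add_abs_inv.const_mul C).mono' hm (ae_of_all _ hC)

theorem rapidDecay_gaussianPDFReal (μ : ℝ) {v : ℝ≥0} (hv : v ≠ 0) :
    RapidDecay (gaussianPDFReal μ v) := by
  intro N
  have hv' : (0 : ℝ) < v := by positivity
  refine ⟨(√(2 * Real.pi * v))⁻¹ * (Real.exp (N ^ 2 / (4 * (1 / (2 * v)))) * (1 + |μ|) ^ N),
    by positivity, fun x => ?_⟩
  have := exp_neg_sq_sub_le (a := 1 / (2 * (v : ℝ))) (by positivity) N x μ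
  have he : -(x - μ) ^ 2 / (2 * (v : ℝ)) = -(1 / (2 * (v : ℝ)) * (x - μ) ^ 2) := by ring
  rw [abs_of_nonneg (gaussianPDFReal_nonneg _ _ _), gaussianPDFReal, he,
    mul_assoc (√(2 * Real.pi * v))⁻¹]
  gcongr

/-! ### Heat polynomials -/

/-- The polynomials `h_k` with `h_{k+1} = x h_k - v k h_{k-1}`. -/
noncomputable def heatPoly (v : ℝ) : ℕ → ℝ[X]
  | 0 => 1
  | 1 => X
  | (k + 2) => X * heatPoly v (k + 1) - C (v * (k + 1)) * heatPoly v k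

theorem heatPoly_succ (v : ℝ) (k : ℕ) :
    heatPoly v (k + 1) = X * heatPoly v k - C (v * k) * heatPoly v (k - 1) := by
  cases k with
  | zero => simp [heatPoly]
  | succ k => simp [heatPoly]

theorem heatPoly_monic_natDegree (v : ℝ) (k : ℕ) :
    (heatPoly v k).Monic ∧ (heatPoly v k).natDegree = k := by
  induction k using Nat.twoStepInduction with
  | zero => simp [heatPoly]
  | one => simp [heatPoly, monic_X]
  | more k ih0 ih1 =>
    have h1 : (X * heatPoly v (k + 1)).Monic := monic_X.mul ih1.1
    have h2 : (X * heatPoly v (k + 1)).natDegree = k + 2 := by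
      rw [monic_X.natDegree_mul ih1.1, ih1.2, natDegree_X]; ring
    have h3 : (C (v * (k + 1)) * heatPoly v k).natDegree < (X * heatPoly v (k + 1)).natDegree := by
      rw [h2]
      exact (natDegree_C_mul_le _ _).trans_lt (by rw [ih0.2]; omega)
    have h4 : (C (v * (k + 1)) * heatPoly v k).degree < (X * heatPoly v (k + 1)).degree :=
      degree_lt_degree h3
    simp only [heatPoly]
    exact ⟨h1.sub_of_left h4, by rw [natDegree_sub_eq_left_of_natDegree_lt h3, h2]⟩

/-- The Appell property: `heatPoly v k` is `exp (-(v/2) D²)` applied to `X ^ k`, and this operator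
commutes with differentiation. -/
theorem derivative_heatPoly (v : ℝ) (k : ℕ) :
    derivative (heatPoly v k) = C (k : ℝ) * heatPoly v (k - 1) := by
  induction k using Nat.twoStepInduction with
  | zero => simp [heatPoly]
  | one => simp [heatPoly]
  | more k ih0 ih1 =>
    rw [heatPoly, derivative_sub, derivative_mul, derivative_C_mul, ih0, ih1]
    have := heatPoly_succ v k
    simp only [derivative_X, Nat.add_sub_cancel]
    rw [show k + 2 - 1 = k + 1 from rfl, this]
    push_cast
    simp only [map_add, map_mul, map_natCast, map_one, map_ofNat]
    ring

theorem heatPoly_zero (k : ℕ) : heatPoly 0 k = X ^ k := by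
  induction k with
  | zero => simp [heatPoly]
  | succ k ih => rw [heatPoly_succ, ih]; simp [pow_succ']

theorem integrable_gaussianPDFReal_mul_eval (μ : ℝ) {v : ℝ≥0} (hv : v ≠ 0) (p : ℝ[X]) :
    Integrable fun y => gaussianPDFReal μ v y * p.eval y :=
  ((rapidDecay_gaussianPDFReal μ hv).mul_poly p).integrable
    ((measurable_gaussianPDFReal μ v).mul p.continuous.measurable).aestronglyMeasurable

theorem hasDerivAt_gaussianPDFReal (μ : ℝ) {v : ℝ≥0} (hv : v ≠ 0) (y : ℝ) :
    HasDerivAt (gaussianPDFReal μ v) (-(y - μ) / v * gaussianPDFReal μ v y) y := by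
  have hv' : (v : ℝ) ≠ 0 := by exact_mod_cast hv
  have h1 : HasDerivAt (fun y : ℝ => -(y - μ) ^ 2 / (2 * v)) (-(y - μ) / v) y := by
    have := ((((hasDerivAt_id y).sub_const μ).pow 2).neg).div_const (2 * (v : ℝ))
    refine this.congr_deriv ?_
    simp only [id]
    field_simp
    norm_num
    ring
  have h2 := (h1.exp).const_mul (√(2 * Real.pi * v))⁻¹
  refine h2.congr_deriv ?_
  simp only [gaussianPDFReal]; ring

/-- Stein's identity: the integral of the derivative of density times polynomial vanishes. It turns
multiplication by `X` into the recursion that defines `heatPoly`. -/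
theorem integral_gaussianPDFReal_stein (μ : ℝ) {v : ℝ≥0} (hv : v ≠ 0) (p : ℝ[X]) :
    ∫ y, gaussianPDFReal μ v y * (X * p).eval y =
      μ * (∫ y, gaussianPDFReal μ v y * p.eval y) +
        v * ∫ y, gaussianPDFReal μ v y * (derivative p).eval y := by
  have hv' : (v : ℝ) ≠ 0 := by exact_mod_cast hv
  have hi := integrable_gaussianPDFReal_mul_eval μ hv
  have hd : ∀ y, HasDerivAt (fun y => gaussianPDFReal μ v y * p.eval y)
      (-(v : ℝ)⁻¹ * (gaussianPDFReal μ v y * (X * p).eval y) +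
        (v : ℝ)⁻¹ * μ * (gaussianPDFReal μ v y * p.eval y) +
        gaussianPDFReal μ v y * (derivative p).eval y) y := by
    intro y
    refine ((hasDerivAt_gaussianPDFReal μ hv y).mul (p.hasDerivAt y)).congr_deriv ?_
    rw [eval_mul, eval_X]
    field_simp
    ring
  have h0 := integral_eq_zero_of_hasDerivAt_of_integrable hd
    ((((hi (X * p)).const_mul _).add ((hi p).const_mul _)).add (hi (derivative p))) (hi p)
  have i1 := (hi (X * p)).const_mul (-(v : ℝ)⁻¹)
  have i2 := (hi p).const_mul ((v : ℝ)⁻¹ * μ)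
  have i3 := i1.add i2
  simp only [Pi.add_def] at i3
  rw [integral_add i3 (hi (derivative p)), integral_add i1 i2, integral_const_mul, integral_const_mul] at h0
  field_simp at h0
  linarith

/-- Averaging a polynomial over a Gaussian of variance `v` is the operator `exp ((v/2) D²)`, which
undoes an amount `v` of the backward heat flow. -/
theorem integral_gaussianPDFReal_heatPoly (μ w : ℝ) {v : ℝ≥0} (hv : v ≠ 0) (k : ℕ) :
    ∫ y, gaussianPDFReal μ v y * (heatPoly w k).eval y = (heatPoly (w - v) k).eval μ := by
  have hi := integrable_gaussianPDFReal_mul_eval μ hv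
  induction k using Nat.strong_induction_on with
  | _ k ih =>
    cases k with
    | zero => simp [heatPoly, integral_gaussianPDFReal_eq_one μ hv]
    | succ k =>
      rw [heatPoly_succ w, heatPoly_succ]
      simp only [eval_sub, mul_sub]
      rw [integral_sub (hi _) (hi _), integral_gaussianPDFReal_stein μ hv, derivative_heatPoly]
      have hc : ∀ c : ℝ, ∫ y, gaussianPDFReal μ v y * (C c * heatPoly w (k - 1)).eval y =
          c * (heatPoly (w - v) (k - 1)).eval μ := by
        intro c
        rw [← ih (k - 1) (by omega), ← integral_const_mul]
        congr 1 with y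
        rw [eval_mul, eval_C]; ring
      rw [hc, hc, ih k (by omega)]
      simp only [eval_mul, eval_X, eval_C]
      ring

/-- The operator `exp (-(v / 2) D²)` on polynomials. -/
noncomputable def heatInv (v : ℝ) (p : ℝ[X]) : ℝ[X] := p.sum fun k a => C a * heatPoly v k

theorem heatInv_zero (p : ℝ[X]) : heatInv 0 p = p := by
  simp only [heatInv, heatPoly_zero]
  exact p.sum_C_mul_X_pow_eq

theorem integral_gaussianPDFReal_heatInv (μ w : ℝ) {v : ℝ≥0} (hv : v ≠ 0) (p : ℝ[X]) :
    ∫ y, gaussianPDFReal μ v y * (heatInv w p).eval y = (heatInv (w - v) p).eval μ := by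
  simp only [heatInv, Polynomial.sum, eval_finsetSum, Finset.mul_sum]
  rw [integral_finsetSum _ fun k _ => integrable_gaussianPDFReal_mul_eval μ hv _]
  refine Finset.sum_congr rfl fun k _ => ?_
  simp only [eval_mul, eval_C]
  rw [← integral_gaussianPDFReal_heatPoly μ w hv k, ← integral_const_mul]
  congr 1 with y
  ring

/-- The operator changes a polynomial only by terms of lower degree. This is what makes the `ψ_l` at
the last time a polynomial family whose determinant is a multiple of the Vandermonde product. -/
theorem heatInv_natDegree_leadingCoeff (v : ℝ) (p : ℝ[X]) :
    (heatInv v p).natDegree = p.natDegree ∧ (heatInv v p).leadingCoeff = p.leadingCoeff := by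
  by_cases hp : p = 0
  · simp [hp, heatInv]
  have hd : (heatInv v p).natDegree ≤ p.natDegree := by
    unfold heatInv Polynomial.sum
    refine natDegree_sum_le_of_forall_le _ _ fun k hk => ?_
    refine (natDegree_C_mul_le _ _).trans ?_
    rw [(heatPoly_monic_natDegree v k).2]
    exact le_natDegree_of_mem_supp k hk
  have hc : (heatInv v p).coeff p.natDegree = p.leadingCoeff := by
    unfold heatInv Polynomial.sum
    rw [finsetSum_coeff, Finset.sum_eq_single p.natDegree]
    · rw [coeff_C_mul]
      have h := heatPoly_monic_natDegree v p.natDegree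
      have : (heatPoly v p.natDegree).coeff p.natDegree = 1 := by
        conv_lhs => rw [← h.2]
        rw [h.2]
        have := h.1.coeff_natDegree
        rwa [h.2] at this
      rw [this, mul_one]; rfl
    · intro k hk hne
      rw [coeff_C_mul, coeff_eq_zero_of_natDegree_lt (p := heatPoly v k), mul_zero]
      rw [(heatPoly_monic_natDegree v k).2]
      exact lt_of_le_of_ne (le_natDegree_of_mem_supp k hk) hne
    · intro h
      rw [notMem_support_iff.1 h]; simp
  have hd' : (heatInv v p).natDegree = p.natDegree := by
    refine le_antisymm hd (le_natDegree_of_ne_zero ?_)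
    rw [hc]; exact leadingCoeff_ne_zero.2 hp
  exact ⟨hd', by rw [leadingCoeff, hd', hc]⟩

end NIBM

/-! ### Transport of polynomials and weights along the bridge to `0` -/

namespace NIBM

open Polynomial

/-- Completing the square in `y`: up to the factor `√((1-t)/(1-s))`, `G` is the transition density
of the Brownian bridge that ends at `0` at time `1`. -/
theorem gaussianPart_eq {n : ℕ} (hn : 0 < n) {s t : ℝ} (hst : s < t) (ht : t < 1) (x y : ℝ) :
    gaussianPart n x y s t = √((1 - t) / (1 - s)) *
      gaussianPDFReal ((1 - t) * x / (1 - s))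
        (Real.toNNReal ((t - s) * (1 - t) / (n * (1 - s)))) y := by
  have hn' : (0 : ℝ) < n := by exact_mod_cast hn
  have hA : 0 < 1 - s := by linarith
  have hB : 0 < 1 - t := by linarith
  have hT : 0 < t - s := by linarith
  have hv : 0 ≤ (t - s) * (1 - t) / (n * (1 - s)) := by positivity
  rw [gaussianPart, gaussianPDFReal, Real.coe_toNNReal _ hv, ← mul_assoc]
  congr 1
  · rw [← Real.sqrt_inv, ← Real.sqrt_mul (by positivity), ← Real.sqrt_div hn'.le]
    congr 1
    field_simp
  · congr 1
    obtain ⟨A, rfl⟩ : ∃ A, s = 1 - A := ⟨1 - s, by ring⟩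
    obtain ⟨B, rfl⟩ : ∃ B, t = 1 - B := ⟨1 - t, by ring⟩
    have e1 : 1 - B - (1 - A) = A - B := by ring
    have hAB : A - B ≠ 0 := by linarith
    have hA' : A ≠ 0 := by linarith
    have hB' : B ≠ 0 := by linarith
    rw [e1, sub_sub_cancel, sub_sub_cancel]
    field_simp
    ring

/-- Backward transport of a polynomial along the bridge to `0`. -/
noncomputable def psi (n : ℕ) (p : ℝ[X]) (t x : ℝ) : ℝ :=
  (√(1 - t))⁻¹ * (heatInv (t / (n * (1 - t))) p).eval (x / (1 - t))

/-- Forward transport of a function along the bridge to `0`. -/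
noncomputable def phi (n : ℕ) (φ : ℝ → ℝ) (t y : ℝ) : ℝ :=
  if t = 0 then φ y else ∫ w, φ w * gaussianPart n w y 0 t

theorem gaussianPart_nonneg (n : ℕ) (x y s t : ℝ) : 0 ≤ gaussianPart n x y s t := by
  unfold gaussianPart; positivity

theorem continuous_gaussianPart (n : ℕ) (s t : ℝ) :
    Continuous fun q : ℝ × ℝ => gaussianPart n q.1 q.2 s t := by
  unfold gaussianPart; fun_prop

/-- The bridge contracts toward `0`: the mean of `y` is at most `|x|` in absolute value, so powers
of `1 + |y|` are controlled by the same powers of `1 + |x|`. -/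
theorem exists_gaussianPart_le {n : ℕ} (hn : 0 < n) {s t : ℝ} (hst : s < t) (ht : t < 1) (N : ℕ) :
    ∃ C, 0 ≤ C ∧ ∀ x y, gaussianPart n x y s t ≤ C * (1 + |x|) ^ N * ((1 + |y|) ^ N)⁻¹ := by
  have hn' : (0 : ℝ) < n := by exact_mod_cast hn
  have hA : 0 < 1 - s := by linarith
  have hB : 0 < 1 - t := by linarith
  have hT : 0 < t - s := by linarith
  set v : ℝ := (t - s) * (1 - t) / (n * (1 - s)) with hv_def
  have hv : 0 < v := by positivity
  refine ⟨√((1 - t) / (1 - s)) * ((√(2 * Real.pi * v))⁻¹ *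
    Real.exp (N ^ 2 / (4 * (1 / (2 * v))))), by positivity, fun x y => ?_⟩
  rw [gaussianPart_eq hn hst ht, gaussianPDFReal, Real.coe_toNNReal _ hv.le]
  set u := (1 - t) * x / (1 - s)
  have hu : |u| ≤ |x| := by
    simp only [u]
    rw [abs_div, abs_mul, abs_of_pos hA, abs_of_pos hB, div_le_iff₀ hA]
    nlinarith [abs_nonneg x]
  have h1 := exp_neg_sq_sub_le (a := 1 / (2 * v)) (by positivity) N y u
  have he : -(y - u) ^ 2 / (2 * v) = -(1 / (2 * v) * (y - u) ^ 2) := by ring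
  rw [he]
  calc _ ≤ √((1 - t) / (1 - s)) * ((√(2 * Real.pi * v))⁻¹ *
        (Real.exp (N ^ 2 / (4 * (1 / (2 * v)))) * (1 + |u|) ^ N * ((1 + |y|) ^ N)⁻¹)) := by gcongr
    _ ≤ √((1 - t) / (1 - s)) * ((√(2 * Real.pi * v))⁻¹ *
        (Real.exp (N ^ 2 / (4 * (1 / (2 * v)))) * (1 + |x|) ^ N * ((1 + |y|) ^ N)⁻¹)) := by gcongr
    _ = _ := by ring

/-- In the coordinate `x / (1 - t)` the bridge is a Brownian motion run with variance `t / (n (1 -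
t))`. Averaging over a step cancels the corresponding part of `heatInv`, and the factor `(√(1 -
t))⁻¹` in `psi` compensates the one in `gaussianPart_eq`. -/
theorem integral_gaussianPart_mul_psi {n : ℕ} (hn : 0 < n) (p : ℝ[X]) {s t : ℝ} (hst : s < t)
    (ht : t < 1) (x : ℝ) : ∫ y, gaussianPart n x y s t * psi n p t y = psi n p s x := by
  have hn' : (0 : ℝ) < n := by exact_mod_cast hn
  have hA : 0 < 1 - s := by linarith
  have hB : 0 < 1 - t := by linarith
  have hT : 0 < t - s := by linarith
  have hv : 0 < (t - s) * (1 - t) / (n * (1 - s)) := by positivity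
  have hw : 0 < (t - s) / (n * (1 - s) * (1 - t)) := by positivity
  have key : ∀ y, gaussianPDFReal ((1 - t) * x / (1 - s))
        (Real.toNNReal ((t - s) * (1 - t) / (n * (1 - s)))) ((1 - t) * y) = (1 - t)⁻¹ *
        gaussianPDFReal (x / (1 - s)) (Real.toNNReal ((t - s) / (n * (1 - s) * (1 - t)))) y := by
    intro y
    simp only [gaussianPDFReal]
    rw [Real.coe_toNNReal _ hv.le, Real.coe_toNNReal _ hw.le, ← mul_assoc]
    congr 1
    · have h2 : (1 - t)⁻¹ = (√((1 - t) ^ 2))⁻¹ := by rw [Real.sqrt_sq hB.le]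
      rw [h2, ← mul_inv, ← Real.sqrt_mul (by positivity)]
      congr 2
      field_simp
    · congr 1
      field_simp
  have h1 : ∀ y, gaussianPart n x ((1 - t) * y) s t * psi n p t ((1 - t) * y) =
      (√(1 - s))⁻¹ * (1 - t)⁻¹ *
        (gaussianPDFReal (x / (1 - s)) (Real.toNNReal ((t - s) / (n * (1 - s) * (1 - t)))) y *
        (heatInv (t / (n * (1 - t))) p).eval y) := by
    intro y
    rw [gaussianPart_eq hn hst ht, key, psi, mul_div_cancel_left₀ _ hB.ne', Real.sqrt_div hB.le]
    have : √(1 - t) ≠ 0 := (Real.sqrt_pos.2 hB).ne'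
    field_simp
  have h2 := Measure.integral_comp_mul_left
    (fun y => gaussianPart n x y s t * psi n p t y) (1 - t)
  simp only [h1] at h2
  rw [integral_const_mul, integral_gaussianPDFReal_heatInv _ _
    (by rw [Ne, Real.toNNReal_eq_zero, not_le]; exact hw), Real.coe_toNNReal _ hw.le,
    abs_of_pos (inv_pos.2 hB), smul_eq_mul] at h2
  -- The variance of the step, in the rescaled coordinate, is the increment of `t / (n (1 - t))`
  -- from `s` to `t`.
  have h3 : t / (n * (1 - t)) - (t - s) / (n * (1 - s) * (1 - t)) = s / (n * (1 - s)) := by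
    field_simp; ring
  rw [h3] at h2
  rw [psi]
  have hB' := hB.ne'
  field_simp at h2 ⊢
  linarith

/-- Chapman–Kolmogorov. The exponential weights at the middle time cancel, and the product is `G x
z` times the normal density of the middle point given both ends. -/
theorem integral_gaussianPart_mul_gaussianPart {n : ℕ} (hn : 0 < n) {s t u : ℝ} (hst : s < t)
    (htu : t < u) (x z : ℝ) :
    ∫ y, gaussianPart n x y s t * gaussianPart n y z t u = gaussianPart n x z s u := by
  have hn' : (0 : ℝ) < n := by exact_mod_cast hn
  have h1 : 0 < t - s := by linarith
  have h2 : 0 < u - t := by linarith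
  have h3 : 0 < u - s := by linarith
  have hv : 0 < (t - s) * (u - t) / (n * (u - s)) := by positivity
  have key : ∀ y, gaussianPart n x y s t * gaussianPart n y z t u = gaussianPart n x z s u *
      gaussianPDFReal (((u - t) * x + (t - s) * z) / (u - s))
        (Real.toNNReal ((t - s) * (u - t) / (n * (u - s)))) y := by
    intro y
    simp only [gaussianPart, gaussianPDFReal]
    rw [Real.coe_toNNReal _ hv.le, mul_mul_mul_comm, mul_mul_mul_comm (√(n : ℝ) / √(2 * Real.pi * (u - s))),
      ← Real.exp_add, ← Real.exp_add]
    congr 1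
    · rw [← Real.sqrt_inv, ← Real.sqrt_div hn'.le, ← Real.sqrt_div hn'.le, ← Real.sqrt_div hn'.le,
        ← Real.sqrt_mul (by positivity), ← Real.sqrt_mul (by positivity)]
      congr 1
      field_simp
    · congr 1
      have h4 : -(n * (x - y) ^ 2 / (2 * (t - s))) + -(n * (y - z) ^ 2 / (2 * (u - t))) =
        -(n * (x - z) ^ 2 / (2 * (u - s))) + -(y - ((u - t) * x + (t - s) * z) / (u - s)) ^ 2 /
          (2 * ((t - s) * (u - t) / (n * (u - s)))) := by
        obtain ⟨a, rfl⟩ : ∃ a, t = s + a := ⟨t - s, by ring⟩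
        obtain ⟨b, rfl⟩ : ∃ b, u = s + a + b := ⟨u - (s + a), by ring⟩
        have e1 : s + a - s = a := by ring
        have e2 : s + a + b - (s + a) = b := by ring
        have e3 : s + a + b - s = a + b := by ring
        have ha : a ≠ 0 := by linarith
        have hb : b ≠ 0 := by linarith
        have hab : a + b ≠ 0 := by linarith
        rw [e1, e2, e3]
        field_simp
        ring
      linarith
  simp only [key]
  rw [integral_const_mul, integral_gaussianPDFReal_eq_one _
    (by rw [Ne, Real.toNNReal_eq_zero, not_le]; exact hv), mul_one]

theorem psi_zero (n : ℕ) (p : ℝ[X]) (x : ℝ) : psi n p 0 x = p.eval x := by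
  simp [psi, heatInv_zero]

theorem continuous_psi (n : ℕ) (p : ℝ[X]) (t : ℝ) : Continuous (psi n p t) := by
  unfold psi; fun_prop

theorem exists_abs_psi_le {n : ℕ} (p : ℝ[X]) {t : ℝ} (ht : t < 1) (N : ℕ)
    (hN : p.natDegree ≤ N) : ∃ C, 0 ≤ C ∧ ∀ x, |psi n p t x| ≤ C * (1 + |x|) ^ N := by
  have hB : 0 < 1 - t := by linarith
  let q : ℝ[X] := (heatInv (t / (n * (1 - t))) p).comp (C ((1 - t)⁻¹) * X)
  have hq : q.natDegree ≤ N := by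
    refine natDegree_comp_le.trans ?_
    rw [(heatInv_natDegree_leadingCoeff _ p).1]
    calc _ ≤ p.natDegree * 1 := by gcongr; exact (natDegree_C_mul_le _ _).trans natDegree_X_le
      _ ≤ N := by omega
  obtain ⟨D, hD0, hD⟩ := exists_abs_eval_le q N hq
  refine ⟨(√(1 - t))⁻¹ * D, by positivity, fun x => ?_⟩
  have : psi n p t x = (√(1 - t))⁻¹ * q.eval x := by
    simp only [psi, q, eval_comp, eval_mul, eval_C, eval_X]
    rw [div_eq_inv_mul]
  rw [this, abs_mul, abs_of_nonneg (by positivity : 0 ≤ (√(1 - t))⁻¹), mul_assoc]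
  gcongr
  exact hD x

theorem integrable_mul_gaussianPart {n : ℕ} {φ : ℝ → ℝ} (hφ : Continuous φ)
    (hd : RapidDecay φ) {s t : ℝ} (hn : 0 < n) (hst : s < t) (ht : t < 1) (y : ℝ) :
    Integrable fun w => φ w * gaussianPart n w y s t := by
  obtain ⟨C, hC0, hC⟩ := exists_gaussianPart_le hn hst ht 0
  refine ((hd.integrable hφ.aestronglyMeasurable).mul_bdd (c := C) ?_ (ae_of_all _ fun w => ?_))
  · exact ((continuous_gaussianPart n s t).comp (by fun_prop :
      Continuous fun w : ℝ => (w, y))).aestronglyMeasurable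
  · rw [Real.norm_eq_abs, abs_of_nonneg (gaussianPart_nonneg _ _ _ _ _)]
    simpa using hC w y

theorem stronglyMeasurable_phi (n : ℕ) {φ : ℝ → ℝ} (hφ : Continuous φ) (t : ℝ) :
    StronglyMeasurable (phi n φ t) := by
  by_cases h : t = 0
  · have : phi n φ t = φ := by ext y; simp [phi, h]
    rw [this]; exact hφ.stronglyMeasurable
  · have : phi n φ t = fun y => ∫ w, φ w * gaussianPart n w y 0 t := by ext y; simp [phi, h]
    rw [this]
    refine StronglyMeasurable.integral_prod_right
      (f := fun y w => φ w * gaussianPart n w y 0 t) ?_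
    have : Continuous (Function.uncurry fun y w => φ w * gaussianPart n w y 0 t) := by
      have := (continuous_gaussianPart n 0 t).comp continuous_swap
      exact (hφ.comp continuous_snd).mul this
    exact this.stronglyMeasurable

theorem rapidDecay_phi {n : ℕ} (hn : 0 < n) {φ : ℝ → ℝ} (hd : RapidDecay φ)
    {t : ℝ} (ht0 : 0 ≤ t) (ht : t < 1) : RapidDecay (phi n φ t) := by
  rcases ht0.eq_or_lt with rfl | ht0
  · have : phi n φ 0 = φ := by ext y; simp [phi]
    rwa [this]
  intro N
  obtain ⟨C, hC0, hC⟩ := exists_gaussianPart_le hn ht0 ht N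
  obtain ⟨D, hD0, hD⟩ := hd (N + 2)
  refine ⟨D * C * ∫ x : ℝ, ((1 + |x|) ^ 2)⁻¹, ?_, fun y => ?_⟩
  · exact mul_nonneg (by positivity) (integral_nonneg fun x => by positivity)
  rw [phi, if_neg ht0.ne', ← Real.norm_eq_abs]
  have hle : ∀ w, ‖φ w * gaussianPart n w y 0 t‖ ≤
      D * C * ((1 + |y|) ^ N)⁻¹ * ((1 + |w|) ^ 2)⁻¹ := by
    intro w
    rw [norm_mul, Real.norm_eq_abs, Real.norm_eq_abs, abs_of_nonneg (gaussianPart_nonneg _ _ _ _ _)]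
    calc _ ≤ (D * ((1 + |w|) ^ (N + 2))⁻¹) * (C * (1 + |w|) ^ N * ((1 + |y|) ^ N)⁻¹) := by
          gcongr; exacts [gaussianPart_nonneg _ _ _ _ _, hD w, hC w y]
      _ = _ := by
        have : (0 : ℝ) < 1 + |w| := by positivity
        rw [pow_add]; field_simp
  refine (norm_integral_le_of_norm_le (integrable_one_add_abs_inv.const_mul _)
    (ae_of_all _ hle)).trans ?_
  rw [integral_const_mul]
  exact le_of_eq (by ring)

/-- Fubini. The decay of `φ` in `w` and the bound on `G` with two spare powers dominate the double
integrand by an integrable product. -/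
theorem integral_phi_mul {n : ℕ} (hn : 0 < n) {φ : ℝ → ℝ} (hφ : Continuous φ) (hd : RapidDecay φ)
    {t : ℝ} (ht0 : 0 < t) (ht : t < 1) {g : ℝ → ℝ} (hg : Measurable g) {N : ℕ} {D : ℝ}
    (hgD : ∀ y, |g y| ≤ D * (1 + |y|) ^ N) :
    ∫ y, phi n φ t y * g y = ∫ w, φ w * ∫ y, gaussianPart n w y 0 t * g y := by
  have hD0 : 0 ≤ D := by
    have := (abs_nonneg _).trans (hgD 0)
    simpa using this
  obtain ⟨C, hC0, hC⟩ := exists_gaussianPart_le hn ht0 ht (N + 2)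
  have hcont : Continuous fun q : ℝ × ℝ => φ q.1 * gaussianPart n q.1 q.2 0 t :=
    (hφ.comp continuous_fst).mul (continuous_gaussianPart n 0 t)
  have hint : Integrable (Function.uncurry fun y w => φ w * gaussianPart n w y 0 t * g y)
      (volume.prod volume) := by
    obtain ⟨E, hE0, hE⟩ := hd (N + 2 + 2)
    have h2 := (integrable_one_add_abs_inv.mul_prod integrable_one_add_abs_inv).const_mul
      (E * C * D)
    refine h2.mono' ?_ (ae_of_all _ fun q => ?_)
    · exact ((hcont.comp continuous_swap).measurable.mul
        (hg.comp measurable_fst)).aestronglyMeasurable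
    · obtain ⟨y, w⟩ := q
      simp only [Function.uncurry_apply_pair]
      rw [Real.norm_eq_abs, abs_mul, abs_mul, abs_of_nonneg (gaussianPart_nonneg _ _ _ _ _)]
      calc _ ≤ (E * ((1 + |w|) ^ (N + 2 + 2))⁻¹) *
            (C * (1 + |w|) ^ (N + 2) * ((1 + |y|) ^ (N + 2))⁻¹) * (D * (1 + |y|) ^ N) := by
            gcongr; exacts [gaussianPart_nonneg _ _ _ _ _, hE w, hC w y, hgD y]
        _ = _ := by
          have h3 : (0 : ℝ) < 1 + |w| := by positivity
          have h4 : (0 : ℝ) < 1 + |y| := by positivity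
          rw [pow_add _ (N + 2), pow_add _ N]; field_simp; ring
  have h1 : ∀ y, phi n φ t y * g y = ∫ w, φ w * gaussianPart n w y 0 t * g y := by
    intro y
    rw [phi, if_neg ht0.ne', integral_mul_const]
  simp only [h1]
  rw [integral_integral_swap hint]
  congr 1 with w
  rw [← integral_const_mul]
  congr 1 with y
  ring

/-- Forward transport of `φ` is adjoint to backward transport of `p`, so the pairing keeps its value
from time `0`. -/
theorem integral_phi_mul_psi {n : ℕ} (hn : 0 < n) {φ : ℝ → ℝ} (hφ : Continuous φ)
    (hd : RapidDecay φ) (p : ℝ[X]) {t : ℝ} (ht0 : 0 ≤ t) (ht : t < 1) :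
    ∫ y, phi n φ t y * psi n p t y = ∫ w, φ w * p.eval w := by
  rcases ht0.eq_or_lt with rfl | ht0
  · simp [phi, psi_zero]
  obtain ⟨D, hD0, hD⟩ := exists_abs_psi_le (n := n) p ht _ le_rfl
  rw [integral_phi_mul hn hφ hd ht0 ht (continuous_psi n p t).measurable hD]
  simp only [integral_gaussianPart_mul_psi hn p ht0 ht, psi_zero]

theorem integral_phi_mul_gaussianPart {n : ℕ} (hn : 0 < n) {φ : ℝ → ℝ} (hφ : Continuous φ)
    (hd : RapidDecay φ) {s t : ℝ} (hs0 : 0 ≤ s) (hst : s < t) (ht : t < 1) (z : ℝ) :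
    ∫ y, phi n φ s y * gaussianPart n y z s t = phi n φ t z := by
  rcases hs0.eq_or_lt with rfl | hs0
  · simp [phi, hst.ne']
  obtain ⟨C, hC0, hC⟩ := exists_gaussianPart_le hn hst ht 0
  have hm : Measurable fun y => gaussianPart n y z s t := by
    have : Continuous fun y => gaussianPart n y z s t := by unfold gaussianPart; fun_prop
    exact this.measurable
  have hb : ∀ y, |gaussianPart n y z s t| ≤ C * (1 + |y|) ^ 0 := fun y => by
    rw [abs_of_nonneg (gaussianPart_nonneg _ _ _ _ _)]
    simpa using hC y z
  rw [integral_phi_mul hn hφ hd hs0 (hst.trans ht) hm hb]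
  simp only [integral_gaussianPart_mul_gaussianPart hn hs0 hst]
  rw [phi, if_neg (hs0.trans hst).ne']

end NIBM

/-! ### The extended kernel is reproducing -/

namespace NIBM

open Polynomial

theorem RapidDecay.integrable_mul {f g : ℝ → ℝ} (hf : RapidDecay f) (hfm : AEStronglyMeasurable f)
    (hgm : AEStronglyMeasurable g) {D : ℝ} {N : ℕ} (hg : ∀ y, |g y| ≤ D * (1 + |y|) ^ N) :
    Integrable fun y => f y * g y := by
  obtain ⟨C, hC0, hC⟩ := hf (N + 2)
  have hD0 : 0 ≤ D := by simpa using (abs_nonneg _).trans (hg 0)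
  refine (integrable_one_add_abs_inv.const_mul (C * D)).mono' (hfm.mul hgm)
    (ae_of_all _ fun y => ?_)
  rw [Real.norm_eq_abs, abs_mul]
  calc _ ≤ (C * ((1 + |y|) ^ (N + 2))⁻¹) * (D * (1 + |y|) ^ N) := by gcongr; exacts [hC y, hg y]
    _ = _ := by
      have : (0 : ℝ) < 1 + |y| := by positivity
      rw [pow_add]; field_simp

/-- The kernel `∑_l ψ_l(x) φ_l(y) - 1_{i < j} G(x, y)` at the times `τ_i`. -/
noncomputable def extKernel {m : ℕ} (n : ℕ) (p : ℕ → ℝ[X]) (φ : ℕ → ℝ → ℝ) (τ : Fin (m + 1) → ℝ)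
    (i j : Fin (m + 1)) (x y : ℝ) : ℝ :=
  ∑ l : Fin n, psi n (p l) (τ i) x * phi n (φ l) (τ j) y -
    if i < j then gaussianPart n x y (τ i) (τ j) else 0

section

variable {m n : ℕ} (hn : 0 < n) {p : ℕ → ℝ[X]} (hdeg : ∀ l, (p l).natDegree = l)
  {φ : ℕ → ℝ → ℝ} (hφ : ∀ l, Continuous (φ l)) (hd : ∀ l, RapidDecay (φ l))
  (hpφ : ∀ l k, ∫ w, φ l w * (p k).eval w = if l = k then 1 else 0)
  {τ : Fin (m + 1) → ℝ} (hτ : StrictMono τ) (hτ0 : ∀ i, 0 ≤ τ i) (hτ1 : ∀ i, τ i < 1)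

include hφ in
theorem measurable_extKernel (i j : Fin (m + 1)) :
    Measurable fun q : ℝ × ℝ => extKernel n p φ τ i j q.1 q.2 := by
  unfold extKernel
  refine Measurable.sub (Finset.measurable_sum _ fun l _ => ?_) ?_
  · exact ((continuous_psi n (p l) (τ i)).measurable.comp measurable_fst).mul
      ((stronglyMeasurable_phi n (hφ l) (τ j)).measurable.comp measurable_snd)
  · split_ifs
    · exact (continuous_gaussianPart n (τ i) (τ j)).measurable
    · exact measurable_const

include hn hdeg hd hτ hτ0 hτ1 in
-- A bound of product form `g_i(x) h_j(y)` with `g_i h_i` integrable. `G` alone has no decay in `x`;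
-- for `i < j` it only trades growth in `x` for equal decay in `y`. The exponents therefore drop by
-- two from each layer to the next, and the extra `2` for `y` makes the diagonal products equal to
-- `(1 + |x|)⁻²`.
theorem exists_abs_extKernel_le (i j : Fin (m + 1)) : ∃ C, 0 ≤ C ∧ ∀ x y,
    |extKernel n p φ τ i j x y| ≤ C * ((1 + |x|) ^ (n + 2 * (m - i : ℕ)) *
      ((1 + |y|) ^ (n + 2 * (m - j : ℕ) + 2))⁻¹) := by
  have h1 : ∀ l : Fin n, ∃ C, 0 ≤ C ∧ ∀ x y, |psi n (p l) (τ i) x * phi n (φ l) (τ j) y| ≤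
      C * ((1 + |x|) ^ (n + 2 * (m - i : ℕ)) * ((1 + |y|) ^ (n + 2 * (m - j : ℕ) + 2))⁻¹) := by
    intro l
    obtain ⟨C, hC0, hC⟩ := exists_abs_psi_le (n := n) (p l) (hτ1 i) (n + 2 * (m - i : ℕ))
      (by rw [hdeg]; have := l.2; omega)
    obtain ⟨D, hD0, hD⟩ := rapidDecay_phi hn (hd l) (hτ0 j) (hτ1 j)
      (n + 2 * (m - j : ℕ) + 2)
    refine ⟨C * D, by positivity, fun x y => ?_⟩
    rw [abs_mul]
    calc _ ≤ (C * (1 + |x|) ^ (n + 2 * (m - i : ℕ))) *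
          (D * ((1 + |y|) ^ (n + 2 * (m - j : ℕ) + 2))⁻¹) := by gcongr; exacts [hC x, hD y]
      _ = _ := by ring
  have h2 : ∃ C, 0 ≤ C ∧ ∀ x y, |if i < j then gaussianPart n x y (τ i) (τ j) else 0| ≤
      C * ((1 + |x|) ^ (n + 2 * (m - i : ℕ)) * ((1 + |y|) ^ (n + 2 * (m - j : ℕ) + 2))⁻¹) := by
    by_cases hij : i < j
    · obtain ⟨C, hC0, hC⟩ := exists_gaussianPart_le hn (hτ hij) (hτ1 j) (n + 2 * (m - i : ℕ))
      refine ⟨C, hC0, fun x y => ?_⟩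
      rw [if_pos hij, abs_of_nonneg (gaussianPart_nonneg _ _ _ _ _)]
      refine (hC x y).trans ?_
      rw [mul_assoc]
      have hle : n + 2 * (m - j : ℕ) + 2 ≤ n + 2 * (m - i : ℕ) := by
        have h3 : (i : ℕ) < j := hij
        have h4 := j.2
        omega
      gcongr
      · linarith [abs_nonneg y]
    · exact ⟨0, le_rfl, fun x y => by simp [hij]⟩
  choose C hC0 hC using h1
  obtain ⟨D, hD0, hD⟩ := h2
  refine ⟨∑ l, C l + D, add_nonneg (Finset.sum_nonneg fun l _ => hC0 l) hD0, fun x y => ?_⟩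
  unfold extKernel
  refine (abs_sub _ _).trans ?_
  rw [add_mul, Finset.sum_mul]
  exact add_le_add ((Finset.abs_sum_le_sum_abs _ _).trans
    (Finset.sum_le_sum fun l _ => hC l x y)) (hD x y)

include hn hφ hd hpφ hτ0 hτ1 in
theorem integral_phi_psi (l k : ℕ) (j : Fin (m + 1)) :
    ∫ y, phi n (φ l) (τ j) y * psi n (p k) (τ j) y = if l = k then 1 else 0 := by
  rw [integral_phi_mul_psi hn (hφ l) (hd l) _ (hτ0 j) (hτ1 j), hpφ]

include hn hφ hd hτ0 hτ1 in
theorem integrable_phi_psi (l k : ℕ) (j : Fin (m + 1)) :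
    Integrable fun y => phi n (φ l) (τ j) y * psi n (p k) (τ j) y := by
  obtain ⟨C, hC0, hC⟩ := exists_abs_psi_le (n := n) (p k) (hτ1 j) _ le_rfl
  exact (rapidDecay_phi hn (hd l) (hτ0 j) (hτ1 j)).integrable_mul
    (stronglyMeasurable_phi n (hφ l) (τ j)).aestronglyMeasurable
    (continuous_psi n (p k) (τ j)).aestronglyMeasurable hC

theorem rapidDecay_gaussianPart (hn : 0 < n) {s t : ℝ} (hst : s < t) (ht : t < 1) (x : ℝ) :
    RapidDecay fun y => gaussianPart n x y s t := by
  intro N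
  obtain ⟨C, hC0, hC⟩ := exists_gaussianPart_le hn hst ht N
  refine ⟨C * (1 + |x|) ^ N, by positivity, fun y => ?_⟩
  rw [abs_of_nonneg (gaussianPart_nonneg _ _ _ _ _)]
  exact hC x y

theorem continuous_gaussianPart_right (n : ℕ) (x s t : ℝ) :
    Continuous fun y => gaussianPart n x y s t := by
  unfold gaussianPart; fun_prop

theorem continuous_gaussianPart_left (n : ℕ) (y s t : ℝ) :
    Continuous fun x => gaussianPart n x y s t := by
  unfold gaussianPart; fun_prop

include hn hφ hd hpφ hτ hτ0 hτ1 in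
-- Expand the product into four terms. Biorthogonality and the two transport rules each reproduce
-- the same sum `S = ∑ ψ_l(x) φ_l(z)`, and Chapman–Kolmogorov reproduces `G`. The coefficient counts
-- the terms that are present: for `i < j < k` the result is `S - S - S + G = -(S - G)`.
theorem integral_extKernel_mul (i j k : Fin (m + 1)) (x z : ℝ) :
    ∫ y, extKernel n p φ τ i j x y * extKernel n p φ τ j k y z =
      ((if j ≤ i then 1 else 0) + (if k ≤ j then 1 else 0) - 1) * extKernel n p φ τ i k x z := by
  set S : ℝ := ∑ l : Fin n, psi n (p l) (τ i) x * phi n (φ l) (τ k) z with hS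
  have iφψ := integrable_phi_psi (p := p) hn hφ hd hτ0 hτ1
  let f1 : ℝ → ℝ := fun y => ∑ a : Fin n, ∑ b : Fin n,
    psi n (p a) (τ i) x * phi n (φ b) (τ k) z * (phi n (φ a) (τ j) y * psi n (p b) (τ j) y)
  have hi1 : ∀ a b : Fin n, Integrable fun y => psi n (p a) (τ i) x * phi n (φ b) (τ k) z *
      (phi n (φ a) (τ j) y * psi n (p b) (τ j) y) := fun a b => (iφψ a b j).const_mul _
  have hf1i : Integrable f1 := integrable_finsetSum _ fun a _ => integrable_finsetSum _ fun b _ =>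
    hi1 a b
  have hf1 : ∫ y, f1 y = S := by
    simp only [f1]
    rw [integral_finsetSum _ fun a _ => integrable_finsetSum _ fun b _ => hi1 a b, hS]
    refine Finset.sum_congr rfl fun a _ => ?_
    rw [integral_finsetSum _ fun b _ => hi1 a b]
    simp only [integral_const_mul, integral_phi_psi hn hφ hd hpφ hτ0 hτ1]
    rw [Finset.sum_eq_single a (fun b _ hb => by
      rw [if_neg (fun h => hb (Fin.ext h.symm)), mul_zero]) (fun h => absurd (Finset.mem_univ a) h)]
    simp
  let f2 : ℝ → ℝ := fun y => ∑ a : Fin n, psi n (p a) (τ i) x *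
    (phi n (φ a) (τ j) y * gaussianPart n y z (τ j) (τ k))
  have hφG : j < k → ∀ a : Fin n,
      Integrable fun y => phi n (φ a) (τ j) y * gaussianPart n y z (τ j) (τ k) := by
    intro hjk a
    obtain ⟨C, hC0, hC⟩ := exists_gaussianPart_le hn (hτ hjk) (hτ1 k) 0
    refine (rapidDecay_phi hn (hd a) (hτ0 j) (hτ1 j)).integrable_mul (N := 0) (D := C)
      (stronglyMeasurable_phi n (hφ a) (τ j)).aestronglyMeasurable
      (continuous_gaussianPart_left n z _ _).aestronglyMeasurable fun y => ?_
    rw [abs_of_nonneg (gaussianPart_nonneg _ _ _ _ _)]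
    simpa using hC y z
  have hf2i : j < k → Integrable f2 := fun hjk =>
    integrable_finsetSum _ fun a _ => (hφG hjk a).const_mul _
  have hf2 : j < k → ∫ y, f2 y = S := by
    intro hjk
    simp only [f2]
    rw [integral_finsetSum _ fun a _ => (hφG hjk a).const_mul _]
    simp only [integral_const_mul,
      integral_phi_mul_gaussianPart hn (hφ _) (hd _) (hτ0 j) (hτ hjk) (hτ1 k)]
    rfl
  let f3 : ℝ → ℝ := fun y => ∑ b : Fin n, phi n (φ b) (τ k) z *
    (gaussianPart n x y (τ i) (τ j) * psi n (p b) (τ j) y)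
  have hGψ : i < j → ∀ b : Fin n,
      Integrable fun y => gaussianPart n x y (τ i) (τ j) * psi n (p b) (τ j) y := by
    intro hij b
    obtain ⟨C, hC0, hC⟩ := exists_abs_psi_le (n := n) (p b) (hτ1 j) _ le_rfl
    exact (rapidDecay_gaussianPart hn (hτ hij) (hτ1 j) x).integrable_mul
      (continuous_gaussianPart_right n x _ _).aestronglyMeasurable
      (continuous_psi n (p b) (τ j)).aestronglyMeasurable hC
  have hf3i : i < j → Integrable f3 := fun hij =>
    integrable_finsetSum _ fun b _ => (hGψ hij b).const_mul _
  have hf3 : i < j → ∫ y, f3 y = S := by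
    intro hij
    simp only [f3]
    rw [integral_finsetSum _ fun b _ => (hGψ hij b).const_mul _]
    simp only [integral_const_mul, integral_gaussianPart_mul_psi hn _ (hτ hij) (hτ1 j)]
    rw [hS]
    exact Finset.sum_congr rfl fun b _ => mul_comm _ _
  let f4 : ℝ → ℝ := fun y => gaussianPart n x y (τ i) (τ j) * gaussianPart n y z (τ j) (τ k)
  have hf4i : i < j → j < k → Integrable f4 := by
    intro hij hjk
    obtain ⟨C, hC0, hC⟩ := exists_gaussianPart_le hn (hτ hjk) (hτ1 k) 0
    refine (rapidDecay_gaussianPart hn (hτ hij) (hτ1 j) x).integrable_mul (N := 0) (D := C)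
      (continuous_gaussianPart_right n x _ _).aestronglyMeasurable
      (continuous_gaussianPart_left n z _ _).aestronglyMeasurable fun y => ?_
    rw [abs_of_nonneg (gaussianPart_nonneg _ _ _ _ _)]
    simpa using hC y z
  have hf4 : i < j → j < k → ∫ y, f4 y = gaussianPart n x z (τ i) (τ k) := fun hij hjk =>
    integral_gaussianPart_mul_gaussianPart hn (hτ hij) (hτ hjk) x z
  have hexp : ∀ y, extKernel n p φ τ i j x y * extKernel n p φ τ j k y z =
      f1 y - (if j < k then f2 y else 0) - (if i < j then f3 y else 0) +
        (if i < j then (if j < k then f4 y else 0) else 0) := by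
    intro y
    have e1 : f1 y = (∑ a : Fin n, psi n (p a) (τ i) x * phi n (φ a) (τ j) y) *
        ∑ b : Fin n, psi n (p b) (τ j) y * phi n (φ b) (τ k) z := by
      rw [Finset.sum_mul_sum]
      exact Finset.sum_congr rfl fun a _ => Finset.sum_congr rfl fun b _ => by ring
    have e2 : f2 y = (∑ a : Fin n, psi n (p a) (τ i) x * phi n (φ a) (τ j) y) *
        gaussianPart n y z (τ j) (τ k) := by
      rw [Finset.sum_mul]
      exact Finset.sum_congr rfl fun a _ => by ring
    have e3 : f3 y = gaussianPart n x y (τ i) (τ j) *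
        ∑ b : Fin n, psi n (p b) (τ j) y * phi n (φ b) (τ k) z := by
      rw [Finset.mul_sum]
      exact Finset.sum_congr rfl fun a _ => by ring
    have e4 : f4 y = gaussianPart n x y (τ i) (τ j) * gaussianPart n y z (τ j) (τ k) := rfl
    rw [e1, e2, e3, e4]
    unfold extKernel
    split_ifs <;> ring
  simp only [hexp]
  by_cases hij : i < j
  · by_cases hjk : j < k
    · simp only [hij, hjk, if_true, not_le.2 hij, not_le.2 hjk, if_false]
      have hik := hij.trans hjk
      have i1 := hf1i.sub (hf2i hjk)
      have i2 := i1.sub (hf3i hij)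
      simp only [Pi.sub_def] at i1 i2
      rw [integral_add i2 (hf4i hij hjk), integral_sub i1 (hf3i hij),
        integral_sub hf1i (hf2i hjk), hf1, hf2 hjk, hf3 hij, hf4 hij hjk, extKernel, if_pos hik]
      ring
    · simp only [hij, hjk, if_true, not_le.2 hij, not_lt.1 hjk, if_false, sub_zero, add_zero]
      rw [integral_sub hf1i (hf3i hij), hf1, hf3 hij]
      ring
  · by_cases hjk : j < k
    · simp only [hij, hjk, if_true, not_lt.1 hij, not_le.2 hjk, if_false, sub_zero, add_zero]
      rw [integral_sub hf1i (hf2i hjk), hf1, hf2 hjk]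
      ring
    · simp only [hij, hjk, if_true, not_lt.1 hij, not_lt.1 hjk, if_false, sub_zero, add_zero]
      have hik : ¬ i < k := not_lt.2 ((not_lt.1 hjk).trans (not_lt.1 hij))
      rw [hf1, extKernel, if_neg hik]
      ring

/-- In the bordered matrix, the columns of points in layers `≤ j` can be nonzero only in the `n`
border rows and in the rows of points in layers `< j`. More than `n` points in layer `j` make these
columns too numerous. -/
theorem corr_extKernel_eq_zero {k : ℕ} (s : Fin k → Fin (m + 1)) (x : Fin k → ℝ) (j : Fin (m + 1))
    (hj : n < (Finset.univ.filter fun a => s a = j).card) :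
    corr (extKernel n p φ τ) s x = 0 := by
  let A : Matrix (Fin n) (Fin k) ℝ := Matrix.of fun l b => phi n (φ l) (τ (s b)) (x b)
  let B : Matrix (Fin k) (Fin n) ℝ := Matrix.of fun a l => psi n (p l) (τ (s a)) (x a)
  let D : Matrix (Fin k) (Fin k) ℝ :=
    Matrix.of fun a b => if s a < s b then gaussianPart n (x a) (x b) (τ (s a)) (τ (s b)) else 0
  have h1 : (Matrix.of fun a b => extKernel n p φ τ (s a) (s b) (x a) (x b)) = -(D - B * A) := by
    ext a b
    simp [extKernel, D, A, B, Matrix.mul_apply]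
  rw [corr, h1, Matrix.det_neg, ← Matrix.det_fromBlocks_one₁₁ A B D,
    det_eq_zero_of_card_lt _ ((Finset.univ.filter fun a => s a ≤ j).map Function.Embedding.inr)
      (Finset.univ.disjSum (Finset.univ.filter fun a => s a < j)), mul_zero]
  · rw [Finset.card_disjSum, Finset.card_map, Finset.card_univ, Fintype.card_fin]
    have : (Finset.univ.filter fun a => s a ≤ j) =
        (Finset.univ.filter fun a => s a < j) ∪ (Finset.univ.filter fun a => s a = j) := by
      ext a; simp [le_iff_lt_or_eq]
    rw [this, Finset.card_union_of_disjoint]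
    · omega
    · rw [Finset.disjoint_filter]
      intro a _ h1 h2
      exact h1.ne h2
  · intro a ha b hb
    rw [Finset.mem_map] at hb
    obtain ⟨b, hb, rfl⟩ := hb
    rcases a with a | a
    · exact absurd (Finset.inl_mem_disjSum.2 (Finset.mem_univ a)) ha
    · have ha' : ¬ s a < j := fun h =>
        ha (Finset.inr_mem_disjSum.2 (Finset.mem_filter.2 ⟨Finset.mem_univ _, h⟩))
      have hb' := (Finset.mem_filter.1 hb).2
      have : ¬ s a < s b := not_lt.2 (hb'.trans (not_lt.1 ha'))
      simp [D, this]

include hn hdeg hφ hd hpφ hτ hτ0 hτ1 in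
theorem isReproducing_extKernel : IsReproducing n (extKernel n p φ τ) where
  measurable := measurable_extKernel hφ
  bound := by
    choose C hC0 hC using exists_abs_extKernel_le hn hdeg hd hτ hτ0 hτ1
    refine ⟨fun i x => (∑ i', ∑ j', C i' j') * (1 + |x|) ^ (n + 2 * (m - i : ℕ)),
      fun j y => ((1 + |y|) ^ (n + 2 * (m - j : ℕ) + 2))⁻¹, fun i j x y => ?_, fun i => ?_⟩
    · refine (hC i j x y).trans ?_
      rw [mul_assoc]
      gcongr
      calc C i j ≤ ∑ j', C i j' :=
            Finset.single_le_sum (f := fun j' => C i j') (fun j' _ => hC0 i j') (Finset.mem_univ j)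
        _ ≤ _ := Finset.single_le_sum (f := fun i' => ∑ j', C i' j')
            (fun i' _ => Finset.sum_nonneg fun j' _ => hC0 i' j') (Finset.mem_univ i)
    · refine (integrable_one_add_abs_inv.const_mul (∑ i', ∑ j', C i' j')).congr
        (ae_of_all _ fun x => ?_)
      have : (0 : ℝ) < 1 + |x| := by positivity
      simp only
      rw [pow_add _ (n + 2 * (m - i : ℕ)) 2]
      field_simp
  integral_diag i := by
    simp only [extKernel, lt_irrefl, if_false, sub_zero]
    have h := integrable_phi_psi (p := p) hn hφ hd hτ0 hτ1
    have h' : ∀ l : Fin n, Integrable fun y => psi n (p l) (τ i) y * phi n (φ l) (τ i) y := by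
      intro l
      simpa only [mul_comm] using h l l i
    rw [integral_finsetSum _ fun l _ => h' l]
    have : ∀ l : Fin n, ∫ y, psi n (p l) (τ i) y * phi n (φ l) (τ i) y = 1 := by
      intro l
      have := integral_phi_psi hn hφ hd hpφ hτ0 hτ1 l l i
      simpa only [mul_comm, if_true] using this
    simp [this]
  integral_mul := integral_extKernel_mul hn hφ hd hpφ hτ hτ0 hτ1
  corr_eq_zero k s x j hj := corr_extKernel_eq_zero s x j hj

end

theorem det_eval_eq_vandermonde {n : ℕ} (p : ℕ → ℝ[X]) (hdeg : ∀ l, (p l).natDegree = l)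
    (hlead : ∀ l, (p l).leadingCoeff ≠ 0) (x : Fin n → ℝ) :
    (Matrix.of fun k l : Fin n => (p l).eval (x k)).det =
      (∏ l : Fin n, (p l).leadingCoeff) * vandermonde x := by
  let q : Fin n → ℝ[X] := fun l => C ((p l).leadingCoeff⁻¹) * p l
  have hq : ∀ l, (q l).natDegree = l := fun l => by
    simp only [q]
    rw [natDegree_C_mul (inv_ne_zero (hlead l)), hdeg]
  have hqm : ∀ l, (q l).Monic := fun l => by
    simp only [q, Monic, leadingCoeff_mul, leadingCoeff_C]
    exact inv_mul_cancel₀ (hlead l)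
  have h1 := Matrix.det_eval_matrixOfPolynomials_eq_det_vandermonde x q hq hqm
  rw [Matrix.det_vandermonde] at h1
  have h2 : (Matrix.of fun k l : Fin n => (p l).eval (x k)) =
      Matrix.of fun k l : Fin n => (p l).leadingCoeff * (Matrix.of fun i j => (q j).eval (x i)) k l := by
    ext k l
    simp only [Matrix.of_apply, q, eval_mul, eval_C]
    rw [mul_inv_cancel_left₀ (hlead l)]
  rw [h2, Matrix.det_mul_row, ← h1]
  rfl

end NIBM

/-! ### The full determinant and the decay of the weight -/

namespace NIBM

open Polynomial

/-- At time `0` the `φ_l` are `p_l e^{-nV}` and at the last time the `ψ_l` are polynomials of degree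
`l`, so both outer determinants of `exists_det_block` are multiples of Vandermonde products. The
constant `ε` does not depend on `x`, and only its being nonzero matters. -/
theorem exists_fullDet_extKernel (m n : ℕ) {V : ℝ → ℝ} {p : ℕ → ℝ[X]}
    (hdeg : ∀ l, (p l).natDegree = l) (hlead : ∀ l, (p l).leadingCoeff ≠ 0)
    {τ : Fin (m + 1) → ℝ} (hτ0 : τ 0 = 0) (hτ1 : τ (Fin.last m) < 1) :
    ∃ ε : ℝ, ε ≠ 0 ∧ ∀ x : Fin (m + 1) → Fin n → ℝ,
      fullDet (extKernel n p (fun l w => (p l).eval w * Real.exp (-(n * V w))) τ) x =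
      ε * ((vandermonde (x 0) * ∏ k, Real.exp (-(n * V (x 0 k)))) *
        (∏ i : Fin m, (Matrix.of fun k l =>
          gaussianPart n (x i.castSucc k) (x i.succ l) (τ i.castSucc) (τ i.succ)).det) *
        vandermonde (x (Fin.last m))) := by
  obtain ⟨ε, hε, h⟩ := exists_det_block m n
  set t := τ (Fin.last m) with ht
  have hB : 0 < 1 - t := by linarith
  let q : ℕ → ℝ[X] := fun l => C ((√(1 - t))⁻¹) *
    (heatInv (t / (n * (1 - t))) (p l)).comp (C ((1 - t)⁻¹) * X)
  have hs : (√(1 - t))⁻¹ ≠ 0 := inv_ne_zero (Real.sqrt_pos.2 hB).ne'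
  have hr : (1 - t)⁻¹ ≠ 0 := inv_ne_zero hB.ne'
  have hqe : ∀ l x, (q l).eval x = psi n (p l) t x := fun l x => by
    simp only [psi, q, eval_comp, eval_mul, eval_C, eval_X]
    rw [div_eq_inv_mul x]
  have hnd : (C ((1 - t)⁻¹) * X : ℝ[X]).natDegree = 1 := natDegree_C_mul_X _ hr
  have hqd : ∀ l, (q l).natDegree = l := fun l => by
    simp only [q]
    rw [natDegree_C_mul hs, natDegree_comp, hnd, (heatInv_natDegree_leadingCoeff _ _).1, hdeg,
      mul_one]
  have hql : ∀ l, (q l).leadingCoeff ≠ 0 := fun l => by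
    simp only [q]
    rw [leadingCoeff_mul, leadingCoeff_C, leadingCoeff_comp (by rw [hnd]; exact one_ne_zero),
      (heatInv_natDegree_leadingCoeff _ _).2]
    refine mul_ne_zero hs (mul_ne_zero (hlead l) (pow_ne_zero _ ?_))
    rw [leadingCoeff_mul, leadingCoeff_C, leadingCoeff_X, mul_one]
    exact hr
  refine ⟨ε * ((∏ l : Fin n, (p l).leadingCoeff) * ∏ l : Fin n, (q l).leadingCoeff),
    mul_ne_zero hε (mul_ne_zero (Finset.prod_ne_zero_iff.2 fun l _ => hlead l)
      (Finset.prod_ne_zero_iff.2 fun l _ => hql l)), fun x => ?_⟩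
  have h1 := h (fun i => Matrix.of fun k l : Fin n => psi n (p l) (τ i) (x i k))
    (fun j => Matrix.of fun l k : Fin n =>
      phi n (fun w => (p l).eval w * Real.exp (-(n * V w))) (τ j) (x j k))
    (fun i j => Matrix.of fun k l : Fin n => gaussianPart n (x i k) (x j l) (τ i) (τ j))
  have h2 : fullDet (extKernel n p (fun l w => (p l).eval w * Real.exp (-(n * V w))) τ) x = _ := h1
  rw [h2]
  have h3 : (Matrix.of fun l k : Fin n => phi n (fun w => (p l).eval w * Real.exp (-(n * V w)))
      (τ 0) (x 0 k)).det = (∏ l : Fin n, (p l).leadingCoeff) *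
        (vandermonde (x 0) * ∏ k, Real.exp (-(n * V (x 0 k)))) := by
    rw [← Matrix.det_transpose]
    have : (Matrix.of fun l k : Fin n => phi n (fun w => (p l).eval w * Real.exp (-(n * V w)))
        (τ 0) (x 0 k)).transpose = Matrix.of fun k l => Real.exp (-(n * V (x 0 k))) *
          (Matrix.of fun k l : Fin n => (p l).eval (x 0 k)) k l := by
      ext k l
      simp [phi, hτ0, mul_comm]
    rw [this, Matrix.det_mul_column, det_eval_eq_vandermonde p hdeg hlead]
    ring
  have h4 : (Matrix.of fun k l : Fin n => psi n (p l) t (x (Fin.last m) k)).det =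
      (∏ l : Fin n, (q l).leadingCoeff) * vandermonde (x (Fin.last m)) := by
    rw [← det_eval_eq_vandermonde q hqd hql]
    simp only [hqe]
  rw [h3, ← ht, h4]
  ring

/-- Outside a compact set `n V x ≥ N log (1 + |x|)`, which is decay of order `N`; on the compact set
continuity gives a bound. -/
theorem rapidDecay_exp_neg {n : ℕ} (hn : 0 < n) {V : ℝ → ℝ} (hV : Continuous V)
    (hVtop : Tendsto (fun x : ℝ => V x / Real.log (1 + |x|)) atTop atTop)
    (hVbot : Tendsto (fun x : ℝ => V x / Real.log (1 + |x|)) atBot atTop) :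
    RapidDecay fun x => Real.exp (-(n * V x)) := by
  have hn' : (0 : ℝ) < n := by exact_mod_cast hn
  intro N
  have hcomp : ∀ᶠ x in cocompact ℝ, |Real.exp (-(n * V x))| * (1 + |x|) ^ N ≤ 1 := by
    have h1 : ∀ᶠ x : ℝ in cocompact ℝ, (N : ℝ) / n ≤ V x / Real.log (1 + |x|) := by
      rw [cocompact_eq_atBot_atTop]
      exact Filter.eventually_sup.2
        ⟨hVbot.eventually_ge_atTop _, hVtop.eventually_ge_atTop _⟩
    have h2 : ∀ᶠ x : ℝ in cocompact ℝ, x ≠ 0 := by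
      have : ({0} : Set ℝ)ᶜ ∈ cocompact ℝ := isCompact_singleton.compl_mem_cocompact
      exact this
    filter_upwards [h1, h2] with x hx hx0
    have hlog : 0 < Real.log (1 + |x|) := Real.log_pos (by linarith [abs_pos.2 hx0])
    rw [le_div_iff₀ hlog, div_mul_eq_mul_div, div_le_iff₀ hn'] at hx
    have h3 : (1 + |x|) ^ N = Real.exp (N * Real.log (1 + |x|)) := by
      rw [Real.exp_nat_mul, Real.exp_log (by positivity)]
    rw [Real.abs_exp, h3, ← Real.exp_add, Real.exp_le_one_iff]
    linarith
  obtain ⟨K, hK, hKc⟩ := Filter.mem_cocompact.1 hcomp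
  have hcont : Continuous fun x => |Real.exp (-(n * V x))| * (1 + |x|) ^ N := by fun_prop
  obtain ⟨C, hC⟩ := hK.exists_bound_of_continuousOn hcont.continuousOn
  refine ⟨max C 1, by positivity, fun x => ?_⟩
  rw [← div_eq_mul_inv, le_div_iff₀ (by positivity)]
  by_cases hx : x ∈ K
  · exact ((le_abs_self _).trans (hC x hx)).trans (le_max_left _ _)
  · exact (hKc hx).trans (le_max_right _ _)

/-! ### The vertical integral -/

/-- The Gaussian weight `exp ((z - μ)² / (2 v))`. -/
noncomputable def verticalWeight (μ v : ℝ) (z : ℂ) : ℂ := Complex.exp ((z - μ) ^ 2 / (2 * v))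

theorem norm_verticalWeight (μ v c u : ℝ) : ‖verticalWeight μ v (c + u * Complex.I)‖ =
    Real.exp ((c - μ) ^ 2 / (2 * v)) * Real.exp (-(1 / (2 * v) * u ^ 2)) := by
  rw [verticalWeight, Complex.norm_exp, ← Real.exp_add]
  congr 1
  have : ((c : ℂ) + u * Complex.I - μ) ^ 2 / (2 * v) =
      (((c - μ) ^ 2 / (2 * v) + -(1 / (2 * v) * u ^ 2) : ℝ) : ℂ) +
        ((2 * (c - μ) * u / (2 * v) : ℝ) : ℂ) * Complex.I := by
    push_cast
    linear_combination ((u : ℂ) ^ 2 / (2 * v)) * Complex.I_sq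
  rw [this, Complex.add_re, Complex.ofReal_re, Complex.re_ofReal_mul, Complex.I_re, mul_zero,
    add_zero]

theorem integrable_pow_mul_verticalWeight (μ c : ℝ) {v : ℝ} (hv : 0 < v) (k : ℕ) :
    Integrable fun u : ℝ => ((c : ℂ) + u * Complex.I) ^ k *
      verticalWeight μ v (c + u * Complex.I) := by
  have hcont : Continuous fun u : ℝ => ((c : ℂ) + u * Complex.I) ^ k *
      verticalWeight μ v (c + u * Complex.I) := by unfold verticalWeight; fun_prop
  refine (integrable_one_add_abs_inv.const_mul ((1 + |c|) ^ k * Real.exp ((c - μ) ^ 2 / (2 * v)) *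
    Real.exp (((k + 2 : ℕ) : ℝ) ^ 2 / (4 * (1 / (2 * v)))))).mono' hcont.aestronglyMeasurable
    (ae_of_all _ fun u => ?_)
  rw [norm_mul, norm_pow, norm_verticalWeight]
  have h1 : ‖(c : ℂ) + u * Complex.I‖ ≤ (1 + |c|) * (1 + |u|) := by
    refine (norm_add_le _ _).trans ?_
    rw [norm_mul, Complex.norm_I, mul_one, Complex.norm_real, Complex.norm_real, Real.norm_eq_abs,
      Real.norm_eq_abs]
    nlinarith [abs_nonneg c, abs_nonneg u, mul_nonneg (abs_nonneg c) (abs_nonneg u)]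
  have h2 := one_add_abs_pow_mul_exp_le (a := 1 / (2 * v)) (by positivity) (k + 2) u
  have h3 : (1 + |u|) ^ k * Real.exp (-(1 / (2 * v) * u ^ 2)) ≤
      Real.exp (((k + 2 : ℕ) : ℝ) ^ 2 / (4 * (1 / (2 * v)))) * ((1 + |u|) ^ 2)⁻¹ := by
    rw [← div_eq_mul_inv, le_div_iff₀ (by positivity)]
    calc _ = (1 + |u|) ^ (k + 2) * Real.exp (-(1 / (2 * v) * u ^ 2)) := by rw [pow_add]; ring
      _ ≤ _ := h2
  calc _ ≤ ((1 + |c|) * (1 + |u|)) ^ k *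
        (Real.exp ((c - μ) ^ 2 / (2 * v)) * Real.exp (-(1 / (2 * v) * u ^ 2))) := by gcongr
    _ = (1 + |c|) ^ k * Real.exp ((c - μ) ^ 2 / (2 * v)) *
        ((1 + |u|) ^ k * Real.exp (-(1 / (2 * v) * u ^ 2))) := by rw [mul_pow]; ring
    _ ≤ (1 + |c|) ^ k * Real.exp ((c - μ) ^ 2 / (2 * v)) *
        (Real.exp (((k + 2 : ℕ) : ℝ) ^ 2 / (4 * (1 / (2 * v)))) * ((1 + |u|) ^ 2)⁻¹) := by gcongr
    _ = _ := by ring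

/-- The integral representation of Hermite polynomials on a vertical line. Integrating the
derivative of `z ^ k` times the weight gives zero, which is the recursion of `heatPoly`; the base
case is a Gaussian integral on a shifted line, independent of `c`. -/
theorem integral_pow_mul_verticalWeight (μ c : ℝ) {v : ℝ} (hv : 0 < v) (k : ℕ) :
    ∫ u : ℝ, ((c : ℂ) + u * Complex.I) ^ k * verticalWeight μ v (c + u * Complex.I) =
      (√(2 * Real.pi * v) : ℝ) * (((heatPoly v k).eval μ : ℝ) : ℂ) := by
  have hvc : (v : ℂ) ≠ 0 := by exact_mod_cast hv.ne'
  have hi := integrable_pow_mul_verticalWeight μ c hv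
  induction k using Nat.strong_induction_on with
  | _ k ih =>
    cases k with
    | zero =>
      have h := GaussianFourier.integral_cexp_neg_mul_sq_add_real_mul_I
        (b := ((1 / (2 * v) : ℝ) : ℂ)) (by rw [Complex.ofReal_re]; positivity) (-(c - μ))
      simp only [pow_zero, one_mul, heatPoly, eval_one, Complex.ofReal_one, mul_one]
      have h2 : ∀ u : ℝ, verticalWeight μ v (c + u * Complex.I) =
          Complex.exp (-((1 / (2 * v) : ℝ) : ℂ) * (u + ((-(c - μ) : ℝ) : ℂ) * Complex.I) ^ 2) := by
        intro u
        rw [verticalWeight]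
        congr 1
        push_cast
        field_simp
        linear_combination ((u : ℂ) ^ 2 + (c - μ) ^ 2) * Complex.I_sq
      simp only [h2]
      rw [h, Real.sqrt_eq_rpow, Complex.ofReal_cpow (by positivity)]
      congr 1
      · push_cast; field_simp
      · norm_num
    | succ k =>
      have hd : ∀ u : ℝ, HasDerivAt (fun u : ℝ => ((c : ℂ) + u * Complex.I) ^ k *
          verticalWeight μ v (c + u * Complex.I))
          (Complex.I * (k * (((c : ℂ) + u * Complex.I) ^ (k - 1) *
            verticalWeight μ v (c + u * Complex.I)) +
            (1 / v) * (((c : ℂ) + u * Complex.I) ^ (k + 1) *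
              verticalWeight μ v (c + u * Complex.I)) -
            (μ / v) * (((c : ℂ) + u * Complex.I) ^ k *
              verticalWeight μ v (c + u * Complex.I)))) u := by
        intro u
        have e1 : HasDerivAt (fun u : ℝ => (c : ℂ) + u * Complex.I) Complex.I u := by
          have := ((hasDerivAt_id u).ofReal_comp.mul_const Complex.I).const_add (c : ℂ)
          simpa using this
        have e2 : HasDerivAt (fun u : ℝ => verticalWeight μ v (c + u * Complex.I))
            (verticalWeight μ v (c + u * Complex.I) *
              (2 * ((c : ℂ) + u * Complex.I - μ) * Complex.I / (2 * v))) u := by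
          have := (((e1.sub_const (μ : ℂ)).pow 2).div_const (2 * (v : ℂ))).cexp
          simpa [verticalWeight] using this
        refine ((e1.pow k).mul e2).congr_deriv ?_
        simp only [Pi.pow_apply]
        field_simp
        ring
      have h0 := integral_eq_zero_of_hasDerivAt_of_integrable hd
        (((((hi (k - 1)).const_mul _).add ((hi (k + 1)).const_mul _)).sub
          ((hi k).const_mul _)).const_mul _) (hi k)
      have i1 := (hi (k - 1)).const_mul (k : ℂ)
      have i2 := (hi (k + 1)).const_mul (1 / (v : ℂ))
      have i3 := (hi k).const_mul ((μ : ℂ) / v)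
      have i12 := i1.add i2
      simp only [Pi.add_def] at i12
      rw [integral_const_mul, integral_sub i12 i3, integral_add i1 i2, integral_const_mul,
        integral_const_mul, integral_const_mul, ih k (by omega)] at h0
      have h1 := (mul_eq_zero.1 h0).resolve_left Complex.I_ne_zero
      have h2 : ∫ u : ℝ, ((c : ℂ) + u * Complex.I) ^ (k + 1) *
          verticalWeight μ v (c + u * Complex.I) =
          μ * ((√(2 * Real.pi * v) : ℝ) * (((heatPoly v k).eval μ : ℝ) : ℂ)) -
          v * (k * ∫ u : ℝ, ((c : ℂ) + u * Complex.I) ^ (k - 1) *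
            verticalWeight μ v (c + u * Complex.I)) := by
        generalize (∫ u : ℝ, ((c : ℂ) + u * Complex.I) ^ (k + 1) *
          verticalWeight μ v (c + u * Complex.I)) = A at h1 ⊢
        generalize (∫ u : ℝ, ((c : ℂ) + u * Complex.I) ^ (k - 1) *
          verticalWeight μ v (c + u * Complex.I)) = A' at h1 ⊢
        field_simp at h1
        linear_combination h1
      rw [h2, heatPoly_succ, eval_sub, eval_mul, eval_X, eval_mul, eval_C]
      rcases k with _ | k
      · push_cast; ring
      · rw [ih (k + 1 - 1) (by omega)]
        push_cast
        ring

theorem integral_aeval_mul_verticalWeight (μ c : ℝ) {v : ℝ} (hv : 0 < v) (p : ℝ[X]) :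
    Integrable (fun u : ℝ => aeval ((c : ℂ) + u * Complex.I) p *
      verticalWeight μ v (c + u * Complex.I)) ∧
    ∫ u : ℝ, aeval ((c : ℂ) + u * Complex.I) p * verticalWeight μ v (c + u * Complex.I) =
      (√(2 * Real.pi * v) : ℝ) * (((heatInv v p).eval μ : ℝ) : ℂ) := by
  have hi := integrable_pow_mul_verticalWeight μ c hv
  have h1 : ∀ u : ℝ, aeval ((c : ℂ) + u * Complex.I) p * verticalWeight μ v (c + u * Complex.I) =
      ∑ k ∈ p.support, (p.coeff k : ℂ) * (((c : ℂ) + u * Complex.I) ^ k *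
        verticalWeight μ v (c + u * Complex.I)) := by
    intro u
    rw [aeval_def, eval₂_eq_sum, Polynomial.sum, Finset.sum_mul]
    refine Finset.sum_congr rfl fun k _ => ?_
    rw [Complex.coe_algebraMap]; ring
  simp only [h1]
  refine ⟨integrable_finsetSum _ fun k _ => (hi k).const_mul _, ?_⟩
  rw [integral_finsetSum _ fun k _ => (hi k).const_mul _]
  simp only [integral_const_mul, integral_pow_mul_verticalWeight μ c hv, heatInv, Polynomial.sum,
    eval_finsetSum, eval_mul, eval_C]
  push_cast
  rw [Finset.mul_sum]
  exact Finset.sum_congr rfl fun k _ => by ring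

/-- The `z`-exponent is a vertical Gaussian weight with centre `x / (1 - t)` and variance `t / (n (1
- t))`, the parameters occurring in `psi`. The `w`-exponent is the one of `G` from time `0` to `t'`.
-/
theorem integrand_eq {n : ℕ} (hn : 0 < n) (V : ℝ → ℝ) (p : ℕ → ℝ[X]) {t t' : ℝ} (ht0 : 0 < t)
    (ht1 : t < 1) (ht0' : 0 < t') (ht1' : t' < 1) (x y : ℝ) (z : ℂ) (w : ℝ) :
    integrand n V p x y t t' z w = ∑ l : Fin n,
      (aeval z (p l) * verticalWeight (x / (1 - t)) (t / (n * (1 - t))) z) *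
      (((√(2 * Real.pi * t') / √n * ((p l).eval w * Real.exp (-(n * V w)) *
        gaussianPart n w y 0 t') : ℝ)) : ℂ) := by
  have hn' : (0 : ℝ) < n := by exact_mod_cast hn
  have hB : 0 < 1 - t := by linarith
  have hB' : 0 < 1 - t' := by linarith
  have hBc : (1 - (t : ℂ)) ≠ 0 := by exact_mod_cast hB.ne'
  have htc : (t : ℂ) ≠ 0 := by exact_mod_cast ht0.ne'
  have hnc : (n : ℂ) ≠ 0 := by exact_mod_cast hn'.ne'
  have h1 : verticalWeight (x / (1 - t)) (t / (n * (1 - t))) z =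
      Complex.exp (n * (x - (1 - t) * z) ^ 2 / (2 * t * (1 - t))) := by
    rw [verticalWeight]
    congr 1
    push_cast
    field_simp
    ring
  have h2 : √(2 * Real.pi * t') / √n * gaussianPart n w y 0 t' =
      Real.exp (-(n * (y - (1 - t') * w) ^ 2 / (2 * t' * (1 - t')))) := by
    have e1 : √(n : ℝ) ≠ 0 := (Real.sqrt_pos.2 hn').ne'
    have e2 : √(2 * Real.pi * t') ≠ 0 := (Real.sqrt_pos.2 (by positivity)).ne'
    rw [gaussianPart, sub_zero, ← mul_assoc, div_mul_div_cancel₀ e1, div_self e2, one_mul]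
    congr 1
    field_simp
    ring
  have h3 : ∀ l : Fin n, √(2 * Real.pi * t') / √n * ((p l).eval w * Real.exp (-(n * V w)) *
        gaussianPart n w y 0 t') = (p l).eval w * Real.exp (-(n * V w)) *
      Real.exp (-(n * (y - (1 - t') * w) ^ 2 / (2 * t' * (1 - t')))) := by
    intro l
    rw [← h2]; ring
  simp only [h3, h1]
  rw [integrand, kernelPE, sub_eq_add_neg (n * (x - (1 - t) * z) ^ 2 / (2 * t * (1 - t)) : ℂ),
    Complex.exp_add, Finset.sum_range, Finset.mul_sum, Finset.sum_mul]
  refine Finset.sum_congr rfl fun l _ => ?_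
  push_cast
  ring

theorem integrable_integrand {n : ℕ} (hn : 0 < n) {V : ℝ → ℝ} {p : ℕ → ℝ[X]}
    (hφ : ∀ l, Continuous fun w => (p l).eval w * Real.exp (-(n * V w)))
    (hd : ∀ l, RapidDecay fun w => (p l).eval w * Real.exp (-(n * V w)))
    {t t' : ℝ} (ht0 : 0 < t) (ht1 : t < 1) (ht0' : 0 < t') (ht1' : t' < 1) (c x y : ℝ) :
    Integrable fun q : ℝ × ℝ => integrand n V p x y t t' (c + q.1 * Complex.I) q.2 := by
  have hn' : (0 : ℝ) < n := by exact_mod_cast hn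
  have hB : 0 < 1 - t := by linarith
  have hv : 0 < t / (n * (1 - t)) := by positivity
  simp only [integrand_eq hn V p ht0 ht1 ht0' ht1']
  refine integrable_finsetSum _ fun l _ => ?_
  exact Integrable.mul_prod (integral_aeval_mul_verticalWeight (x / (1 - t)) c hv (p l)).1
    ((integrable_mul_gaussianPart (hφ l) (hd l) hn ht0' ht1' y).const_mul _).ofReal

theorem kernelTilde_eq {n : ℕ} (hn : 0 < n) {V : ℝ → ℝ} {p : ℕ → ℝ[X]}
    (hφ : ∀ l, Continuous fun w => (p l).eval w * Real.exp (-(n * V w)))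
    (hd : ∀ l, RapidDecay fun w => (p l).eval w * Real.exp (-(n * V w)))
    {t t' : ℝ} (ht0 : 0 < t) (ht1 : t < 1) (ht0' : 0 < t') (ht1' : t' < 1) (c x y : ℝ) :
    kernelTilde n V p c x y t t' = ((∑ l : Fin n, psi n (p l) t x *
      phi n (fun w => (p l).eval w * Real.exp (-(n * V w))) t' y : ℝ) : ℂ) := by
  have hn' : (0 : ℝ) < n := by exact_mod_cast hn
  have hB : 0 < 1 - t := by linarith
  have hv : 0 < t / (n * (1 - t)) := by positivity
  have h1 : ∀ z, ∫ w : ℝ, integrand n V p x y t t' z w = ∑ l : Fin n,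
      (aeval z (p l) * verticalWeight (x / (1 - t)) (t / (n * (1 - t))) z) *
      (((√(2 * Real.pi * t') / √n *
        phi n (fun w => (p l).eval w * Real.exp (-(n * V w))) t' y : ℝ)) : ℂ) := by
    intro z
    simp only [integrand_eq hn V p ht0 ht1 ht0' ht1']
    have hi : ∀ l : Fin n, Integrable fun w : ℝ =>
        (aeval z (p l) * verticalWeight (x / (1 - t)) (t / (n * (1 - t))) z) *
        (((√(2 * Real.pi * t') / √n * ((p l).eval w * Real.exp (-(n * V w)) *
          gaussianPart n w y 0 t') : ℝ)) : ℂ) := fun l =>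
      (((integrable_mul_gaussianPart (hφ l) (hd l) hn ht0' ht1' y).const_mul _).ofReal).const_mul _
    rw [integral_finsetSum _ fun l _ => hi l]
    refine Finset.sum_congr rfl fun l _ => ?_
    rw [integral_const_mul, integral_complex_ofReal, integral_const_mul, phi, if_neg ht0'.ne']
  have h2 := fun l : Fin n => integral_aeval_mul_verticalWeight (x / (1 - t)) c hv (p l)
  rw [kernelTilde, verticalIntegral]
  simp only [h1, integral_mul_const]
  rw [integral_finsetSum _ fun l _ => (h2 l).1.mul_const _]
  simp only [integral_mul_const, (h2 _).2]
  push_cast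
  rw [Finset.sum_mul, Finset.mul_sum]
  refine Finset.sum_congr rfl fun l _ => ?_
  have h3 : (n : ℝ) / (2 * Real.pi * √(t * t')) * (√(2 * Real.pi * (t / (n * (1 - t)))) *
      (√(2 * Real.pi * t') / √n)) = (√(1 - t))⁻¹ := by
    have e : ∀ a : ℝ, 0 < a → √a ≠ 0 := fun a ha => (Real.sqrt_pos.2 ha).ne'
    have e1 : √(2 * Real.pi * (t / (n * (1 - t)))) = √(2 * Real.pi) * √t / (√n * √(1 - t)) := by
      rw [← Real.sqrt_mul (by positivity), ← Real.sqrt_mul hn'.le, ← Real.sqrt_div (by positivity)]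
      congr 1
      field_simp
    rw [e1, Real.sqrt_mul ht0.le, Real.sqrt_mul (by positivity) t']
    have := e _ hn'
    have := e _ hB
    have := e _ ht0
    have := e _ ht0'
    have s1 : √(n : ℝ) * √n = n := Real.mul_self_sqrt hn'.le
    have s2 : √(2 * Real.pi) * √(2 * Real.pi) = 2 * Real.pi :=
      Real.mul_self_sqrt (by positivity)
    field_simp
    nlinarith [s1, s2]
  have h4 : ((n : ℂ) / (2 * Real.pi * (√(t * t') : ℝ)) *
      ((√(2 * Real.pi * (t / (n * (1 - t)))) : ℝ) *
      ((√(2 * Real.pi * t') : ℝ) / (√n : ℝ)))) = ((√(1 - t) : ℝ) : ℂ)⁻¹ := by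
    exact_mod_cast congrArg (fun r : ℝ => (r : ℂ)) h3
  have h5 : (n : ℂ) / (2 * Real.pi * Complex.I * (√(t * t') : ℝ)) * Complex.I =
      (n : ℂ) / (2 * Real.pi * (√(t * t') : ℝ)) := by
    have : Complex.I ≠ 0 := Complex.I_ne_zero
    field_simp
  rw [psi]
  push_cast
  rw [← h4, ← h5]
  ring

theorem kernelX_eq {m n : ℕ} (hn : 0 < n) {V : ℝ → ℝ} {p : ℕ → ℝ[X]}
    (hφ : ∀ l, Continuous fun w => (p l).eval w * Real.exp (-(n * V w)))
    (hd : ∀ l, RapidDecay fun w => (p l).eval w * Real.exp (-(n * V w)))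
    {τ : Fin (m + 1) → ℝ} (hτ : StrictMono τ) (hτ1 : ∀ i, τ i < 1) {i j : Fin (m + 1)}
    (hi : 0 < τ i) (hj : 0 < τ j) (c x y : ℝ) :
    kernelX n V p c x y (τ i) (τ j) = ((extKernel n p
      (fun l w => (p l).eval w * Real.exp (-(n * V w))) τ i j x y : ℝ) : ℂ) := by
  rw [kernelX, kernelTilde_eq hn hφ hd hi (hτ1 i) hj (hτ1 j), extKernel]
  simp only [hτ.lt_iff_lt]
  split_ifs <;> push_cast <;> ring

end NIBM

namespace NIBM

/-! ### Brownian paths -/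

/-- Independence of the pairs across `i` and within each pair makes the law of all pairs a product
measure, which is then regrouped into the two families. -/
theorem indepFun_pi_of_iIndepFun {ι Ω α β : Type*} [Fintype ι] [MeasurableSpace Ω]
    [MeasurableSpace α] [MeasurableSpace β] {P : Measure Ω} [IsProbabilityMeasure P]
    {U : ι → Ω → α} {W : ι → Ω → β} (hU : ∀ i, Measurable (U i)) (hW : ∀ i, Measurable (W i))
    (h : iIndepFun (fun i ω => (U i ω, W i ω)) P) (hUW : ∀ i, IndepFun (U i) (W i) P) :
    IndepFun (fun ω i => U i ω) (fun ω i => W i ω) P := by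
  have hUi : iIndepFun U P := h.comp (fun _ => Prod.fst) fun _ => measurable_fst
  have hWi : iIndepFun W P := h.comp (fun _ => Prod.snd) fun _ => measurable_snd
  have := fun i => Measure.isProbabilityMeasure_map (hU i).aemeasurable (μ := P)
  have := fun i => Measure.isProbabilityMeasure_map (hW i).aemeasurable (μ := P)
  rw [indepFun_iff_map_prod_eq_prod_map_map (measurable_pi_lambda _ hU).aemeasurable
    (measurable_pi_lambda _ hW).aemeasurable,
    (iIndepFun_iff_map_fun_eq_pi_map fun i => (hU i).aemeasurable).1 hUi,
    (iIndepFun_iff_map_fun_eq_pi_map fun i => (hW i).aemeasurable).1 hWi,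
    ← (measurePreserving_arrowProdEquivProdArrow α β ι (fun i => P.map (U i))
      fun i => P.map (W i)).map_eq]
  have h1 := (iIndepFun_iff_map_fun_eq_pi_map
    fun i => ((hU i).prodMk (hW i)).aemeasurable).1 h
  have h2 : ∀ i, P.map (fun ω => (U i ω, W i ω)) = (P.map (U i)).prod (P.map (W i)) := fun i =>
    (indepFun_iff_map_prod_eq_prod_map_map (hU i).aemeasurable (hW i).aemeasurable).1 (hUW i)
  simp only [h2] at h1
  rw [← h1, Measure.map_map (MeasurableEquiv.measurable _)
    (measurable_pi_lambda _ fun i => (hU i).prodMk (hW i))]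
  rfl

/-- Independent Brownian motions all of whose paths are continuous and start at `0`. -/
structure IsRegularBrownian {n : ℕ} {Ω₀ : Type*} [MeasurableSpace Ω₀]
    (B : Fin n → ℝ≥0 → Ω₀ → ℝ) (P₀ : Measure Ω₀) : Prop where
  isPre : ∀ j, IsPreBrownianReal (B j) P₀
  indep : iIndepFun (fun (j : Fin n) (ω : Ω₀) (t : ℝ≥0) => B j t ω) P₀
  continuous : ∀ j ω, Continuous fun t => B j t ω
  measurable : ∀ j t, Measurable (B j t)
  zero : ∀ j ω, B j 0 ω = 0

/-- The paths are set to `0` on a null set. The given `B j t` are only almost everywhere measurable,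
with an exceptional set depending on `t`, so representatives are used at countably many dense times
and path continuity extends measurability to every `t`. -/
theorem IsIndepBrownian.exists_isRegularBrownian {n : ℕ} {Ω₀ : Type*} [MeasurableSpace Ω₀]
    {B : Fin n → ℝ≥0 → Ω₀ → ℝ} {P₀ : Measure Ω₀} (hB : IsIndepBrownian B P₀) :
    ∃ B' : Fin n → ℝ≥0 → Ω₀ → ℝ, IsRegularBrownian B' P₀ ∧
      ∀ᵐ ω ∂P₀, ∀ j t, B' j t ω = B j t ω := by
  obtain ⟨D, hDc, hD⟩ := TopologicalSpace.exists_countable_dense ℝ≥0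
  have hm : ∀ j t, AEMeasurable (B j t) P₀ := fun j t => (hB.isBrownian j).aemeasurable t
  have h1 : ∀ᵐ ω ∂P₀, ∀ j, Continuous (fun t => B j t ω) ∧ B j 0 ω = 0 ∧
      ∀ t ∈ D, B j t ω = (hm j t).mk _ ω := by
    refine ae_all_iff.2 fun j => ?_
    filter_upwards [(hB.isBrownian j).cont, (hB.isBrownian j).eval_zero_ae_eq_zero,
      (ae_ball_iff hDc).2 fun t _ => (hm j t).ae_eq_mk] with ω a b c
    exact ⟨a, b, c⟩
  obtain ⟨N, hN, hNm, hN0⟩ := exists_measurable_superset_of_null (ae_iff.1 h1)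
  have hgood : ∀ ω ∉ N, ∀ j, Continuous (fun t => B j t ω) ∧ B j 0 ω = 0 ∧
      ∀ t ∈ D, B j t ω = (hm j t).mk _ ω := fun ω hω => by
    by_contra hc
    exact hω (hN hc)
  have hae : ∀ᵐ ω ∂P₀, ω ∉ N := measure_eq_zero_iff_ae_notMem.1 hN0
  classical
  let B' : Fin n → ℝ≥0 → Ω₀ → ℝ := fun j t => Nᶜ.indicator (B j t)
  have heq : ∀ ω ∉ N, ∀ j t, B' j t ω = B j t ω := fun ω hω j t =>
    Set.indicator_of_mem (s := Nᶜ) hω _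
  have hzero : ∀ ω ∈ N, ∀ j t, B' j t ω = 0 := fun ω hω j t =>
    Set.indicator_of_notMem (s := Nᶜ) (fun h => h hω) _
  have hcont : ∀ j ω, Continuous fun t => B' j t ω := by
    intro j ω
    by_cases hω : ω ∈ N
    · simp only [hzero ω hω]
      exact continuous_const
    · simp only [heq ω hω]
      exact (hgood ω hω j).1
  have hmD : ∀ j, ∀ t ∈ D, Measurable (B' j t) := by
    intro j t ht
    have : B' j t = Nᶜ.indicator ((hm j t).mk _) := by
      ext ω
      by_cases hω : ω ∈ N
      · rw [hzero ω hω, Set.indicator_of_notMem (Set.notMem_compl_iff.2 hω)]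
      · rw [heq ω hω, Set.indicator_of_mem (s := Nᶜ) hω, (hgood ω hω j).2.2 t ht]
    rw [this]
    exact (hm j t).measurable_mk.indicator hNm.compl
  refine ⟨B', ⟨fun j => (hB.isBrownian j).toIsPreBrownianReal.congr fun t => ?_, ?_, hcont,
    fun j t => ?_, fun j ω => ?_⟩, ?_⟩
  · filter_upwards [hae] with ω hω using (heq ω hω j t).symm
  · refine hB.indep.congr fun j => ?_
    filter_upwards [hae] with ω hω
    exact funext fun t => (heq ω hω j t).symm
  · obtain ⟨x, hx, hxt⟩ := mem_closure_iff_seq_limit.1 (hD t)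
    exact measurable_of_tendsto_metrizable (fun i => hmD j (x i) (hx i))
      (tendsto_pi_nhds.2 fun ω => ((hcont j ω).tendsto t).comp hxt)
  · by_cases hω : ω ∈ N
    · exact hzero ω hω j 0
    · rw [heq ω hω, (hgood ω hω j).2.1]
  · filter_upwards [hae] with ω hω using heq ω hω

theorem isOpen_chamber (n : ℕ) : IsOpen (chamber n) := by
  have : chamber n = ⋂ i, ⋂ j, {a | i < j → a i < a j} := by
    ext a
    simp only [chamber, Set.mem_ofPred_eq, Set.mem_iInter, StrictMono]
  rw [this]
  refine isOpen_iInter_of_finite fun i => isOpen_iInter_of_finite fun j => ?_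
  by_cases h : i < j
  · simp only [h, true_imp_iff]
    exact isOpen_lt (continuous_apply i) (continuous_apply j)
  · simp [h]

/-- By compactness, paths that stay strictly ordered have gaps bounded below uniformly. A uniform
bound can be tested on a countable dense set of times, which makes the noncollision events
measurable; strict inequality tested there would not suffice. -/
theorem forall_strictMono_iff {n : ℕ} {S : Type*} [TopologicalSpace S] [CompactSpace S] {D : Set S}
    (hD : Dense D) {γ : S → Fin n → ℝ} (hγ : Continuous γ) :
    (∀ s, StrictMono (γ s)) ↔
      ∃ k : ℕ, ∀ s ∈ D, ∀ i j, i < j → 1 / ((k : ℝ) + 1) ≤ γ s j - γ s i := by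
  have hc : ∀ i, Continuous fun s => γ s i := fun i => (continuous_apply i).comp hγ
  constructor
  · intro h
    let U : ℕ → Set S := fun k => {s | ∀ i j, i < j → 1 / ((k : ℝ) + 1) < γ s j - γ s i}
    have hU : ∀ k, IsOpen (U k) := fun k => by
      have : U k = ⋂ i, ⋂ j, {s | i < j → 1 / ((k : ℝ) + 1) < γ s j - γ s i} := by
        ext s; simp [U]
      rw [this]
      refine isOpen_iInter_of_finite fun i => isOpen_iInter_of_finite fun j => ?_
      by_cases h : i < j
      · simp only [h, true_imp_iff]
        exact isOpen_lt continuous_const ((hc j).sub (hc i))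
      · simp [h]
    have hcov : Set.univ ⊆ ⋃ k, U k := by
      intro s _
      have h1 : ∀ i j, i < j → ∀ᶠ k : ℕ in atTop, 1 / ((k : ℝ) + 1) < γ s j - γ s i :=
        fun i j hij => tendsto_one_div_add_atTop_nhds_zero_nat.eventually_lt_const
          (sub_pos.2 (h s hij))
      have h2 : ∀ᶠ k : ℕ in atTop, ∀ i j, i < j → 1 / ((k : ℝ) + 1) < γ s j - γ s i :=
        eventually_all.2 fun i => eventually_all.2 fun j => eventually_imp_distrib_left.2 (h1 i j)
      obtain ⟨k, hk⟩ := h2.exists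
      exact Set.mem_iUnion.2 ⟨k, hk⟩
    have hdir : Directed (· ⊆ ·) U := by
      refine Monotone.directed_le fun k l hkl s hs i j hij => lt_of_le_of_lt ?_ (hs i j hij)
      exact one_div_le_one_div_of_le (by positivity) (by gcongr)
    obtain ⟨k, hk⟩ := isCompact_univ.elim_directed_cover U hU hcov hdir
    exact ⟨k, fun s _ i j hij => (hk (Set.mem_univ s) i j hij).le⟩
  · rintro ⟨k, hk⟩ s i j hij
    have hcl : IsClosed {s | 1 / ((k : ℝ) + 1) ≤ γ s j - γ s i} :=
      isClosed_le continuous_const ((hc j).sub (hc i))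
    have h1 := hcl.closure_subset_iff.2 (fun s hs => hk s hs i j hij : D ⊆ _) (hD s)
    have h2 : 0 < 1 / ((k : ℝ) + 1) := by positivity
    exact sub_pos.1 (h2.trans_le h1)

variable {n : ℕ} {Ω₀ : Type*} {B : Fin n → ℝ≥0 → Ω₀ → ℝ}

/-- The Brownian paths with diffusion parameter `n^{-1/2}` started from `a`. -/
noncomputable def freePath (B : Fin n → ℝ≥0 → Ω₀ → ℝ) (a : Fin n → ℝ) (t : ℝ≥0) (ω : Ω₀) :
    Fin n → ℝ :=
  fun j => a j + B j t ω / √(n : ℝ)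

/-- The event that the paths do not intersect during `[0, u]`. -/
def noCollision (B : Fin n → ℝ≥0 → Ω₀ → ℝ) (a : Fin n → ℝ) (u : ℝ≥0) : Set Ω₀ :=
  {ω | ∀ r ≤ u, StrictMono (freePath B a r ω)}

theorem noCollision_antitone (a : Fin n → ℝ) {u v : ℝ≥0} (h : u ≤ v) :
    noCollision B a v ⊆ noCollision B a u := fun _ hω r hr => hω r (hr.trans h)

/-- The events determined by the paths up to time `u`. -/
abbrev pastAlgebra (B : Fin n → ℝ≥0 → Ω₀ → ℝ) (u : ℝ≥0) : MeasurableSpace Ω₀ :=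
  MeasurableSpace.comap (fun ω (j : Fin n) (r : Set.Iic u) => B j r ω) inferInstance

theorem measurable_pastAlgebra_eval {u r : ℝ≥0} (hr : r ≤ u) (j : Fin n) :
    Measurable[pastAlgebra B u] (B j r) := by
  have h1 : Measurable[pastAlgebra B u] fun ω (j : Fin n) (r : Set.Iic u) => B j r ω :=
    comap_measurable _
  have h2 : Measurable fun x : Fin n → Set.Iic u → ℝ => x j ⟨r, hr⟩ := by fun_prop
  exact h2.comp h1

theorem measurable_pastAlgebra_freePath (a : Fin n → ℝ) {u r : ℝ≥0} (hr : r ≤ u) :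
    Measurable[pastAlgebra B u] (freePath B a r) :=
  @measurable_pi_lambda _ _ _ (pastAlgebra B u) _ _ fun j =>
    ((measurable_pastAlgebra_eval hr j).div_const _).const_add _

theorem pastAlgebra_mono {u v : ℝ≥0} (h : u ≤ v) : pastAlgebra B u ≤ pastAlgebra B v := by
  refine Measurable.comap_le ?_
  refine @measurable_pi_lambda _ _ _ (pastAlgebra B v) _ _ fun j => ?_
  refine @measurable_pi_lambda _ _ _ (pastAlgebra B v) _ _ fun r => ?_
  exact measurable_pastAlgebra_eval (le_trans r.2 h) j

namespace IsRegularBrownian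

variable [MeasurableSpace Ω₀] {P₀ : Measure Ω₀} (hB : IsRegularBrownian B P₀)
include hB

theorem pastAlgebra_le (u : ℝ≥0) : pastAlgebra B u ≤ ‹MeasurableSpace Ω₀› := by
  refine Measurable.comap_le ?_
  exact measurable_pi_lambda _ fun j => measurable_pi_lambda _ fun r => hB.measurable j r

theorem continuous_freePath (a : Fin n → ℝ) (ω : Ω₀) : Continuous fun t => freePath B a t ω :=
  continuous_pi fun j => continuous_const.add ((hB.continuous j ω).div_const _)

theorem measurable_freePath (a : Fin n → ℝ) (t : ℝ≥0) : Measurable (freePath B a t) :=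
  measurable_pi_lambda _ fun j => ((hB.measurable j t).div_const _).const_add _

theorem freePath_zero (a : Fin n → ℝ) (ω : Ω₀) : freePath B a 0 ω = a := by
  ext j
  simp [freePath, hB.zero]

theorem measurableSet_noCollision (a : Fin n → ℝ) (u : ℝ≥0) :
    MeasurableSet[pastAlgebra B u] (noCollision B a u) := by
  have : CompactSpace (Set.Iic u) := by
    rw [← isCompact_iff_compactSpace, ← Set.Icc_bot]
    exact isCompact_Icc
  obtain ⟨D, hDc, hD⟩ := TopologicalSpace.exists_countable_dense (Set.Iic u)
  have h1 : noCollision B a u = ⋃ k : ℕ, ⋂ s ∈ D, ⋂ i, ⋂ j, ⋂ _ : i < j,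
      {ω | 1 / ((k : ℝ) + 1) ≤ freePath B a s ω j - freePath B a s ω i} := by
    ext ω
    have h2 := forall_strictMono_iff hD (γ := fun s : Set.Iic u => freePath B a s ω)
      ((hB.continuous_freePath a ω).comp continuous_subtype_val)
    simp only [Subtype.forall, Set.mem_Iic] at h2
    simp only [noCollision, Set.mem_ofPred_eq, h2, Set.mem_iUnion, Set.mem_iInter, Subtype.forall,
      Set.mem_Iic]
  rw [h1]
  refine MeasurableSet.iUnion fun k => MeasurableSet.biInter hDc fun s _ =>
    MeasurableSet.iInter fun i => MeasurableSet.iInter fun j => MeasurableSet.iInter fun _ => ?_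
  have h3 := measurable_pastAlgebra_freePath (B := B) a s.2
  exact (((measurable_pi_apply j).comp h3).sub ((measurable_pi_apply i).comp h3))
    measurableSet_Ici

theorem indepFun_past (s t : ℝ≥0) [IsProbabilityMeasure P₀] :
    IndepFun (fun ω (j : Fin n) (r : Set.Iic s) => B j r ω)
      (fun ω (j : Fin n) => B j (s + t) ω - B j s ω) P₀ := by
  refine indepFun_pi_of_iIndepFun (U := fun j ω (r : Set.Iic s) => B j r ω)
    (W := fun j ω => B j (s + t) ω - B j s ω)
    (fun j => measurable_pi_lambda _ fun r => hB.measurable j r)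
    (fun j => (hB.measurable j _).sub (hB.measurable j _)) ?_ fun j => ?_
  · exact hB.indep.comp (fun _ x => ((fun r : Set.Iic s => x r), x (s + t) - x s))
      fun _ => by fun_prop
  · exact (((hB.isPre j).indepFun_shift s).comp (measurable_pi_apply t) measurable_id).symm

theorem map_increment (s t : ℝ≥0) [IsProbabilityMeasure P₀] :
    P₀.map (fun ω (j : Fin n) => B j (s + t) ω - B j s ω) =
      Measure.pi fun _ => gaussianReal 0 t := by
  have h1 : iIndepFun (fun (j : Fin n) ω => B j (s + t) ω - B j s ω) P₀ :=
    hB.indep.comp (fun _ x => x (s + t) - x s) fun _ => by fun_prop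
  refine ((iIndepFun_iff_map_fun_eq_pi_map
    fun j => ((hB.measurable j _).sub (hB.measurable j _)).aemeasurable).1 h1).trans ?_
  congr 1
  ext1 j
  rw [← (((hB.isPre j).shift s).hasLaw_eval t).map_eq]
  rfl

/-- The pair is jointly Gaussian and `cov (B_t - t B_1, B_1) = t - t = 0`. -/
theorem indepFun_bridge [IsProbabilityMeasure P₀] :
    IndepFun (fun ω (j : Fin n) (t : I) => B j (unitInterval.toNNReal t) ω - (t : ℝ) * B j 1 ω)
      (fun ω (j : Fin n) => B j 1 ω) P₀ := by
  refine indepFun_pi_of_iIndepFun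
    (U := fun j ω (t : I) => B j (unitInterval.toNNReal t) ω - (t : ℝ) * B j 1 ω)
    (W := fun j ω => B j 1 ω)
    (fun j => measurable_pi_lambda _ fun t =>
      (hB.measurable j _).sub ((hB.measurable j _).const_mul _))
    (fun j => hB.measurable j _) ?_ fun j => ?_
  · exact hB.indep.comp (fun _ x => ((fun t : I => x (unitInterval.toNNReal t) - (t : ℝ) * x 1),
      x 1)) fun _ => by fun_prop
  · have hG := IsPreBrownianReal.isGaussianProcess (hB.isPre j)
    have h1 : IndepFun (fun ω (t : I) => B j (unitInterval.toNNReal t) ω - (t : ℝ) * B j 1 ω)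
        (fun ω (_ : Unit) => B j 1 ω) P₀ := by
      refine IsGaussianProcess.indepFun_of_covariance_eq_zero
        (X := fun (t : I) ω => B j (unitInterval.toNNReal t) ω - (t : ℝ) * B j 1 ω)
        (Y := fun _ ω => B j 1 ω) ?_ (fun t =>
        ((hB.measurable j _).sub ((hB.measurable j _).const_mul _)).aemeasurable)
        (fun _ => (hB.measurable j _).aemeasurable) fun t _ => ?_
      · refine hG.of_isGaussianProcess ?_
        rintro (t | _)
        · exact ⟨{unitInterval.toNNReal t, 1},
            { toFun x := x ⟨unitInterval.toNNReal t, by simp⟩ - (t : ℝ) * x ⟨1, by simp⟩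
              map_add' x y := by simp; ring
              map_smul' c x := by simp; ring }, by simp⟩
        · exact ⟨{1},
            { toFun x := x ⟨1, by simp⟩
              map_add' x y := by simp
              map_smul' c x := by simp }, by simp⟩
      · have hL : ∀ r, MemLp (B j r) 2 P₀ := fun r => (hG.hasGaussianLaw_eval r).memLp_two
        rw [covariance_fun_sub_left (hL _) ((hL 1).const_mul _) (hL 1),
          covariance_const_mul_left]
        have e1 := (hB.isPre j).covariance_fun_eval (unitInterval.toNNReal t) 1
        have e2 := (hB.isPre j).covariance_fun_eval 1 1
        rw [e1, e2]
        have : unitInterval.toNNReal t ≤ 1 := t.2.2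
        rw [min_eq_left this]
        simp
    exact h1.comp measurable_id (measurable_pi_apply ())

end IsRegularBrownian

end NIBM

namespace NIBM

/-! ### The heat semigroup -/

variable {n : ℕ}

/-- The heat semigroup of Brownian motion in `ℝⁿ` with diffusion parameter `n^{-1/2}`. -/
noncomputable def heat (ψ : (Fin n → ℝ) → ℝ) (t : ℝ≥0) (x : Fin n → ℝ) : ℝ :=
  ∫ z, ψ (fun j => x j + √(t : ℝ) * z j / √(n : ℝ)) ∂(Measure.pi fun _ : Fin n => gaussianReal 0 1)

/-- The antisymmetrization of a function on `ℝⁿ`. -/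
noncomputable def antisymm (φ : (Fin n → ℝ) → ℝ) (x : Fin n → ℝ) : ℝ :=
  ∑ τ : Equiv.Perm (Fin n), ((Equiv.Perm.sign τ : ℤ) : ℝ) * φ (x ∘ τ)

theorem abs_sign (τ : Equiv.Perm (Fin n)) : |((Equiv.Perm.sign τ : ℤ) : ℝ)| = 1 := by
  rcases Int.units_eq_one_or (Equiv.Perm.sign τ) with h | h <;> simp [h]

theorem continuous_antisymm {φ : (Fin n → ℝ) → ℝ} (hφ : Continuous φ) :
    Continuous (antisymm φ) := by
  unfold antisymm
  refine continuous_finsetSum _ fun τ _ => continuous_const.mul (hφ.comp ?_)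
  exact continuous_pi fun i => continuous_apply _

theorem abs_antisymm_le {φ : (Fin n → ℝ) → ℝ} {C : ℝ} (hC : ∀ x, |φ x| ≤ C) (x : Fin n → ℝ) :
    |antisymm φ x| ≤ n.factorial * C := by
  unfold antisymm
  refine (Finset.abs_sum_le_sum_abs _ _).trans ((Finset.sum_le_card_nsmul _ _ C ?_).trans ?_)
  · intro τ _
    rw [abs_mul, abs_sign, one_mul]
    exact hC _
  · simp [Finset.card_univ, Fintype.card_perm]

theorem antisymm_comp_swap (φ : (Fin n → ℝ) → ℝ) {i j : Fin n} (hij : i ≠ j) (x : Fin n → ℝ) :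
    antisymm φ (x ∘ Equiv.swap i j) = -antisymm φ x := by
  unfold antisymm
  rw [← Finset.sum_neg_distrib]
  refine Fintype.sum_equiv (Equiv.mulLeft (Equiv.swap i j)) _ _ fun τ => ?_
  simp only [Equiv.coe_mulLeft, Equiv.Perm.sign_mul, Equiv.Perm.sign_swap hij, Equiv.Perm.coe_mul]
  simp [Function.comp_assoc]

/-- A nontrivial permutation takes a strictly increasing vector out of the chamber, so only the
identity term survives. -/
theorem antisymm_eq_self {φ : (Fin n → ℝ) → ℝ} (h0 : ∀ x ∉ chamber n, φ x = 0) {x : Fin n → ℝ}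
    (hx : x ∈ chamber n) : antisymm φ x = φ x := by
  unfold antisymm
  rw [Finset.sum_eq_single 1]
  · simp
  · intro τ _ hτ
    rw [h0, mul_zero]
    intro h
    refine hτ (Equiv.ext fun i => ?_)
    have h1 : StrictMono τ := fun a b hab => (StrictMono.lt_iff_lt hx).1 (h hab)
    have := Subsingleton.elim (StrictMono.orderIsoOfSurjective τ h1 τ.surjective) (OrderIso.refl _)
    exact congrArg (fun e : Fin n ≃o Fin n => e i) this
  · simp

theorem abs_heat_le {ψ : (Fin n → ℝ) → ℝ} {C : ℝ} (hC : ∀ x, |ψ x| ≤ C) (t : ℝ≥0)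
    (x : Fin n → ℝ) : |heat ψ t x| ≤ C := by
  have := norm_integral_le_of_norm_le_const
    (μ := Measure.pi fun _ : Fin n => gaussianReal 0 1)
    (f := fun z => ψ (fun j => x j + √(t : ℝ) * z j / √(n : ℝ))) (C := C)
    (ae_of_all _ fun z => hC _)
  simpa [heat] using this

theorem continuous_heat {ψ : (Fin n → ℝ) → ℝ} (hψ : Continuous ψ) {C : ℝ} (hC : ∀ x, |ψ x| ≤ C) :
    Continuous fun q : ℝ≥0 × (Fin n → ℝ) => heat ψ q.1 q.2 := by
  unfold heat
  refine continuous_of_dominated (bound := fun _ => C) (fun q => ?_) (fun q => ae_of_all _ fun z =>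
    hC _) (integrable_const _) (ae_of_all _ fun z => ?_)
  · exact (hψ.comp (by fun_prop)).aestronglyMeasurable
  · exact hψ.comp (by fun_prop)

/-- The heat flow commutes with coordinate swaps and so preserves antisymmetry; an antisymmetric
function vanishes where the two swapped coordinates agree. -/
theorem heat_eq_zero {ψ : (Fin n → ℝ) → ℝ} {i j : Fin n}
    (hψ : ∀ x, ψ (x ∘ Equiv.swap i j) = -ψ x) (t : ℝ≥0) {x : Fin n → ℝ} (hx : x i = x j) :
    heat ψ t x = 0 := by
  have hcm : Measurable fun z : Fin n → ℝ => z ∘ Equiv.swap i j :=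
    measurable_pi_lambda _ fun k => measurable_pi_apply (Equiv.swap i j k)
  have hmp : MeasurePreserving (fun z : Fin n → ℝ => z ∘ Equiv.swap i j)
      (Measure.pi fun _ : Fin n => gaussianReal 0 1)
      (Measure.pi fun _ : Fin n => gaussianReal 0 1) := by
    refine ⟨hcm, ?_⟩
    refine (Measure.pi_eq fun s hs => ?_).symm
    rw [Measure.map_apply hcm (MeasurableSet.univ_pi hs)]
    have : (fun z : Fin n → ℝ => z ∘ Equiv.swap i j) ⁻¹' Set.univ.pi s =
        Set.univ.pi fun k => s (Equiv.swap i j k) := by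
      ext z
      simp only [Set.mem_preimage, Set.mem_univ_pi, Function.comp]
      exact ⟨fun h k => by simpa using h (Equiv.swap i j k),
        fun h k => by simpa using h (Equiv.swap i j k)⟩
    rw [this, Measure.pi_pi]
    exact Fintype.prod_equiv (Equiv.swap i j) _ _ fun k => rfl
  have hxs : ∀ k, x (Equiv.swap i j k) = x k := by
    intro k
    rcases eq_or_ne k i with rfl | h1
    · rw [Equiv.swap_apply_left, hx]
    · rcases eq_or_ne k j with rfl | h2
      · rw [Equiv.swap_apply_right, hx]
      · rw [Equiv.swap_apply_of_ne_of_ne h1 h2]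
  have hme : MeasurableEmbedding (fun z : Fin n → ℝ => z ∘ Equiv.swap i j) :=
    (MeasurableEquiv.ofInvolutive _ (fun z => by ext k; simp) hcm).measurableEmbedding
  have h1 : heat ψ t x = -heat ψ t x := by
    conv_lhs => rw [heat, ← hmp.integral_comp hme]
    rw [heat, ← integral_neg]
    refine integral_congr_ae (ae_of_all _ fun z => ?_)
    simp only
    rw [← hψ]
    congr 1
    ext k
    simp [hxs]
  linarith

theorem map_pi_gaussianReal (t : ℝ≥0) :
    (Measure.pi fun _ : Fin n => gaussianReal 0 1).map (fun z j => √(t : ℝ) * z j) =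
      Measure.pi fun _ : Fin n => gaussianReal 0 t := by
  have h1 : (gaussianReal 0 1).map (fun z => √(t : ℝ) * z) = gaussianReal 0 t := by
    rw [gaussianReal_map_const_mul]
    congr 1
    · simp
    · ext; simp
  have := Measure.pi_map_pi (μ := fun _ : Fin n => gaussianReal 0 1)
    (f := fun _ z => √(t : ℝ) * z) (fun _ => by fun_prop)
  rw [this]
  simp only [h1]

section Markov

variable {Ω₀ : Type*} [MeasurableSpace Ω₀] {B : Fin n → ℝ≥0 → Ω₀ → ℝ} {P₀ : Measure Ω₀}
  [IsProbabilityMeasure P₀] (hB : IsRegularBrownian B P₀)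
include hB

namespace IsRegularBrownian

/-- The Markov property at the fixed time `s`: the increment from `s` to `T` is Gaussian and
independent of the past, so it can be integrated out. -/
theorem integral_mul_freePath (a : Fin n → ℝ) {s T : ℝ≥0} (hsT : s ≤ T) {Y : Ω₀ → ℝ}
    (hY : Measurable[pastAlgebra B s] Y) {C : ℝ} (hYC : ∀ ω, |Y ω| ≤ C)
    {ψ : (Fin n → ℝ) → ℝ} (hψ : Continuous ψ) {D : ℝ} (hψD : ∀ x, |ψ x| ≤ D) :
    ∫ ω, Y ω * ψ (freePath B a T ω) ∂P₀ =
      ∫ ω, Y ω * heat ψ (T - s) (freePath B a s ω) ∂P₀ := by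
  have hYm : Measurable Y := hY.mono (hB.pastAlgebra_le s) le_rfl
  set U : Ω₀ → ℝ × (Fin n → ℝ) := fun ω => (Y ω, freePath B a s ω) with hU
  set W : Ω₀ → Fin n → ℝ := fun ω j => B j (s + (T - s)) ω - B j s ω with hW
  have hUm : Measurable U := hYm.prodMk (hB.measurable_freePath a s)
  have hWm : Measurable W := measurable_pi_lambda _ fun j =>
    (hB.measurable j _).sub (hB.measurable j _)
  have hind : IndepFun U W P₀ := by
    have h1 := hB.indepFun_past s (T - s)
    rw [IndepFun_iff_Indep] at h1 ⊢
    refine indep_of_indep_of_le_left h1 (Measurable.comap_le ?_)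
    exact hY.prodMk (measurable_pastAlgebra_freePath a le_rfl)
  have hmap := (indepFun_iff_map_prod_eq_prod_map_map hUm.aemeasurable hWm.aemeasurable).1 hind
  rw [hB.map_increment s (T - s)] at hmap
  have := Measure.isProbabilityMeasure_map hUm.aemeasurable (μ := P₀)
  set h : (ℝ × (Fin n → ℝ)) × (Fin n → ℝ) → ℝ := fun q =>
    q.1.1 * ψ (fun j => q.1.2 j + q.2 j / √(n : ℝ)) with hh
  have hhm : Measurable h := by
    refine (measurable_fst.comp measurable_fst).mul (hψ.measurable.comp ?_)
    exact measurable_pi_lambda _ fun j => by fun_prop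
  have e1 : ∀ ω, Y ω * ψ (freePath B a T ω) = h (U ω, W ω) := by
    intro ω
    simp only [hh, hU, hW, freePath, add_tsub_cancel_of_le hsT]
    congr 2
    ext j
    rw [freePath]
    ring
  have e2 : ∀ u : ℝ × (Fin n → ℝ), u.1 * heat ψ (T - s) u.2 =
      ∫ w, h (u, w) ∂(Measure.pi fun _ : Fin n => gaussianReal 0 (T - s)) := by
    intro u
    have h1 : Measurable fun z : Fin n → ℝ => fun j => √((T - s : ℝ≥0) : ℝ) * z j := by fun_prop
    have h2 : Measurable fun w => h (u, w) := hhm.comp measurable_prodMk_left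
    rw [← map_pi_gaussianReal, integral_map h1.aemeasurable h2.aestronglyMeasurable, heat,
      ← integral_const_mul]
  have hint : Integrable h ((P₀.map U).prod
      (Measure.pi fun _ : Fin n => gaussianReal 0 (T - s))) := by
    rw [← hmap, integrable_map_measure hhm.aestronglyMeasurable (hUm.prodMk hWm).aemeasurable]
    refine Integrable.of_bound (hhm.comp (hUm.prodMk hWm)).aestronglyMeasurable (C * D)
      (ae_of_all _ fun ω => ?_)
    have hC0 : 0 ≤ C := (abs_nonneg _).trans (hYC ω)
    simp only [Function.comp, hh, hU, norm_mul, Real.norm_eq_abs]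
    exact mul_le_mul (hYC ω) (hψD _) (abs_nonneg _) hC0
  simp only [e1]
  rw [← integral_map (hUm.prodMk hWm).aemeasurable hhm.aestronglyMeasurable, hmap,
    integral_prod _ hint]
  simp only [← e2]
  rw [integral_map hUm.aemeasurable]
  have h3 : Continuous fun x : Fin n → ℝ => heat ψ (T - s) x :=
    (continuous_heat hψ hψD).comp (by fun_prop : Continuous fun x : Fin n → ℝ => (T - s, x))
  exact (measurable_fst.mul (h3.measurable.comp measurable_snd)).aestronglyMeasurable

end IsRegularBrownian

end Markov

end NIBM

namespace NIBM

/-! ### The Karlin–McGregor identity -/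

variable {n : ℕ} {Ω₀ : Type*} [MeasurableSpace Ω₀] {B : Fin n → ℝ≥0 → Ω₀ → ℝ} {P₀ : Measure Ω₀}

namespace IsRegularBrownian

variable (hB : IsRegularBrownian B P₀)
include hB

/-- The times at which strict order fails form a closed set; take its infimum. There the path is a
limit of increasing vectors, hence weakly increasing, but it is not strictly so, and two coordinates
coincide. -/
theorem exists_first_collision {a : Fin n → ℝ} {s T : ℝ≥0} {ω : Ω₀}
    (hs : ω ∈ noCollision B a s) (hT : ω ∉ noCollision B a T) :
    ∃ ρ ≤ T, (∀ u, ω ∈ noCollision B a u ↔ u < ρ) ∧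
      ∃ i j, i ≠ j ∧ freePath B a ρ ω i = freePath B a ρ ω j := by
  have hc := hB.continuous_freePath a ω
  set S : Set ℝ≥0 := {r | ¬ StrictMono (freePath B a r ω)} with hS
  have hcl : IsClosed S := by
    have : Sᶜ = (fun t => freePath B a t ω) ⁻¹' chamber n := by
      ext r; simp [S, chamber]
    rw [← isOpen_compl_iff, this]
    exact (isOpen_chamber n).preimage hc
  obtain ⟨r, hrT, hr⟩ : ∃ r ≤ T, ¬ StrictMono (freePath B a r ω) := by
    simpa [noCollision] using hT
  have hne : S.Nonempty := ⟨r, hr⟩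
  have hmem := hcl.csInf_mem hne (OrderBot.bddBelow S)
  have hlt : ∀ u < sInf S, StrictMono (freePath B a u ω) := fun u hu => by
    by_contra h
    exact absurd (csInf_le (OrderBot.bddBelow S) h) (not_le.2 hu)
  have hiff : ∀ u, ω ∈ noCollision B a u ↔ u < sInf S := fun u =>
    ⟨fun h => not_le.1 fun h1 => hmem (h _ h1), fun h r hr => hlt r (hr.trans_lt h)⟩
  refine ⟨sInf S, (csInf_le (OrderBot.bddBelow S) hr).trans hrT, hiff, ?_⟩
  have hpos : 0 < sInf S := zero_le.trans_lt ((hiff s).1 hs)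
  have hmono : Monotone (freePath B a (sInf S) ω) := by
    intro i j hij
    have h1 : IsClosed {u | freePath B a u ω i ≤ freePath B a u ω j} :=
      isClosed_le ((continuous_apply i).comp hc) ((continuous_apply j).comp hc)
    have h2 : Set.Iio (sInf S) ⊆ {u | freePath B a u ω i ≤ freePath B a u ω j} := fun u hu =>
      (hlt u hu).monotone hij
    have h3 := h1.closure_subset_iff.2 h2
    rw [closure_Iio' (⟨0, Set.mem_Iio.2 hpos⟩ : (Set.Iio (sInf S)).Nonempty)] at h3
    exact h3 (Set.mem_Iic.2 le_rfl)
  have h4 : ¬ Function.Injective (freePath B a (sInf S) ω) := fun h =>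
    hmem (hmono.strictMono_of_injective h)
  simp only [Function.Injective] at h4
  push Not at h4
  obtain ⟨i, j, h5, h6⟩ := h4
  exact ⟨i, j, h6, h5⟩

theorem measurable_indicator_noCollision (a : Fin n → ℝ) {u v : ℝ≥0} (h : u ≤ v) :
    Measurable[pastAlgebra B v] ((noCollision B a u).indicator fun _ => (1 : ℝ)) := by
  have h1 : Measurable[pastAlgebra B u] ((noCollision B a u).indicator fun _ => (1 : ℝ)) :=
    Measurable.indicator measurable_const (hB.measurableSet_noCollision a u)
  exact h1.mono (pastAlgebra_mono h) le_rfl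

/-- The reflection principle in analytic form. For antisymmetric `ψ` the paths that collide between
`s` and `T` contribute nothing, because at the collision the expected future value `heat ψ` is zero.
A refining grid of deterministic times replaces the strong Markov property. -/
theorem integral_noCollision_antisymm [IsProbabilityMeasure P₀] (a : Fin n → ℝ) {s T : ℝ≥0}
    (hsT : s ≤ T) {Y : Ω₀ → ℝ} (hY : Measurable[pastAlgebra B s] Y) {C : ℝ}
    (hYC : ∀ ω, |Y ω| ≤ C) {ψ : (Fin n → ℝ) → ℝ} (hψ : Continuous ψ) {D : ℝ}
    (hψD : ∀ x, |ψ x| ≤ D) (hanti : ∀ i j, i ≠ j → ∀ x, ψ (x ∘ Equiv.swap i j) = -ψ x) :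
    ∫ ω, Y ω * (noCollision B a T).indicator (fun _ => (1 : ℝ)) ω * ψ (freePath B a T ω) ∂P₀ =
    ∫ ω, Y ω * (noCollision B a s).indicator (fun _ => (1 : ℝ)) ω *
      heat ψ (T - s) (freePath B a s ω) ∂P₀ := by
  have hC0 : 0 ≤ C := by
    obtain ⟨ω⟩ := nonempty_of_isProbabilityMeasure P₀
    exact (abs_nonneg _).trans (hYC ω)
  have hD0 : 0 ≤ D := (abs_nonneg _).trans (hψD 0)
  set χ : ℝ≥0 → Ω₀ → ℝ := fun u => (noCollision B a u).indicator fun _ => (1 : ℝ) with hχ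
  have hχ1 : ∀ u ω, |χ u ω| ≤ 1 := fun u ω => by
    simp only [hχ, Set.indicator]; split_ifs <;> simp
  have hYm : Measurable Y := hY.mono (hB.pastAlgebra_le s) le_rfl
  have hχm : ∀ u, Measurable (χ u) := fun u =>
    (hB.measurable_indicator_noCollision a (le_refl u)).mono (hB.pastAlgebra_le u) le_rfl
  have hψm : Measurable fun ω => ψ (freePath B a T ω) :=
    hψ.measurable.comp (hB.measurable_freePath a T)
  have hYχ : ∀ u ω, |Y ω * χ u ω| ≤ C := fun u ω => by
    rw [abs_mul]
    nlinarith [hYC ω, hχ1 u ω, abs_nonneg (Y ω), abs_nonneg (χ u ω)]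
  refine Eq.trans ?_ (hB.integral_mul_freePath a hsT
    (hY.mul (hB.measurable_indicator_noCollision a le_rfl)) (hYχ s) hψ hψD)
  simp only [Pi.mul_apply]
  -- the grid of mesh `(T - s) / N`
  set u : ℕ → ℕ → ℝ≥0 := fun N j => s + (T - s) * (j / N) with hu
  have hu0 : ∀ N, u N 0 = s := fun N => by simp [hu]
  have huN : ∀ N, 0 < N → u N N = T := fun N hN => by
    simp only [hu]
    rw [div_self (by positivity), mul_one, add_tsub_cancel_of_le hsT]
  have humono : ∀ N, Monotone (u N) := fun N i j hij => by simp only [hu]; gcongr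
  have hstep : ∀ N j, u N (j + 1) = u N j + (T - s) / N := fun N j => by
    simp only [hu]
    push_cast
    rw [add_div, mul_add, add_assoc, mul_one_div]
  set h : ℝ≥0 → Ω₀ → ℝ := fun r ω => heat ψ (T - r) (freePath B a r ω) with hh
  have hhc : ∀ ω, Continuous fun r => h r ω := fun ω =>
    (continuous_heat hψ hψD).comp
      ((continuous_const.sub continuous_id).prodMk (hB.continuous_freePath a ω))
  have hhm : ∀ r, Measurable (h r) := fun r =>
    ((continuous_heat hψ hψD).comp
      (by fun_prop : Continuous fun x : Fin n → ℝ => (T - r, x))).measurable.comp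
      (hB.measurable_freePath a r)
  -- For a colliding path only the grid cell containing the first collision contributes, with the
  -- value of `h` at the right end of the cell.
  set S : ℕ → Ω₀ → ℝ := fun N ω => ∑ j ∈ Finset.range N,
    (χ (u N j) ω - χ (u N (j + 1)) ω) * h (u N (j + 1)) ω with hS
  have hχanti : ∀ {v w : ℝ≥0}, v ≤ w → ∀ ω, χ w ω ≤ χ v ω := fun hvw ω =>
    Set.indicator_le_indicator_of_subset (noCollision_antitone a hvw)
      (fun _ => zero_le_one) ω
  have hbound : ∀ N ω (ε : ℝ), 0 ≤ ε → (∀ j, ω ∈ noCollision B a (u N j) →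
      ω ∉ noCollision B a (u N (j + 1)) → |h (u N (j + 1)) ω| ≤ ε) → |S N ω| ≤ ε := by
    intro N ω ε hε hj
    have h1 : ∀ j, |(χ (u N j) ω - χ (u N (j + 1)) ω) * h (u N (j + 1)) ω| ≤
        (χ (u N j) ω - χ (u N (j + 1)) ω) * ε := by
      intro j
      have h2 := hχanti (humono N (Nat.le_succ j)) ω
      rw [abs_mul, abs_of_nonneg (sub_nonneg.2 h2)]
      by_cases h3 : ω ∈ noCollision B a (u N (j + 1))
      · have h4 := noCollision_antitone a (humono N (Nat.le_succ j)) h3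
        simp [hχ, h3, h4]
      · by_cases h4 : ω ∈ noCollision B a (u N j)
        · exact mul_le_mul_of_nonneg_left (hj j h4 h3) (sub_nonneg.2 h2)
        · simp [hχ, h3, h4]
    refine (Finset.abs_sum_le_sum_abs _ _).trans ((Finset.sum_le_sum fun j _ => h1 j).trans ?_)
    rw [← Finset.sum_mul, Finset.sum_range_sub']
    have h5 : χ (u N 0) ω - χ (u N N) ω ≤ 1 := by
      have h6 : 0 ≤ χ (u N N) ω := Set.indicator_nonneg (fun _ _ => zero_le_one) _
      linarith [(le_abs_self _).trans (hχ1 (u N 0) ω)]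
    nlinarith
  have hlim : ∀ ω, Tendsto (fun N => S N ω) atTop (𝓝 0) := by
    intro ω
    rw [Metric.tendsto_atTop]
    intro ε hε
    by_cases hs : ω ∈ noCollision B a s
    swap
    · refine ⟨0, fun N _ => ?_⟩
      rw [Real.dist_eq, sub_zero]
      refine lt_of_le_of_lt (hbound N ω (ε / 2) (by positivity) fun j hj => ?_) (half_lt_self hε)
      exact absurd (noCollision_antitone a (by simp [hu]) hj) hs
    by_cases hT : ω ∈ noCollision B a T
    · refine ⟨1, fun N hN => ?_⟩
      have h0 : ∀ j ∈ Finset.range N, (χ (u N j) ω - χ (u N (j + 1)) ω) * h (u N (j + 1)) ω = 0 := by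
        intro j hj
        have h1 : ∀ k ≤ N, ω ∈ noCollision B a (u N k) := fun k hk =>
          noCollision_antitone a ((humono N hk).trans_eq (huN N hN)) hT
        have h2 := h1 j (Finset.mem_range.1 hj).le
        have h3 := h1 (j + 1) (Finset.mem_range.1 hj)
        simp [hχ, h2, h3]
      simp only [hS, Finset.sum_eq_zero h0, dist_self]
      exact hε
    · obtain ⟨ρ, hρT, hρ, i, j, hij, hcol⟩ := hB.exists_first_collision hs hT
      -- The right end of that cell is within one mesh of `ρ`, where `h` vanishes, so continuity of
      -- `h` along the path makes the sum small.
      have hρ0 : h ρ ω = 0 := heat_eq_zero (hanti i j hij) _ hcol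
      obtain ⟨δ, hδ, hδε⟩ := Metric.continuous_iff.1 (hhc ω) ρ (ε / 2) (by positivity)
      have hmesh : Tendsto (fun N : ℕ => ((T - s : ℝ≥0) : ℝ) / N) atTop (𝓝 0) :=
        tendsto_const_div_atTop_nhds_zero_nat _
      obtain ⟨N₀, hN₀⟩ := eventually_atTop.1 (hmesh.eventually_lt_const hδ)
      refine ⟨N₀, fun N hN => ?_⟩
      rw [Real.dist_eq, sub_zero]
      refine lt_of_le_of_lt (hbound N ω (ε / 2) (by positivity) fun k hk1 hk2 => ?_)
        (half_lt_self hε)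
      have h1 : u N k < ρ := (hρ _).1 hk1
      have h2 : ρ ≤ u N (k + 1) := not_lt.1 fun h => hk2 ((hρ _).2 h)
      have h3 : dist (u N (k + 1)) ρ < δ := by
        have h4 : (u N (k + 1) : ℝ) = u N k + ((T - s : ℝ≥0) : ℝ) / N := by
          rw [hstep]; push_cast; rfl
        have h1' : (u N k : ℝ) < ρ := by exact_mod_cast h1
        have h2' : (ρ : ℝ) ≤ u N (k + 1) := by exact_mod_cast h2
        rw [NNReal.dist_eq, abs_of_nonneg (by linarith)]
        linarith [hN₀ N hN]
      have h5 := hδε _ h3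
      rw [Real.dist_eq, hρ0, sub_zero] at h5
      exact h5.le
  have hSm : ∀ N, Measurable (S N) := fun N =>
    Finset.measurable_sum _ fun j _ => ((hχm _).sub (hχm _)).mul (hhm _)
  have hSD : ∀ N ω, |S N ω| ≤ D := fun N ω =>
    hbound N ω D hD0 fun j _ _ => abs_heat_le hψD _ _
  have hint : ∀ v, Integrable (fun ω => Y ω * χ v ω * ψ (freePath B a T ω)) P₀ := fun v => by
    refine Integrable.of_bound ((hYm.mul (hχm v)).mul hψm).aestronglyMeasurable (C * D)
      (ae_of_all _ fun ω => ?_)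
    rw [Real.norm_eq_abs, abs_mul]
    exact mul_le_mul (hYχ v ω) (hψD _) (abs_nonneg _) hC0
  have hint2 : ∀ v w, Integrable (fun ω => Y ω * χ v ω * h w ω) P₀ := fun v w => by
    refine Integrable.of_bound ((hYm.mul (hχm v)).mul (hhm w)).aestronglyMeasurable (C * D)
      (ae_of_all _ fun ω => ?_)
    rw [Real.norm_eq_abs, abs_mul]
    exact mul_le_mul (hYχ v ω) (abs_heat_le hψD _ _) (abs_nonneg _) hC0
  -- The contribution of the colliding paths, telescoped over the grid. Each indicator difference is
  -- known at time `u N (j + 1)`, so the Markov property there replaces `ψ` at time `T` by `h`. The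
  -- left side does not depend on `N`.
  have hconst : ∀ N, 0 < N → ∫ ω, Y ω * χ s ω * ψ (freePath B a T ω) ∂P₀ -
      ∫ ω, Y ω * χ T ω * ψ (freePath B a T ω) ∂P₀ = ∫ ω, Y ω * S N ω ∂P₀ := by
    intro N hN
    have h1 : ∀ j < N, ∫ ω, Y ω * χ (u N j) ω * ψ (freePath B a T ω) ∂P₀ -
        ∫ ω, Y ω * χ (u N (j + 1)) ω * ψ (freePath B a T ω) ∂P₀ =
        ∫ ω, Y ω * ((χ (u N j) ω - χ (u N (j + 1)) ω) * h (u N (j + 1)) ω) ∂P₀ := by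
      intro j hj
      have h2 : u N (j + 1) ≤ T := (humono N hj).trans_eq (huN N hN)
      have h3 : s ≤ u N (j + 1) := by simp [hu]
      have h4 : ∀ v ≤ u N (j + 1), ∫ ω, Y ω * χ v ω * ψ (freePath B a T ω) ∂P₀ =
          ∫ ω, Y ω * χ v ω * h (u N (j + 1)) ω ∂P₀ := fun v hv =>
        hB.integral_mul_freePath a h2 ((hY.mono (pastAlgebra_mono h3) le_rfl).mul
          (hB.measurable_indicator_noCollision a hv)) (hYχ v) hψ hψD
      rw [h4 _ (humono N (Nat.le_succ j)), h4 _ le_rfl, ← integral_sub (hint2 _ _) (hint2 _ _)]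
      refine integral_congr_ae (ae_of_all _ fun ω => ?_)
      simp only
      ring
    have h5 : ∀ j, Integrable (fun ω =>
        Y ω * ((χ (u N j) ω - χ (u N (j + 1)) ω) * h (u N (j + 1)) ω)) P₀ := fun j => by
      refine ((hint2 (u N j) (u N (j + 1))).sub (hint2 (u N (j + 1)) (u N (j + 1)))).congr
        (ae_of_all _ fun ω => ?_)
      simp only [Pi.sub_apply]
      ring
    simp only [hS, Finset.mul_sum]
    rw [integral_finsetSum _ fun j _ => h5 j, ← Finset.sum_congr rfl fun j hj =>
      h1 j (Finset.mem_range.1 hj), Finset.sum_range_sub', hu0, huN N hN]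
  have hzero : Tendsto (fun N => ∫ ω, Y ω * S N ω ∂P₀) atTop (𝓝 (∫ ω, Y ω * 0 ∂P₀)) := by
    refine tendsto_integral_of_dominated_convergence (fun _ => C * D)
      (fun N => (hYm.mul (hSm N)).aestronglyMeasurable) (integrable_const _)
      (fun N => ae_of_all _ fun ω => ?_) (ae_of_all _ fun ω => (hlim ω).const_mul _)
    rw [Real.norm_eq_abs, abs_mul]
    exact mul_le_mul (hYC ω) (hSD N ω) (abs_nonneg _) hC0
  have hfin := tendsto_nhds_unique (tendsto_const_nhds.congr' (eventually_atTop.2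
    ⟨1, fun N hN => hconst N hN⟩)) hzero
  simp only [mul_zero, integral_zero] at hfin
  linarith

/-- Integrating a function of the endpoint which vanishes off the chamber propagates through the
heat semigroup applied to its antisymmetrization. -/
theorem integral_noCollision [IsProbabilityMeasure P₀] (a : Fin n → ℝ) {s T : ℝ≥0}
    (hsT : s ≤ T) {Y : Ω₀ → ℝ} (hY : Measurable[pastAlgebra B s] Y) {C : ℝ}
    (hYC : ∀ ω, |Y ω| ≤ C) {φ : (Fin n → ℝ) → ℝ} (hφ : Continuous φ) {D : ℝ}
    (hφD : ∀ x, |φ x| ≤ D) (hφ0 : ∀ x ∉ chamber n, φ x = 0) :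
    ∫ ω, Y ω * (noCollision B a T).indicator (fun _ => (1 : ℝ)) ω * φ (freePath B a T ω) ∂P₀ =
    ∫ ω, Y ω * (noCollision B a s).indicator (fun _ => (1 : ℝ)) ω *
      heat (antisymm φ) (T - s) (freePath B a s ω) ∂P₀ := by
  rw [← hB.integral_noCollision_antisymm a hsT hY hYC (continuous_antisymm hφ)
    (abs_antisymm_le hφD) fun i j hij x => antisymm_comp_swap φ hij x]
  refine integral_congr_ae (ae_of_all _ fun ω => ?_)
  simp only
  by_cases hω : ω ∈ noCollision B a T
  · rw [antisymm_eq_self hφ0 (hω T le_rfl)]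
  · simp [hω]

end IsRegularBrownian

end NIBM

namespace NIBM

/-! ### Karlin–McGregor determinants -/

variable {n : ℕ}

theorem pi_gaussianReal_eq_withDensity (x : Fin n → ℝ) {v : ℝ≥0} (hv : v ≠ 0) :
    Measure.pi (fun j => gaussianReal (x j) v) = (volume : Measure (Fin n → ℝ)).withDensity
      fun y => ENNReal.ofReal (∏ j, gaussianPDFReal (x j) v (y j)) := by
  refine Measure.pi_eq fun s hs => ?_
  have hm : MeasurableSet (Set.univ.pi s) := MeasurableSet.univ_pi hs
  have hint : Integrable fun y : Fin n → ℝ => ∏ j, gaussianPDFReal (x j) v (y j) :=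
    Integrable.fintype_prod fun j => integrable_gaussianPDFReal (x j) v
  rw [withDensity_apply _ hm, ← ofReal_integral_eq_lintegral_ofReal hint.integrableOn
    (ae_of_all _ fun y => Finset.prod_nonneg fun j _ => gaussianPDFReal_nonneg _ _ _),
    ← integral_indicator hm]
  have h1 : ∀ y : Fin n → ℝ, (Set.univ.pi s).indicator
      (fun y => ∏ j, gaussianPDFReal (x j) v (y j)) y =
      ∏ j, (s j).indicator (gaussianPDFReal (x j) v) (y j) := by
    intro y
    by_cases hy : y ∈ Set.univ.pi s
    · rw [Set.indicator_of_mem hy]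
      exact Finset.prod_congr rfl fun j _ => (Set.indicator_of_mem (hy j trivial) _).symm
    · rw [Set.indicator_of_notMem hy]
      simp only [Set.mem_univ_pi, not_forall] at hy
      obtain ⟨j, hj⟩ := hy
      exact (Finset.prod_eq_zero (Finset.mem_univ j) (Set.indicator_of_notMem hj _)).symm
  simp only [h1]
  rw [integral_fintype_prod_volume_eq_prod fun j => (s j).indicator (gaussianPDFReal (x j) v),
    ENNReal.ofReal_prod_of_nonneg fun j _ => integral_nonneg fun y =>
      Set.indicator_nonneg (fun _ _ => gaussianPDFReal_nonneg _ _ _) _]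
  refine Finset.prod_congr rfl fun j _ => ?_
  rw [integral_indicator (hs j), gaussianReal_apply_eq_integral _ hv]

/-- The Karlin–McGregor determinant of the transition densities of Brownian motion with diffusion
parameter `n^{-1/2}`. -/
noncomputable def transition (n : ℕ) (t : ℝ≥0) (x y : Fin n → ℝ) : ℝ :=
  (Matrix.of fun k l => gaussianPDFReal (x k) (t / n) (y l)).det

theorem continuous_transition_comp {S : Type*} [TopologicalSpace S] (t : ℝ≥0)
    {f g : S → Fin n → ℝ} (hf : Continuous f) (hg : Continuous g) :
    Continuous fun s => transition n t (f s) (g s) := by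
  refine Continuous.matrix_det (continuous_matrix fun k l => ?_)
  simp only [Matrix.of_apply, gaussianPDFReal]
  fun_prop

theorem transition_eq_sum (t : ℝ≥0) (x y : Fin n → ℝ) :
    transition n t x y = ∑ τ : Equiv.Perm (Fin n), ((Equiv.Perm.sign τ : ℤ) : ℝ) *
      ∏ j, gaussianPDFReal (x (τ j)) (t / n) (y j) := by
  rw [transition, Matrix.det_apply']
  rfl

theorem abs_transition_le (t : ℝ≥0) (x y : Fin n → ℝ) :
    |transition n t x y| ≤ ∑ τ : Equiv.Perm (Fin n),
      ∏ j, gaussianPDFReal (x (τ j)) (t / n) (y j) := by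
  rw [transition_eq_sum]
  refine (Finset.abs_sum_le_sum_abs _ _).trans (Finset.sum_le_sum fun τ _ => ?_)
  rw [abs_mul, abs_sign, one_mul, abs_of_nonneg]
  exact Finset.prod_nonneg fun j _ => gaussianPDFReal_nonneg _ _ _

theorem integrable_prod_gaussianPDFReal (v : ℝ≥0) (x : Fin n → ℝ) :
    Integrable fun y : Fin n → ℝ => ∏ j, gaussianPDFReal (x j) v (y j) :=
  Integrable.fintype_prod fun j => integrable_gaussianPDFReal (x j) v

theorem integrable_transition (t : ℝ≥0) (x : Fin n → ℝ) :
    Integrable fun y => transition n t x y := by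
  simp only [transition_eq_sum]
  exact integrable_finsetSum _ fun τ _ =>
    (integrable_prod_gaussianPDFReal (t / n) (x ∘ τ)).const_mul _

theorem integral_abs_transition_le (hn : 0 < n) {t : ℝ≥0} (ht : 0 < t) (x : Fin n → ℝ) :
    ∫ y, |transition n t x y| ≤ n.factorial := by
  have hv : t / n ≠ 0 := by positivity
  refine (integral_mono (g := fun y => ∑ τ : Equiv.Perm (Fin n),
      ∏ j, gaussianPDFReal ((x ∘ τ) j) (t / n) (y j)) (integrable_transition t x).abs
    (integrable_finsetSum _ fun τ _ => integrable_prod_gaussianPDFReal (t / n) (x ∘ τ))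
    (abs_transition_le t x)).trans ?_
  have h0 : ∀ τ : Equiv.Perm (Fin n), Integrable fun y : Fin n → ℝ =>
      ∏ j, gaussianPDFReal ((x ∘ τ) j) (t / n) (y j) := fun τ =>
    integrable_prod_gaussianPDFReal (t / n) (x ∘ τ)
  rw [integral_finsetSum _ fun τ _ => h0 τ]
  have h1 : ∀ τ : Equiv.Perm (Fin n), ∫ y : Fin n → ℝ,
      ∏ j, gaussianPDFReal ((x ∘ τ) j) (t / n) (y j) = 1 := fun τ => by
    rw [integral_fintype_prod_volume_eq_prod fun j => gaussianPDFReal ((x ∘ τ) j) (t / n)]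
    exact Finset.prod_eq_one fun j _ => integral_gaussianPDFReal_eq_one _ hv
  simp only [h1]
  simp [Finset.card_univ, Fintype.card_perm]

theorem heat_eq_integral (hn : 0 < n) {t : ℝ≥0} (ht : 0 < t) {ψ : (Fin n → ℝ) → ℝ}
    (hψ : Measurable ψ) (x : Fin n → ℝ) :
    heat ψ t x = ∫ y : Fin n → ℝ, (∏ j, gaussianPDFReal (x j) (t / n) (y j)) * ψ y := by
  have hv : t / n ≠ 0 := by positivity
  have h1 : ∀ j : Fin n, (gaussianReal 0 1).map (fun z => x j + √(t : ℝ) * z / √(n : ℝ)) =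
      gaussianReal (x j) (t / n) := by
    intro j
    have h2 : (fun z => x j + √(t : ℝ) * z / √(n : ℝ)) =
        (fun z => x j + z) ∘ fun z => (√(t : ℝ) / √(n : ℝ)) * z := by
      ext z; simp only [Function.comp]; ring
    rw [h2, ← Measure.map_map (by fun_prop) (by fun_prop), gaussianReal_map_const_mul,
      gaussianReal_map_const_add]
    congr 1
    · simp
    · ext
      simp [div_pow]
  have h3 := Measure.pi_map_pi (μ := fun _ : Fin n => gaussianReal 0 1)
    (f := fun j z => x j + √(t : ℝ) * z / √(n : ℝ)) (fun _ => by fun_prop)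
  simp only [h1] at h3
  have h4 : Measurable fun (z : Fin n → ℝ) (j : Fin n) => x j + √(t : ℝ) * z j / √(n : ℝ) := by
    fun_prop
  rw [heat, ← integral_map h4.aemeasurable hψ.aestronglyMeasurable, h3,
    pi_gaussianReal_eq_withDensity x hv, integral_withDensity_eq_integral_toReal_smul₀]
  · refine integral_congr_ae (ae_of_all _ fun y => ?_)
    simp only
    rw [ENNReal.toReal_ofReal (Finset.prod_nonneg fun j _ => gaussianPDFReal_nonneg _ _ _),
      smul_eq_mul]
  · exact (integrable_prod_gaussianPDFReal (t / n) x).aestronglyMeasurable.aemeasurable.ennreal_ofReal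
  · exact ae_of_all _ fun y => ENNReal.ofReal_lt_top

/-- Permuting the integration variables moves the antisymmetrization from `φ` to the Gaussian
product density, which becomes a determinant. -/
theorem heat_antisymm_eq (hn : 0 < n) {t : ℝ≥0} (ht : 0 < t) {φ : (Fin n → ℝ) → ℝ}
    (hφ : Continuous φ) {D : ℝ} (hφD : ∀ x, |φ x| ≤ D) (x : Fin n → ℝ) :
    heat (antisymm φ) t x = ∫ y, transition n t x y * φ y := by
  rw [heat_eq_integral hn ht (continuous_antisymm hφ).measurable]
  have hi : ∀ τ : Equiv.Perm (Fin n), ∀ x' : Fin n → ℝ, Integrable fun y : Fin n → ℝ =>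
      ((Equiv.Perm.sign τ : ℤ) : ℝ) * ((∏ j, gaussianPDFReal (x' j) (t / n) (y j)) * φ y) :=
    fun τ x' => ((integrable_prod_gaussianPDFReal (t / n) x').mul_bdd
      hφ.aestronglyMeasurable (ae_of_all _ hφD)).const_mul _
  have hc : ∀ τ : Equiv.Perm (Fin n), Continuous fun y : Fin n → ℝ => φ (y ∘ τ) := fun τ =>
    hφ.comp (continuous_pi fun i => continuous_apply _)
  have hi2 : ∀ τ : Equiv.Perm (Fin n), Integrable fun y : Fin n → ℝ =>
      ((Equiv.Perm.sign τ : ℤ) : ℝ) *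
        ((∏ j, gaussianPDFReal (x j) (t / n) (y j)) * φ (y ∘ τ)) :=
    fun τ => ((integrable_prod_gaussianPDFReal (t / n) x).mul_bdd
      (hc τ).aestronglyMeasurable (ae_of_all _ fun y => hφD _)).const_mul _
  have h1 : ∀ y : Fin n → ℝ, (∏ j, gaussianPDFReal (x j) (t / n) (y j)) * antisymm φ y =
      ∑ τ : Equiv.Perm (Fin n), ((Equiv.Perm.sign τ : ℤ) : ℝ) *
        ((∏ j, gaussianPDFReal (x j) (t / n) (y j)) * φ (y ∘ τ)) := fun y => by
    rw [antisymm, Finset.mul_sum]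
    exact Finset.sum_congr rfl fun τ _ => by ring
  have h2 : ∀ y : Fin n → ℝ, transition n t x y * φ y =
      ∑ τ : Equiv.Perm (Fin n), ((Equiv.Perm.sign τ : ℤ) : ℝ) *
        ((∏ j, gaussianPDFReal ((x ∘ τ) j) (t / n) (y j)) * φ y) := fun y => by
    rw [transition_eq_sum, Finset.sum_mul]
    exact Finset.sum_congr rfl fun τ _ => by simp only [Function.comp]; ring
  simp only [h1, h2]
  rw [integral_finsetSum _ fun τ _ => hi2 τ, integral_finsetSum _ fun τ _ => hi τ _]
  refine Finset.sum_congr rfl fun τ _ => ?_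
  rw [integral_const_mul, integral_const_mul]
  congr 1
  have hmp := volume_measurePreserving_piCongrLeft (fun _ : Fin n => ℝ) τ
  rw [← hmp.integral_comp']
  have h3 : ∀ (y : Fin n → ℝ) j, (MeasurableEquiv.piCongrLeft (fun _ : Fin n => ℝ) τ) y (τ j) = y j :=
    fun y j => Equiv.piCongrLeft_apply_apply (fun _ : Fin n => ℝ) τ y j
  refine integral_congr_ae (ae_of_all _ fun y => ?_)
  simp only
  congr 1
  · rw [← Equiv.prod_comp τ]
    exact Finset.prod_congr rfl fun j _ => by rw [h3, Function.comp]
  · congr 1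
    ext j
    simp [h3]

/-- A boundary point of the chamber is weakly but not strictly increasing, so two coordinates
coincide and `H` vanishes there: cutting off at the boundary creates no jump. -/
theorem continuous_indicator_chamber {H : (Fin n → ℝ) → ℝ} (hH : Continuous H)
    (h0 : ∀ x i j, i ≠ j → x i = x j → H x = 0) : Continuous ((chamber n).indicator H) := by
  refine continuous_indicator (fun x hx => ?_) hH.continuousOn
  have h1 : closure (chamber n) ⊆ {x | Monotone x} := by
    refine closure_minimal (fun x hx => StrictMono.monotone hx) ?_
    have : {x : Fin n → ℝ | Monotone x} = ⋂ i, ⋂ j, ⋂ _ : i ≤ j, {x | x i ≤ x j} := by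
      ext x; simp [Monotone]
    rw [this]
    exact isClosed_iInter fun i => isClosed_iInter fun j => isClosed_iInter fun _ =>
      isClosed_le (continuous_apply i) (continuous_apply j)
  have h2 : Monotone x := h1 (frontier_subset_closure hx)
  have h3 : x ∉ chamber n := by
    rw [(isOpen_chamber n).frontier_eq] at hx
    exact hx.2
  have h4 : ¬ Function.Injective x := fun h => h3 (h2.strictMono_of_injective h)
  simp only [Function.Injective] at h4
  push Not at h4
  obtain ⟨i, j, h5, h6⟩ := h4
  exact h0 x i j h6 h5

/-- The joint density of the nonintersecting paths from `a` at the times `t`. -/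
noncomputable def pathDensity {M : ℕ} (a : Fin n → ℝ) (t : Fin (M + 1) → ℝ≥0)
    (z : Fin (M + 1) → Fin n → ℝ) : ℝ :=
  transition n (t 0) a (z 0) *
    ∏ i : Fin M, transition n (t i.succ - t i.castSucc) (z i.castSucc) (z i.succ)

theorem continuous_pathDensity {M : ℕ} (a : Fin n → ℝ) (t : Fin (M + 1) → ℝ≥0) :
    Continuous (pathDensity a t) := by
  unfold pathDensity
  refine Continuous.mul ?_ (continuous_finsetProd _ fun i _ => ?_)
  · exact continuous_transition_comp (t 0) (f := fun _ => a)
      (g := fun z : Fin (M + 1) → Fin n → ℝ => z 0) continuous_const (continuous_apply 0)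
  · exact continuous_transition_comp (t i.succ - t i.castSucc)
      (f := fun z : Fin (M + 1) → Fin n → ℝ => z i.castSucc)
      (g := fun z : Fin (M + 1) → Fin n → ℝ => z i.succ)
      (continuous_apply i.castSucc) (continuous_apply i.succ)

theorem pathDensity_snoc {M : ℕ} (a : Fin n → ℝ) (t : Fin (M + 2) → ℝ≥0)
    (z : Fin (M + 1) → Fin n → ℝ) (y : Fin n → ℝ) :
    pathDensity a t (Fin.snoc (α := fun _ => Fin n → ℝ) z y) =
      pathDensity a (fun i => t i.castSucc) z *
        transition n (t (Fin.last _) - t (Fin.last M).castSucc) (z (Fin.last M)) y := by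
  unfold pathDensity
  rw [Fin.prod_univ_castSucc]
  have h0 : Fin.snoc (α := fun _ => Fin n → ℝ) z y 0 = z 0 := by
    rw [← Fin.castSucc_zero, Fin.snoc_castSucc]
  simp only [Fin.snoc_castSucc, h0, Fin.succ_castSucc, Fin.castSucc_zero, Fin.succ_last,
    Fin.snoc_last]
  ring

theorem measurePreserving_snoc (N : ℕ) : MeasurePreserving
    (fun q : (Fin N → Fin n → ℝ) × (Fin n → ℝ) =>
      (Fin.snoc (α := fun _ => Fin n → ℝ) q.1 q.2 : Fin (N + 1) → Fin n → ℝ)) := by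
  have h1 := (volume_preserving_piFinSuccAbove (fun _ : Fin (N + 1) => Fin n → ℝ)
    (Fin.last N)).symm
  have h2 := h1.comp (Measure.measurePreserving_swap (μ := (volume : Measure (Fin N → Fin n → ℝ)))
    (ν := (volume : Measure (Fin n → ℝ))))
  have h3 : (fun q : (Fin N → Fin n → ℝ) × (Fin n → ℝ) =>
      (Fin.snoc (α := fun _ => Fin n → ℝ) q.1 q.2 : Fin (N + 1) → Fin n → ℝ)) =
      (MeasurableEquiv.piFinSuccAbove (fun _ => Fin n → ℝ) (Fin.last N)).symm ∘ Prod.swap := by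
    ext q
    simp [MeasurableEquiv.piFinSuccAbove, Fin.insertNthEquiv, Fin.insertNth_last']
  rw [h3]
  exact h2

theorem measurableEmbedding_snoc (N : ℕ) : MeasurableEmbedding
    (fun q : (Fin N → Fin n → ℝ) × (Fin n → ℝ) =>
      (Fin.snoc (α := fun _ => Fin n → ℝ) q.1 q.2 : Fin (N + 1) → Fin n → ℝ)) := by
  have h1 := (MeasurableEquiv.piFinSuccAbove (fun _ : Fin (N + 1) => Fin n → ℝ)
    (Fin.last N)).symm.measurableEmbedding
  have h2 := h1.comp (MeasurableEquiv.prodComm (α := (Fin N → Fin n → ℝ))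
    (β := (Fin n → ℝ))).measurableEmbedding
  convert h2 using 1
  ext q
  simp [MeasurableEquiv.piFinSuccAbove, Fin.insertNthEquiv, Fin.insertNth_last',
    MeasurableEquiv.prodComm]

/-- Integrate out the last time: the determinant has `L¹` norm at most `n!`, uniformly in the
preceding position. -/
theorem integrable_pathDensity (hn : 0 < n) {M : ℕ} (a : Fin n → ℝ) {t : Fin (M + 1) → ℝ≥0}
    (ht : StrictMono t) : Integrable (pathDensity a t) := by
  induction M with
  | zero =>
    have := (volume_preserving_funUnique (Fin 1) (Fin n → ℝ)).integrable_comp_emb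
      (MeasurableEquiv.measurableEmbedding _) (g := fun y => transition n (t 0) a y)
    have h2 := this.2 (integrable_transition _ _)
    refine h2.congr (ae_of_all _ fun z => ?_)
    simp [pathDensity]
  | succ M ih =>
    rw [← (measurePreserving_snoc (M + 1)).integrable_comp_emb (measurableEmbedding_snoc (M + 1))]
    have hc : Continuous ((pathDensity a t) ∘ fun q : (Fin (M + 1) → Fin n → ℝ) × (Fin n → ℝ) =>
        (Fin.snoc (α := fun _ => Fin n → ℝ) q.1 q.2 : Fin (M + 2) → Fin n → ℝ)) := by
      refine (continuous_pathDensity a t).comp (continuous_pi fun i => ?_)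
      refine Fin.lastCases ?_ (fun i => ?_) i
      · simpa using continuous_snd
      · simp only [Fin.snoc_castSucc]
        exact (continuous_apply i).comp continuous_fst
    have hpos : 0 < t (Fin.last _) - t (Fin.last M).castSucc :=
      tsub_pos_of_lt (ht (Fin.castSucc_lt_last _))
    refine (integrable_prod_iff hc.aestronglyMeasurable).2 ⟨ae_of_all _ fun z => ?_, ?_⟩
    · simp only [Function.comp, pathDensity_snoc]
      exact (integrable_transition _ _).const_mul _
    · refine ((ih (t := fun i => t i.castSucc) fun i j h => ht
        (Fin.castSucc_lt_castSucc_iff.2 h)).norm.mul_const (n.factorial : ℝ)).mono'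
        hc.norm.stronglyMeasurable.integral_prod_right'.aestronglyMeasurable
        (ae_of_all _ fun z => ?_)
      simp only [Function.comp, pathDensity_snoc, norm_mul, integral_const_mul]
      rw [norm_norm, Real.norm_of_nonneg (integral_nonneg fun _ => norm_nonneg _)]
      exact mul_le_mul_of_nonneg_left (integral_abs_transition_le hn hpos _) (norm_nonneg _)

end NIBM

/-! ### Karlin–McGregor at several times -/

namespace NIBM

variable {n : ℕ} {Ω₀ : Type*} [MeasurableSpace Ω₀] {B : Fin n → ℝ≥0 → Ω₀ → ℝ} {P₀ : Measure Ω₀}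

theorem integral_snoc {N : ℕ} {F : (Fin (N + 1) → Fin n → ℝ) → ℝ} (hF : Integrable F) :
    ∫ w, F w = ∫ z : Fin N → Fin n → ℝ, ∫ y : Fin n → ℝ,
      F (Fin.snoc (α := fun _ => Fin n → ℝ) z y) := by
  have h1 := (measurePreserving_snoc (n := n) N).integral_comp (measurableEmbedding_snoc N) F
  have h2 := ((measurePreserving_snoc (n := n) N).integrable_comp_emb
    (measurableEmbedding_snoc N)).2 hF
  rw [← h1]
  exact integral_prod _ h2

theorem integrable_prod_mul_pathDensity (hn : 0 < n) {M : ℕ} (a : Fin n → ℝ)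
    {t : Fin (M + 1) → ℝ≥0} (ht : StrictMono t) {g : (Fin (M + 1) → Fin n → ℝ) → ℝ}
    (hg : Measurable g) {C : ℝ} (hgC : ∀ z, |g z| ≤ C) :
    Integrable fun z => g z * pathDensity a t z :=
  (integrable_pathDensity hn a ht).bdd_mul hg.aestronglyMeasurable (ae_of_all _ hgC)

theorem abs_prod_indicator_le {ι : Type*} [Fintype ι] (f : ι → (Fin n → ℝ) →ᵇ ℝ)
    (z : ι → Fin n → ℝ) : |∏ i, (chamber n).indicator (f i) (z i)| ≤ ∏ i, ‖f i‖ := by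
  rw [Finset.abs_prod]
  refine Finset.prod_le_prod (fun i _ => abs_nonneg _) fun i _ => ?_
  exact (norm_indicator_le_norm_self (f i) (z i)).trans ((f i).norm_coe_le_norm (z i))

namespace IsRegularBrownian

/-- The Karlin–McGregor identity for several times. -/
theorem integral_prod_noCollision [IsProbabilityMeasure P₀] (hB : IsRegularBrownian B P₀)
    (hn : 0 < n) {a : Fin n → ℝ} (ha : a ∈ chamber n) {M : ℕ} {t : Fin (M + 1) → ℝ≥0}
    (ht : StrictMono t) (ht0 : 0 < t 0) (f : Fin M → (Fin n → ℝ) →ᵇ ℝ) {φ : (Fin n → ℝ) → ℝ}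
    (hφ : Continuous φ) {D : ℝ} (hφD : ∀ x, |φ x| ≤ D) (hφ0 : ∀ x ∉ chamber n, φ x = 0) :
    ∫ ω, (∏ i : Fin M, f i (freePath B a (t i.castSucc) ω)) *
        (noCollision B a (t (Fin.last M))).indicator (fun _ => (1 : ℝ)) ω *
        φ (freePath B a (t (Fin.last M)) ω) ∂P₀ =
      ∫ z : Fin (M + 1) → Fin n → ℝ, (∏ i : Fin M, (chamber n).indicator (f i) (z i.castSucc)) *
        pathDensity a t z * φ (z (Fin.last M)) := by
  induction M generalizing φ D with
  | zero =>
    have h1 := hB.integral_noCollision a (zero_le : 0 ≤ t 0) (Y := fun _ => 1) measurable_const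
      (C := 1) (by simp) hφ hφD hφ0
    have h2 : noCollision B a 0 = Set.univ := by
      ext ω
      simp only [Set.mem_univ, iff_true]
      intro r hr
      rw [nonpos_iff_eq_zero.1 hr, hB.freePath_zero]
      exact ha
    simp only [hB.freePath_zero, h2, Set.indicator_univ, tsub_zero, one_mul, integral_const,
      probReal_univ, one_smul] at h1
    have h3 := (volume_preserving_funUnique (Fin 1) (Fin n → ℝ)).integral_comp
      (MeasurableEquiv.measurableEmbedding _) (g := fun y => transition n (t 0) a y * φ y)
    simp only [Finset.univ_eq_empty, Finset.prod_empty, one_mul, Fin.last_zero, pathDensity,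
      mul_one]
    rw [h1, heat_antisymm_eq hn ht0 hφ hφD, ← h3]
    rfl
  | succ M ih =>
    set s := t (Fin.last M).castSucc with hs
    set T := t (Fin.last (M + 1)) with hT
    have hsT : s < T := ht (Fin.castSucc_lt_last _)
    have hpos : 0 < T - s := tsub_pos_of_lt hsT
    set H : (Fin n → ℝ) → ℝ := heat (antisymm φ) (T - s) with hH
    have hHc : Continuous H :=
      (continuous_heat (continuous_antisymm hφ) (abs_antisymm_le hφD)).comp
        (by fun_prop : Continuous fun x : Fin n → ℝ => (T - s, x))
    have hHD : ∀ x, |H x| ≤ n.factorial * D := abs_heat_le (abs_antisymm_le hφD) _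
    -- The test function for the preceding time. It must again be continuous and vanish off the
    -- chamber so that the induction hypothesis applies; `H` vanishes where coordinates coincide,
    -- which gives the continuity.
    set φ' : (Fin n → ℝ) → ℝ := (chamber n).indicator fun x => f (Fin.last M) x * H x with hφ'
    have hφ'c : Continuous φ' := by
      refine continuous_indicator_chamber ((f (Fin.last M)).continuous.mul hHc)
        fun x i j hij hx => ?_
      simp only [hH]
      rw [heat_eq_zero (fun x => antisymm_comp_swap φ hij x) _ hx, mul_zero]
    have hφ'D : ∀ x, |φ' x| ≤ ‖f (Fin.last M)‖ * (n.factorial * D) := by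
      intro x
      refine (norm_indicator_le_norm_self (s := chamber n)
        (fun x => f (Fin.last M) x * H x) x).trans ?_
      rw [norm_mul]
      exact mul_le_mul ((f _).norm_coe_le_norm x) (hHD x) (norm_nonneg _) (norm_nonneg _)
    have h1 := hB.integral_noCollision a hsT.le
      (Y := fun ω => ∏ i : Fin (M + 1), f i (freePath B a (t i.castSucc) ω))
      (@Finset.measurable_prod _ _ _ _ _ _ (pastAlgebra B s) _ _ fun i _ =>
        (f i).continuous.measurable.comp (measurable_pastAlgebra_freePath a
          (ht.monotone (Fin.castSucc_le_castSucc_iff.2 (Fin.le_last i)))))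
      (C := ∏ i, ‖f i‖) (fun ω => by
        rw [Finset.abs_prod]
        exact Finset.prod_le_prod (fun i _ => abs_nonneg _) fun i _ => (f i).norm_coe_le_norm _)
      hφ hφD hφ0
    rw [h1]
    have h2 : ∀ ω, (∏ i : Fin (M + 1), f i (freePath B a (t i.castSucc) ω)) *
        (noCollision B a s).indicator (fun _ => (1 : ℝ)) ω * H (freePath B a s ω) =
        (∏ i : Fin M, f i.castSucc (freePath B a (t i.castSucc.castSucc) ω)) *
          (noCollision B a s).indicator (fun _ => (1 : ℝ)) ω * φ' (freePath B a s ω) := by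
      intro ω
      by_cases hω : ω ∈ noCollision B a s
      · rw [Fin.prod_univ_castSucc, hφ', Set.indicator_of_mem (s := chamber n) (hω s le_rfl)]
        ring
      · simp [hω]
    refine (integral_congr_ae (ae_of_all _ h2)).trans ?_
    have ht' : StrictMono fun i : Fin (M + 1) => t i.castSucc := fun i j h =>
      ht (Fin.castSucc_lt_castSucc_iff.2 h)
    have h3 := ih (t := fun i => t i.castSucc) ht' ht0 (fun i => f i.castSucc) hφ'c hφ'D
      fun x hx => Set.indicator_of_notMem hx _
    refine h3.trans ?_
    have hg : Measurable fun z : Fin (M + 2) → Fin n → ℝ =>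
        (∏ i : Fin (M + 1), (chamber n).indicator (f i) (z i.castSucc)) * φ (z (Fin.last _)) := by
      refine (Finset.measurable_prod _ fun i _ => ?_).mul
        (hφ.measurable.comp (measurable_pi_apply _))
      exact ((f i).continuous.measurable.indicator (measurableSet_chamber n)).comp
        (measurable_pi_apply _)
    have hi := integrable_prod_mul_pathDensity hn a ht hg
      (C := (∏ i, ‖f i‖) * D) fun z => by
        rw [abs_mul]
        exact mul_le_mul (abs_prod_indicator_le f fun i : Fin (M + 1) => z i.castSucc) (hφD _)
          (abs_nonneg _) (Finset.prod_nonneg fun i _ => norm_nonneg _)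
    have hi' : Integrable fun z : Fin (M + 2) → Fin n → ℝ =>
        (∏ i : Fin (M + 1), (chamber n).indicator (f i) (z i.castSucc)) * pathDensity a t z *
          φ (z (Fin.last _)) := hi.congr (ae_of_all _ fun z => by ring)
    rw [integral_snoc hi']
    refine integral_congr_ae (ae_of_all _ fun z => ?_)
    simp only [Fin.snoc_castSucc, Fin.snoc_last, pathDensity_snoc, ← hs, ← hT]
    rw [Fin.prod_univ_castSucc]
    have h4 : ∀ y, (∏ i : Fin M, (chamber n).indicator (f i.castSucc) (z i.castSucc)) *
        (chamber n).indicator (f (Fin.last M)) (z (Fin.last M)) *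
        (pathDensity a (fun i => t i.castSucc) z * transition n (T - s) (z (Fin.last M)) y) * φ y =
        ((∏ i : Fin M, (chamber n).indicator (f i.castSucc) (z i.castSucc)) *
          pathDensity a (fun i => t i.castSucc) z *
          (chamber n).indicator (f (Fin.last M)) (z (Fin.last M))) *
          (transition n (T - s) (z (Fin.last M)) y * φ y) := fun y => by ring
    simp only [h4, integral_const_mul]
    rw [← heat_antisymm_eq hn hpos hφ hφD, mul_assoc _ (Set.indicator _ _ _)]
    congr 1
    by_cases hz : z (Fin.last M) ∈ chamber n
    · simp [hφ', hH, hz]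
    · simp [hφ', hz]

end IsRegularBrownian

end NIBM

namespace NIBM

/-! ### Conditioning on the endpoint -/

variable {n : ℕ} {Ω₀ : Type*} {B : Fin n → ℝ≥0 → Ω₀ → ℝ}

/-- The path from `a` to `b` whose rescaled deviation from the straight path is `w`. -/
noncomputable def bridgePath (a : Fin n → ℝ) (q : (Fin n → I → ℝ) × (Fin n → ℝ)) (t : I) :
    Fin n → ℝ :=
  fun j => (1 - (t : ℝ)) * a j + (t : ℝ) * q.2 j + q.1 j t / √(n : ℝ)

theorem measurable_bridgePath (a : Fin n → ℝ) (t : I) :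
    Measurable fun q => bridgePath a q t := by
  unfold bridgePath
  refine measurable_pi_lambda _ fun j => ?_
  have h1 : Measurable fun q : (Fin n → I → ℝ) × (Fin n → ℝ) => q.1 j t := by fun_prop
  have h2 : Measurable fun q : (Fin n → I → ℝ) × (Fin n → ℝ) => q.2 j := by fun_prop
  exact ((h2.const_mul _).const_add _).add (h1.div_const _)

/-- The deviations of the Brownian paths from the straight paths to their positions at time `1`. -/
noncomputable def bridgeDeviation (B : Fin n → ℝ≥0 → Ω₀ → ℝ) (ω : Ω₀) : Fin n → I → ℝ :=
  fun j t => B j (unitInterval.toNNReal t) ω - (t : ℝ) * B j 1 ω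

theorem bridge_eq (a b : Fin n → ℝ) (t : I) (ω : Ω₀) :
    bridge B a b t ω = bridgePath a (bridgeDeviation B ω, b) t := rfl

theorem freePath_eq_bridge (a : Fin n → ℝ) (t : I) (ω : Ω₀) :
    freePath B a (unitInterval.toNNReal t) ω = bridge B a (freePath B a 1 ω) t ω := by
  ext j
  simp only [freePath, bridge]
  ring

theorem mem_nonintersecting_freePath (a : Fin n → ℝ) (ω : Ω₀) :
    ω ∈ nonintersecting B a (freePath B a 1 ω) ↔ ω ∈ noCollision B a 1 := by
  simp only [nonintersecting, noCollision, Set.mem_ofPred_eq, ← freePath_eq_bridge]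
  exact ⟨fun h r hr => h ⟨r, r.2, hr⟩, fun h t => h _ t.2.2⟩

variable [MeasurableSpace Ω₀] {P₀ : Measure Ω₀}

/-- The paths from `a` to `b` which stay ordered at all times. -/
theorem IsRegularBrownian.exists_measurableSet_nonintersecting (hB : IsRegularBrownian B P₀)
    (a : Fin n → ℝ) : ∃ S : Set ((Fin n → I → ℝ) × (Fin n → ℝ)), MeasurableSet S ∧
      ∀ ω b, (bridgeDeviation B ω, b) ∈ S ↔ ω ∈ nonintersecting B a b := by
  obtain ⟨D, hDc, hD⟩ := TopologicalSpace.exists_countable_dense I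
  refine ⟨⋃ k : ℕ, ⋂ t ∈ D, ⋂ i, ⋂ j, ⋂ _ : i < j,
    {q | 1 / ((k : ℝ) + 1) ≤ bridgePath a q t j - bridgePath a q t i}, ?_, fun ω b => ?_⟩
  · refine MeasurableSet.iUnion fun k => MeasurableSet.biInter hDc fun t _ =>
      MeasurableSet.iInter fun i => MeasurableSet.iInter fun j => MeasurableSet.iInter fun _ => ?_
    have h := measurable_bridgePath a t
    exact (((measurable_pi_apply j).comp h).sub ((measurable_pi_apply i).comp h)) measurableSet_Ici
  · have hc : Continuous fun t => bridge B a b t ω := by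
      unfold bridge
      refine continuous_pi fun j => ?_
      have h1 : Continuous fun t : I => B j (unitInterval.toNNReal t) ω :=
        (hB.continuous j ω).comp (by unfold unitInterval.toNNReal; fun_prop)
      have h2 : Continuous fun t : I => (t : ℝ) := continuous_subtype_val
      exact (((continuous_const.sub h2).mul continuous_const).add (h2.mul continuous_const)).add
        ((h1.sub (h2.mul continuous_const)).div_const _)
    have h2 := forall_strictMono_iff hD hc
    simp only [nonintersecting, Set.mem_ofPred_eq, Set.mem_iUnion, Set.mem_iInter]
    exact h2.symm

/-- The density of the free endpoint. -/
noncomputable def endpointDensity (a b : Fin n → ℝ) : ℝ :=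
  ∏ j, gaussianPDFReal (a j) (1 / n) (b j)

namespace IsRegularBrownian

theorem measurable_bridgeDeviation (hB : IsRegularBrownian B P₀) : Measurable (bridgeDeviation B) :=
  measurable_pi_lambda _ fun j => measurable_pi_lambda _ fun _ =>
    (hB.measurable j _).sub ((hB.measurable j _).const_mul _)

variable [IsProbabilityMeasure P₀] (hB : IsRegularBrownian B P₀)
include hB

/-- Disintegration over the endpoint: the bridge deviation is independent of the position at time
`1`, whose density is `endpointDensity a`. -/
theorem integral_bridge_endpoint (hn : 0 < n) (a : Fin n → ℝ)
    {F : (Fin n → I → ℝ) × (Fin n → ℝ) → ℝ} (hF : Measurable F) {C : ℝ} (hFC : ∀ q, |F q| ≤ C) :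
    ∫ ω, F (bridgeDeviation B ω, freePath B a 1 ω) ∂P₀ =
      ∫ b, endpointDensity a b * ∫ ω, F (bridgeDeviation B ω, b) ∂P₀ := by
  have hW := hB.measurable_bridgeDeviation
  have hV : Measurable fun ω j => B j 1 ω := measurable_pi_lambda _ fun j => hB.measurable j 1
  have := Measure.isProbabilityMeasure_map hW.aemeasurable (μ := P₀)
  have hmap := (indepFun_iff_map_prod_eq_prod_map_map hW.aemeasurable hV.aemeasurable).1
    hB.indepFun_bridge
  have hlaw : P₀.map (fun ω j => B j 1 ω) = Measure.pi fun _ : Fin n => gaussianReal 0 1 := by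
    have h := hB.map_increment 0 1
    simp only [zero_add, hB.zero, sub_zero] at h
    exact h
  rw [hlaw] at hmap
  let ψ : (Fin n → ℝ) → ℝ := fun b => ∫ ω, F (bridgeDeviation B ω, b) ∂P₀
  have hψ : ∀ b, ψ b = ∫ w, F (w, b) ∂(P₀.map (bridgeDeviation B)) := fun b =>
    (integral_map hW.aemeasurable (hF.comp measurable_prodMk_right).aestronglyMeasurable).symm
  have hψm : Measurable ψ := by
    have h1 : StronglyMeasurable fun b => ∫ w, F (w, b) ∂(P₀.map (bridgeDeviation B)) :=
      hF.stronglyMeasurable.integral_prod_left'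
    rw [funext hψ]
    exact h1.measurable
  have h1 := heat_eq_integral hn one_pos hψm a
  refine Eq.trans ?_ h1
  let T : (Fin n → I → ℝ) × (Fin n → ℝ) → (Fin n → I → ℝ) × (Fin n → ℝ) := fun q =>
    (q.1, fun j => a j + √((1 : ℝ≥0) : ℝ) * q.2 j / √(n : ℝ))
  have hT : Measurable T := by
    refine measurable_fst.prodMk (measurable_pi_lambda _ fun j => ?_)
    fun_prop
  have h2 : ∀ ω, F (bridgeDeviation B ω, freePath B a 1 ω) =
      (F ∘ T) (bridgeDeviation B ω, fun j => B j 1 ω) := fun ω => by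
    simp [T]
    rfl
  have hint : Integrable (F ∘ T) ((P₀.map (bridgeDeviation B)).prod
      (Measure.pi fun _ : Fin n => gaussianReal 0 1)) :=
    Integrable.of_bound (hF.comp hT).aestronglyMeasurable C (ae_of_all _ fun q => hFC _)
  simp only [h2]
  have h3 := integral_map (μ := P₀) (hW.prodMk hV).aemeasurable (f := F ∘ T)
    (hF.comp hT).aestronglyMeasurable
  refine h3.symm.trans ?_
  have h4 : P₀.map (fun ω => (bridgeDeviation B ω, fun j => B j 1 ω)) =
      (P₀.map (bridgeDeviation B)).prod (Measure.pi fun _ : Fin n => gaussianReal 0 1) := hmap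
  rw [h4, integral_prod_symm _ hint, heat]
  refine integral_congr_ae (ae_of_all _ fun z => ?_)
  simp only [hψ]
  rfl

/-- The bridges conditioned not to intersect, for almost every ordered endpoint. -/
theorem ae_integral_bridge_nonintersecting (hn : 0 < n) {a : Fin n → ℝ} (ha : a ∈ chamber n)
    {M : ℕ} {t : Fin (M + 1) → ℝ≥0} (ht : StrictMono t) (ht0 : 0 < t 0) (ht1 : t (Fin.last M) = 1)
    {u : Fin M → I} (hu : ∀ i, unitInterval.toNNReal (u i) = t i.castSucc)
    (f : Fin M → (Fin n → ℝ) →ᵇ ℝ) : ∀ᵐ b, b ∈ chamber n →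
      endpointDensity a b * ∫ ω in nonintersecting B a b, ∏ i, f i (bridge B a b (u i) ω) ∂P₀ =
      ∫ z : Fin M → Fin n → ℝ, (∏ i, (chamber n).indicator (f i) (z i)) *
        pathDensity a t (Fin.snoc (α := fun _ => Fin n → ℝ) z b) := by
  obtain ⟨S, hSm, hS⟩ := hB.exists_measurableSet_nonintersecting a
  set F : (Fin n → I → ℝ) × (Fin n → ℝ) → ℝ := fun q =>
    (∏ i, f i (bridgePath a q (u i))) * S.indicator (fun _ => (1 : ℝ)) q with hF
  have hFm : Measurable F := (Finset.measurable_prod _ fun i _ =>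
    (f i).continuous.measurable.comp (measurable_bridgePath a (u i))).mul
    (measurable_const.indicator hSm)
  have hFC : ∀ q, |F q| ≤ ∏ i, ‖f i‖ := by
    intro q
    rw [hF]
    simp only
    rw [abs_mul, Finset.abs_prod, ← mul_one (∏ i, ‖f i‖)]
    refine mul_le_mul (Finset.prod_le_prod (fun i _ => abs_nonneg _) fun i _ =>
      (f i).norm_coe_le_norm _) ?_ (abs_nonneg _) (Finset.prod_nonneg fun i _ => norm_nonneg _)
    simp only [Set.indicator]; split_ifs <;> simp
  set L : (Fin n → ℝ) → ℝ := fun b => ∫ ω, F (bridgeDeviation B ω, b) ∂P₀ with hL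
  have hLeq : ∀ b, L b =
      ∫ ω in nonintersecting B a b, ∏ i, f i (bridge B a b (u i) ω) ∂P₀ := by
    intro b
    have hm : MeasurableSet (nonintersecting B a b) := by
      have : nonintersecting B a b = (fun ω => (bridgeDeviation B ω, b)) ⁻¹' S := by
        ext ω; exact (hS ω b).symm
      rw [this]
      exact (hB.measurable_bridgeDeviation.prodMk measurable_const) hSm
    rw [← integral_indicator hm]
    refine integral_congr_ae (ae_of_all _ fun ω => ?_)
    by_cases hω : ω ∈ nonintersecting B a b
    · simp only [hF, Set.indicator_of_mem hω, Set.indicator_of_mem ((hS ω b).2 hω), mul_one,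
        bridge_eq]
    · simp only [hF, Set.indicator_of_notMem hω, Set.indicator_of_notMem (mt (hS ω b).1 hω),
        mul_zero]
  set G : (Fin (M + 1) → Fin n → ℝ) → ℝ := fun w =>
    (∏ i : Fin M, (chamber n).indicator (f i) (w i.castSucc)) * pathDensity a t w with hG
  have hGm : Measurable fun w : Fin (M + 1) → Fin n → ℝ =>
      ∏ i : Fin M, (chamber n).indicator (f i) (w i.castSucc) :=
    Finset.measurable_prod _ fun i _ => ((f i).continuous.measurable.indicator
      (measurableSet_chamber n)).comp (measurable_pi_apply _)
  have hGi : Integrable G := integrable_prod_mul_pathDensity hn a ht hGm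
    fun w => abs_prod_indicator_le f fun i => w i.castSucc
  have hGi2 := ((measurePreserving_snoc (n := n) M).integrable_comp_emb
    (measurableEmbedding_snoc M)).2 hGi
  set R : (Fin n → ℝ) → ℝ := fun b => ∫ z : Fin M → Fin n → ℝ,
    G (Fin.snoc (α := fun _ => Fin n → ℝ) z b) with hR
  have hRi : Integrable R := hGi2.integral_prod_right
  have hLm : Measurable L := by
    have h1 : StronglyMeasurable fun q : (Fin n → ℝ) × Ω₀ => F (bridgeDeviation B q.2, q.1) :=
      (hFm.comp ((hB.measurable_bridgeDeviation.comp measurable_snd).prodMk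
        measurable_fst)).stronglyMeasurable
    exact h1.integral_prod_right'.measurable
  have hLC : ∀ b, ‖L b‖ ≤ ∏ i, ‖f i‖ := fun b => by
    have := norm_integral_le_of_norm_le_const (μ := P₀)
      (f := fun ω => F (bridgeDeviation B ω, b)) (C := ∏ i, ‖f i‖)
      (ae_of_all _ fun ω => hFC (bridgeDeviation B ω, b))
    simpa using this
  have hLi : Integrable fun b => endpointDensity a b * L b :=
    (integrable_prod_gaussianPDFReal (1 / n) a).mul_bdd hLm.aestronglyMeasurable
      (ae_of_all _ hLC)
  -- Both sides are integrable in `b`, and they are compared against smooth functions supported in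
  -- the chamber. Disintegration over the endpoint computes one pairing and Karlin–McGregor the
  -- other, which is why the identity holds only for almost every ordered `b`.
  have key : ∀ᵐ b, b ∈ chamber n → endpointDensity a b * L b - R b = 0 := by
    refine (isOpen_chamber n).ae_eq_zero_of_integral_contDiff_smul_eq_zero
      ((hLi.sub hRi).locallyIntegrable.locallyIntegrableOn _) fun g hg hgc hgs => ?_
    have hgcont := hg.continuous
    obtain ⟨D, hgD⟩ := hgc.exists_bound_of_continuous hgcont
    have hg0 : ∀ x ∉ chamber n, g x = 0 := fun x hx =>
      image_eq_zero_of_notMem_tsupport fun h => hx (hgs h)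
    have e1 := hB.integral_prod_noCollision hn ha ht ht0 f hgcont hgD hg0
    have e2 := hB.integral_bridge_endpoint hn a (F := fun q => F q * g q.2)
      (hFm.mul (hgcont.measurable.comp measurable_snd)) (C := (∏ i, ‖f i‖) * D) fun q => by
        rw [abs_mul]
        exact mul_le_mul (hFC q) (hgD _) (abs_nonneg _) (Finset.prod_nonneg fun i _ => norm_nonneg _)
    have e3 : ∀ ω, F (bridgeDeviation B ω, freePath B a 1 ω) * g (freePath B a 1 ω) =
        (∏ i : Fin M, f i (freePath B a (t i.castSucc) ω)) *
        (noCollision B a (t (Fin.last M))).indicator (fun _ => (1 : ℝ)) ω *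
        g (freePath B a (t (Fin.last M)) ω) := by
      intro ω
      rw [ht1]
      simp only [hF, ← bridge_eq, ← freePath_eq_bridge, hu]
      congr 2
      by_cases hω : ω ∈ noCollision B a 1
      · rw [Set.indicator_of_mem hω, Set.indicator_of_mem]
        exact (hS _ _).2 ((mem_nonintersecting_freePath a ω).2 hω)
      · rw [Set.indicator_of_notMem hω, Set.indicator_of_notMem]
        exact fun h => hω ((mem_nonintersecting_freePath a ω).1 ((hS _ _).1 h))
    simp only [e3] at e2
    rw [e1] at e2
    have hgi : Integrable fun q : (Fin M → Fin n → ℝ) × (Fin n → ℝ) =>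
        G (Fin.snoc (α := fun _ => Fin n → ℝ) q.1 q.2) * g q.2 :=
      hGi2.mul_bdd (hgcont.measurable.comp measurable_snd).aestronglyMeasurable
        (ae_of_all _ fun q => hgD _)
    have e4 : ∫ w, G w * g (w (Fin.last M)) = ∫ b, R b * g b := by
      have h1 := (measurePreserving_snoc (n := n) M).integral_comp (measurableEmbedding_snoc M)
        fun w => G w * g (w (Fin.last M))
      rw [← h1]
      simp only [Fin.snoc_last]
      refine (integral_prod_symm _ hgi).trans ?_
      simp only [integral_mul_const, hR]
    have e5 : ∀ b, endpointDensity a b * ∫ ω, F (bridgeDeviation B ω, b) * g b ∂P₀ =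
        endpointDensity a b * L b * g b := fun b => by
      rw [integral_mul_const, mul_assoc]
    simp only [e5] at e2
    rw [e4] at e2
    have i1 : Integrable fun b => endpointDensity a b * L b * g b :=
      hLi.mul_bdd hgcont.aestronglyMeasurable (ae_of_all _ hgD)
    have i2 : Integrable fun b => R b * g b :=
      hRi.mul_bdd hgcont.aestronglyMeasurable (ae_of_all _ hgD)
    have e6 : ∀ b, g b • (endpointDensity a b * L b - R b) =
        endpointDensity a b * L b * g b - R b * g b := fun b => by
      rw [smul_eq_mul]; ring
    simp only [e6]
    rw [integral_sub i1 i2, e2, sub_self]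
  filter_upwards [key] with b hb hbc
  rw [← hLeq, sub_eq_zero.1 (hb hbc), hR]
  simp only [hG, Fin.snoc_castSucc]

end IsRegularBrownian

end NIBM

namespace NIBM

/-! ### Confluence of exponential determinants -/

/-- The divided differences of `z ↦ exp (x z)` at `b 0, …, b j`, as functions of `x`. -/
noncomputable def expDiff (b : ℕ → ℝ) : ℕ → ℝ → ℝ
  | 0, x => Real.exp (x * b 0)
  | j + 1, x => Real.exp (x * b (j + 1)) * ∫ s in (0 : ℝ)..x, Real.exp (-(s * b (j + 1))) *
      expDiff b j s

/-- Joint continuity in the nodes and in `x`, coinciding nodes included. The recursive integral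
form, unlike quotients of differences, does not degenerate there. -/
theorem continuous_expDiff (j : ℕ) : Continuous fun q : (ℕ → ℝ) × ℝ => expDiff q.1 j q.2 := by
  induction j with
  | zero => simp only [expDiff]; fun_prop
  | succ j ih =>
    simp only [expDiff]
    refine Continuous.mul (by fun_prop) ?_
    refine intervalIntegral.continuous_parametric_intervalIntegral_of_continuous
      (f := fun (q : (ℕ → ℝ) × ℝ) s => Real.exp (-(s * q.1 (j + 1))) * expDiff q.1 j s)
      ?_ continuous_snd
    refine Continuous.mul (by fun_prop) ?_
    exact ih.comp (by fun_prop : Continuous fun r : ((ℕ → ℝ) × ℝ) × ℝ => (r.1.1, r.2))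

theorem continuous_expDiff_right (b : ℕ → ℝ) (j : ℕ) : Continuous (expDiff b j) :=
  (continuous_expDiff j).comp (by fun_prop : Continuous fun x : ℝ => (b, x))

theorem hasDerivAt_expDiff_zero (b : ℕ → ℝ) (x : ℝ) :
    HasDerivAt (expDiff b 0) (b 0 * expDiff b 0 x) x := by
  have h := ((hasDerivAt_id x).mul_const (b 0)).exp
  have h2 : expDiff b 0 = fun x => Real.exp (id x * b 0) := by ext x; simp [expDiff]
  rw [h2]
  refine h.congr_deriv ?_
  simp only [id]
  ring

theorem hasDerivAt_expDiff_succ (b : ℕ → ℝ) (j : ℕ) (x : ℝ) :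
    HasDerivAt (expDiff b (j + 1)) (b (j + 1) * expDiff b (j + 1) x + expDiff b j x) x := by
  have hc : Continuous fun s => Real.exp (-(s * b (j + 1))) * expDiff b j s :=
    Continuous.mul (by fun_prop) (continuous_expDiff_right b j)
  have h1 := (hc.integral_hasStrictDerivAt 0 x).hasDerivAt
  have h2 := ((hasDerivAt_id x).mul_const (b (j + 1))).exp
  have h3 := h2.mul h1
  refine h3.congr_deriv ?_
  simp only [id, expDiff]
  have h4 : Real.exp (x * b (j + 1)) * Real.exp (-(x * b (j + 1))) = 1 := by
    rw [← Real.exp_add]; simp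
  linear_combination expDiff b j x * h4

theorem expDiff_zero_right (b : ℕ → ℝ) (j : ℕ) : expDiff b j 0 = if j = 0 then 1 else 0 := by
  cases j <;> simp [expDiff]

theorem expDiff_zero_left (j : ℕ) (x : ℝ) : expDiff 0 j x = x ^ j / j.factorial := by
  induction j generalizing x with
  | zero => simp [expDiff]
  | succ j ih =>
    simp only [expDiff, Pi.zero_apply, mul_zero, neg_zero, Real.exp_zero, one_mul, ih]
    rw [intervalIntegral.integral_div, integral_pow, Nat.factorial_succ]
    push_cast
    simp only [ne_eq, Nat.add_eq_zero_iff, one_ne_zero, and_false, not_false_eq_true, zero_pow,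
      sub_zero]
    rw [div_div]

/-- Each recursion step costs a factor `exp (3 |x|)`: one `exp |x|` for each of the two exponentials
and one for the length `|x|` of the interval. -/
theorem abs_expDiff_le {b : ℕ → ℝ} (hb : ∀ i, |b i| ≤ 1) (j : ℕ) (x : ℝ) :
    |expDiff b j x| ≤ Real.exp ((3 * j + 1) * |x|) := by
  have h0 : ∀ i x, Real.exp (x * b i) ≤ Real.exp |x| := fun i x => by
    rw [Real.exp_le_exp]
    refine (le_abs_self _).trans ?_
    rw [abs_mul]
    exact mul_le_of_le_one_right (abs_nonneg _) (hb i)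
  induction j generalizing x with
  | zero =>
    simp only [expDiff, Real.abs_exp, Nat.cast_zero, mul_zero, zero_add, one_mul]
    exact h0 0 x
  | succ j ih =>
    have h1 : ‖∫ s in (0 : ℝ)..x, Real.exp (-(s * b (j + 1))) * expDiff b j s‖ ≤
        (Real.exp |x| * Real.exp ((3 * j + 1) * |x|)) * |x - 0| := by
      refine intervalIntegral.norm_integral_le_of_norm_le_const fun s hs => ?_
      have hsx : |s| ≤ |x| := by
        rcases le_total 0 x with h | h
        · rw [Set.uIoc_of_le h] at hs
          rw [abs_of_pos hs.1, abs_of_nonneg h]; exact hs.2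
        · rw [Set.uIoc_of_ge h] at hs
          rw [abs_of_nonpos hs.2, abs_of_nonpos h]; linarith [hs.1]
      rw [norm_mul, Real.norm_eq_abs, Real.norm_eq_abs, Real.abs_exp]
      refine mul_le_mul ?_ ((ih s).trans ?_) (abs_nonneg _) (Real.exp_pos _).le
      · have := h0 (j + 1) (-s)
        rw [neg_mul, abs_neg] at this
        exact this.trans (Real.exp_le_exp.2 hsx)
      · rw [Real.exp_le_exp]
        gcongr
    rw [Real.norm_eq_abs, sub_zero] at h1
    simp only [expDiff, abs_mul, Real.abs_exp]
    have h2 : |x| ≤ Real.exp |x| := by linarith [Real.add_one_le_exp |x|]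
    calc _ ≤ Real.exp |x| * (Real.exp |x| * Real.exp ((3 * j + 1) * |x|) * |x|) :=
          mul_le_mul (h0 _ _) h1 (abs_nonneg _) (Real.exp_pos _).le
      _ ≤ Real.exp |x| * (Real.exp |x| * Real.exp ((3 * j + 1) * |x|) * Real.exp |x|) := by
          gcongr
      _ = _ := by
          rw [← Real.exp_add, ← Real.exp_add, ← Real.exp_add]
          congr 1
          push_cast
          ring

open Polynomial in
/-- Newton's basis `∏_{i < j} (z - b_i)`. -/
noncomputable def newtonBasis (b : ℕ → ℝ) (j : ℕ) : ℝ[X] := ∏ i ∈ Finset.range j, (X - C (b i))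

open Polynomial in
-- Newton interpolation of `z ↦ exp (x z)` is exact at the nodes. As functions of `x`, the partial
-- sums satisfy `F' = b_l F` up to a multiple of the next Newton polynomial at `b_l`, which is zero
-- after `n` terms; and `F 0 = 1`.
theorem sum_newtonBasis_mul_expDiff {n : ℕ} (b : ℕ → ℝ) (l : Fin n) (x : ℝ) :
    ∑ j ∈ Finset.range n, (newtonBasis b j).eval (b l) * expDiff b j x = Real.exp (x * b l) := by
  set N : ℕ → ℝ := fun j => (newtonBasis b j).eval (b l) with hN
  have hNs : ∀ j, N (j + 1) = N j * (b l - b j) := fun j => by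
    simp [hN, newtonBasis, Finset.prod_range_succ]
  have hN0 : N 0 = 1 := by simp [hN, newtonBasis]
  have hNn : N n = 0 := by
    simp only [hN, newtonBasis, eval_prod]
    exact Finset.prod_eq_zero (Finset.mem_range.2 l.2) (by simp)
  -- the partial sums satisfy a linear differential equation
  have hd : ∀ m x, HasDerivAt (fun x => ∑ j ∈ Finset.range (m + 1), N j * expDiff b j x)
      (b l * (∑ j ∈ Finset.range (m + 1), N j * expDiff b j x) - N (m + 1) * expDiff b m x) x := by
    intro m x
    induction m with
    | zero =>
      simp only [zero_add, Finset.sum_range_one]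
      refine ((hasDerivAt_expDiff_zero b x).const_mul (N 0)).congr_deriv ?_
      rw [← zero_add 1, hNs]
      ring
    | succ m ih =>
      have h1 := ih.add ((hasDerivAt_expDiff_succ b m x).const_mul (N (m + 1)))
      simp only [Finset.sum_range_succ _ (m + 1)]
      refine h1.congr_deriv ?_
      rw [hNs (m + 1)]
      ring
  obtain ⟨m, rfl⟩ : ∃ m, n = m + 1 := ⟨n - 1, by have := l.2; omega⟩
  set F : ℝ → ℝ := fun x => (∑ j ∈ Finset.range (m + 1), N j * expDiff b j x) *
    Real.exp (-(x * b l)) with hF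
  have hFd : ∀ x, HasDerivAt F 0 x := fun x => by
    have h2 := (((hasDerivAt_id x).mul_const (b l)).neg).exp
    refine ((hd m x).mul h2).congr_deriv ?_
    rw [hNn]
    simp only [id, Pi.neg_apply]
    ring
  have hF0 : F x = F 0 := is_const_of_deriv_eq_zero (fun x => (hFd x).differentiableAt)
    (fun x => (hFd x).deriv) x 0
  have hF1 : F 0 = 1 := by
    simp only [hF, expDiff_zero_right]
    simp [hN0]
  rw [hF1] at hF0
  have h3 : Real.exp (-(x * b l)) * Real.exp (x * b l) = 1 := by rw [← Real.exp_add]; simp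
  calc _ = F x * Real.exp (x * b l) := by simp only [hF, hN, mul_assoc, h3, mul_one]
    _ = _ := by rw [hF0, one_mul]

/-- Extension of a vector by zero. -/
def extendZero {n : ℕ} (b : Fin n → ℝ) (i : ℕ) : ℝ := if h : i < n then b ⟨i, h⟩ else 0

theorem extendZero_coe {n : ℕ} (b : Fin n → ℝ) (i : Fin n) : extendZero b i = b i := by
  simp [extendZero]

theorem continuous_extendZero {n : ℕ} : Continuous (extendZero : (Fin n → ℝ) → ℕ → ℝ) := by
  refine continuous_pi fun i => ?_
  unfold extendZero
  split_ifs
  · fun_prop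
  · fun_prop

/-- The determinant of the divided differences. -/
noncomputable def expDet {n : ℕ} (b x : Fin n → ℝ) : ℝ :=
  (Matrix.of fun k j : Fin n => expDiff (extendZero b) j (x k)).det

theorem continuous_expDet {n : ℕ} :
    Continuous fun q : (Fin n → ℝ) × (Fin n → ℝ) => expDet q.1 q.2 := by
  refine Continuous.matrix_det (continuous_matrix fun k j => ?_)
  exact (continuous_expDiff j).comp ((continuous_extendZero.comp continuous_fst).prodMk
    ((continuous_apply k).comp continuous_snd))

open Polynomial in
-- Newton's formula factors the matrix into divided differences times the Newton basis at the nodes.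
-- The basis is monic, so the second determinant is the Vandermonde product of `b`; `expDet` stays
-- regular as the nodes merge.
theorem det_exp_eq {n : ℕ} (b x : Fin n → ℝ) :
    (Matrix.of fun k l : Fin n => Real.exp (x k * b l)).det = expDet b x * vandermonde b := by
  have hm : ∀ j, (newtonBasis (extendZero b) j).Monic := fun j =>
    monic_prod_of_monic _ _ fun i _ => monic_X_sub_C _
  have h1 := det_eval_eq_vandermonde (n := n) (newtonBasis (extendZero b))
    (fun j => by
      rw [newtonBasis, natDegree_prod_of_monic _ _ fun i _ => monic_X_sub_C _]
      simp) (fun j => by rw [hm j]; exact one_ne_zero) b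
  simp only [fun j => (hm j).leadingCoeff, Finset.prod_const_one, one_mul] at h1
  rw [← h1, expDet, ← Matrix.det_transpose (Matrix.of fun k l : Fin n =>
    (newtonBasis (extendZero b) l).eval (b k)), ← Matrix.det_mul]
  congr 1
  ext k l
  rw [Matrix.mul_apply, Matrix.of_apply]
  have h2 := sum_newtonBasis_mul_expDiff (extendZero b) l (x k)
  rw [extendZero_coe, Finset.sum_range] at h2
  rw [← h2]
  exact Finset.sum_congr rfl fun j _ => by
    rw [Matrix.transpose_apply, Matrix.of_apply, Matrix.of_apply, mul_comm]

open Polynomial in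
-- At merged nodes the divided differences are `x ^ j / j!`.
theorem expDet_zero {n : ℕ} : ∃ C : ℝ, 0 < C ∧ ∀ x : Fin n → ℝ, expDet 0 x = C * vandermonde x := by
  refine ⟨∏ j : Fin n, ((j : ℕ).factorial : ℝ)⁻¹, Finset.prod_pos fun j _ => by positivity,
    fun x => ?_⟩
  have hne : ∀ j : ℕ, ((j.factorial : ℝ)⁻¹) ≠ 0 := fun j => by positivity
  have h1 := det_eval_eq_vandermonde (n := n) (fun j => C ((j.factorial : ℝ)⁻¹) * X ^ j)
    (fun j => natDegree_C_mul_X_pow j _ (hne j))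
    (fun j => by rw [leadingCoeff_C_mul_X_pow]; exact hne j) x
  simp only [leadingCoeff_C_mul_X_pow] at h1
  rw [← h1, expDet]
  congr 1
  ext k j
  have h0 : extendZero (0 : Fin n → ℝ) = 0 := by ext i; simp [extendZero]
  simp only [Matrix.of_apply, h0, expDiff_zero_left, eval_mul, eval_C, eval_pow, eval_X]
  rw [div_eq_inv_mul]

theorem abs_expDet_le {n : ℕ} {b : Fin n → ℝ} (hb : ∀ i, |b i| ≤ 1) (x : Fin n → ℝ) :
    |expDet b x| ≤ n.factorial * ∏ k, Real.exp ((3 * n + 1) * |x k|) := by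
  have hb' : ∀ i, |extendZero b i| ≤ 1 := fun i => by
    unfold extendZero
    split_ifs
    · exact hb _
    · simp
  rw [expDet, ← Matrix.det_transpose, Matrix.det_apply']
  refine (Finset.abs_sum_le_sum_abs _ _).trans ((Finset.sum_le_card_nsmul _ _
    (∏ k, Real.exp ((3 * n + 1) * |x k|)) fun τ _ => ?_).trans ?_)
  · rw [abs_mul, abs_sign, one_mul, Finset.abs_prod]
    refine Finset.prod_le_prod (fun i _ => abs_nonneg _) fun i _ => ?_
    refine (abs_expDiff_le hb' _ _).trans (Real.exp_le_exp.2 ?_)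
    have : ((τ i : ℕ) : ℝ) ≤ n := by exact_mod_cast (τ i).2.le
    gcongr
  · simp [Finset.card_univ, Fintype.card_perm]

end NIBM

namespace NIBM

/-! ### The confluent limit -/

variable {n : ℕ} {Ω₀ : Type*} [MeasurableSpace Ω₀] {B : Fin n → ℝ≥0 → Ω₀ → ℝ} {P₀ : Measure Ω₀}

/-- The Gaussian weight `exp (-n |x|² / (2 r))`. -/
noncomputable def gaussWeight (r : ℝ) (x : Fin n → ℝ) : ℝ :=
  ∏ k, Real.exp (-(n * x k ^ 2 / (2 * r)))

theorem gaussWeight_pos (r : ℝ) (x : Fin n → ℝ) : 0 < gaussWeight r x :=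
  Finset.prod_pos fun _ _ => Real.exp_pos _

theorem continuous_gaussWeight (r : ℝ) : Continuous (gaussWeight r : (Fin n → ℝ) → ℝ) := by
  unfold gaussWeight
  fun_prop

theorem exists_transition_eq (hn : 0 < n) {t : ℝ≥0} (ht : 0 < t) : ∃ C : ℝ, 0 < C ∧
    ∀ x y : Fin n → ℝ, transition n t x y = C * gaussWeight t x * gaussWeight t y *
      expDet y (fun k => n / t * x k) * vandermonde y := by
  have hn' : (0 : ℝ) < n := by exact_mod_cast hn
  have ht' : (0 : ℝ) < t := ht
  refine ⟨∏ _k : Fin n, (√(2 * Real.pi * ((t / n : ℝ≥0) : ℝ)))⁻¹,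
    Finset.prod_pos fun _ _ => by positivity, fun x y => ?_⟩
  have h1 : (Matrix.of fun k l : Fin n => gaussianPDFReal (x k) (t / n) (y l)) =
      Matrix.of fun k l => ((√(2 * Real.pi * ((t / n : ℝ≥0) : ℝ)))⁻¹ *
        Real.exp (-(n * x k ^ 2 / (2 * t)))) *
        (Matrix.of fun k l => Real.exp (-(n * y l ^ 2 / (2 * t))) *
          (Matrix.of fun k l => Real.exp (n / t * x k * y l)) k l) k l := by
    ext k l
    simp only [Matrix.of_apply, gaussianPDFReal]
    have h2 : Real.exp (-(y l - x k) ^ 2 / (2 * ((t / n : ℝ≥0) : ℝ))) =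
        Real.exp (-(n * x k ^ 2 / (2 * t))) * (Real.exp (-(n * y l ^ 2 / (2 * t))) *
          Real.exp (n / t * x k * y l)) := by
      rw [← Real.exp_add, ← Real.exp_add]
      congr 1
      push_cast
      field_simp
      ring
    rw [h2]
    ring
  rw [transition, h1, Matrix.det_mul_column, Matrix.det_mul_row, det_exp_eq,
    Finset.prod_mul_distrib, gaussWeight, gaussWeight]
  ring

theorem vandermonde_pos {a : Fin n → ℝ} (ha : a ∈ chamber n) : 0 < vandermonde a :=
  Finset.prod_pos fun _ _ => Finset.prod_pos fun _ hj => sub_pos.2 (ha (Finset.mem_Ioi.1 hj))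

theorem exists_vandermonde_smul (n : ℕ) : ∃ N : ℕ, ∀ (c : ℝ) (x : Fin n → ℝ),
    vandermonde (fun k => c * x k) = c ^ N * vandermonde x := by
  refine ⟨∑ i : Fin n, (Finset.Ioi i).card, fun c x => ?_⟩
  simp only [vandermonde, ← mul_sub, Finset.prod_mul_distrib, Finset.prod_const,
    Finset.prod_pow_eq_pow_sum]

theorem continuous_vandermonde : Continuous (vandermonde : (Fin n → ℝ) → ℝ) := by
  unfold vandermonde
  fun_prop

/-- The Gaussian weight beats the exponential growth of `expDet`, uniformly for `b` near `0`; this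
is the domination used in the confluent limit. -/
theorem exists_gaussWeight_mul_expDet_le (hn : 0 < n) {r : ℝ} (hr : 0 < r) (c : ℝ) :
    ∃ C : ℝ, ∀ b : Fin n → ℝ, (∀ i, |b i| ≤ 1) → ∀ x,
      |gaussWeight r x * expDet b (fun k => c * x k)| ≤ C := by
  have hn' : (0 : ℝ) < n := by exact_mod_cast hn
  set α : ℝ := n / (2 * r) with hα
  have hα0 : 0 < α := by positivity
  set β : ℝ := (3 * n + 1) * |c| with hβ
  refine ⟨n.factorial * ∏ _k : Fin n, Real.exp (β ^ 2 / (4 * α)), fun b hb x => ?_⟩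
  rw [abs_mul, abs_of_pos (gaussWeight_pos r x)]
  refine (mul_le_mul_of_nonneg_left (abs_expDet_le hb _) (gaussWeight_pos r x).le).trans ?_
  rw [mul_left_comm, gaussWeight, ← Finset.prod_mul_distrib]
  refine mul_le_mul_of_nonneg_left (Finset.prod_le_prod (fun k _ => by positivity) fun k _ => ?_)
    (by positivity)
  rw [← Real.exp_add, Real.exp_le_exp, abs_mul]
  have h1 : -(n * x k ^ 2 / (2 * r)) + (3 * n + 1) * (|c| * |x k|) =
      -(α * |x k| ^ 2) + β * |x k| := by
    rw [hα, hβ, sq_abs]; ring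
  rw [h1, le_div_iff₀ (by positivity)]
  nlinarith [sq_nonneg (2 * α * |x k| - β)]

theorem zero_mem_closure_chamber : (0 : Fin n → ℝ) ∈ closure (chamber n) := by
  have h1 : Continuous fun (s : ℝ) (i : Fin n) => s * (i : ℝ) := by fun_prop
  have h2 : (0 : ℝ) ∈ closure (Set.Ioi 0) := by rw [closure_Ioi]; exact Set.mem_Ici.2 le_rfl
  have h3 := map_mem_closure h1 h2 (t := chamber n) fun s hs i j hij =>
    mul_lt_mul_of_pos_left (by exact_mod_cast hij) hs
  convert h3 using 1
  ext i
  simp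

theorem IsConfluentLimit.congr {B' : Fin n → ℝ≥0 → Ω₀ → ℝ}
    (h : ∀ᵐ ω ∂P₀, ∀ j t, B' j t ω = B j t ω) {a : Fin n → ℝ} {μ : Measure (I → Fin n → ℝ)}
    (hμ : IsConfluentLimit B P₀ a μ) : IsConfluentLimit B' P₀ a μ := by
  intro m t f
  refine (hμ m t f).congr fun b => ?_
  have hb : ∀ᵐ ω ∂P₀, ∀ t, bridge B' a b t ω = bridge B a b t ω := by
    filter_upwards [h] with ω hω t
    ext j
    simp only [bridge, hω]
  have hs : (nonintersecting B' a b : Set Ω₀) =ᵐ[P₀] nonintersecting B a b := by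
    filter_upwards [hb] with ω hω
    simp only [eq_iff_iff]
    change (∀ t, _) ↔ ∀ t, _
    simp only [hω]
  rw [ProbabilityTheory.cond, ProbabilityTheory.cond, measure_congr hs,
    Measure.restrict_congr_set hs]
  refine integral_congr_ae ?_
  refine Measure.ae_smul_measure (ae_restrict_of_ae ?_) _
  filter_upwards [hb] with ω hω
  simp only [hω]

/-- The multiplied form needs no positivity of `P₀ s`: if `s` is null, both sides are `0`. -/
theorem integral_cond_mul {s : Set Ω₀} [IsProbabilityMeasure P₀] (F : Ω₀ → ℝ) :
    (∫ ω, F ω ∂P₀[|s]) * ∫ _ω in s, (1 : ℝ) ∂P₀ = ∫ ω in s, F ω ∂P₀ := by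
  rw [ProbabilityTheory.cond, integral_smul_measure]
  simp only [integral_const, smul_eq_mul, mul_one, Measure.real, ENNReal.toReal_inv,
    Measure.restrict_apply_univ]
  by_cases h : P₀ s = 0
  · rw [h, Measure.restrict_eq_zero.2 h]
    simp
  · have : (P₀ s).toReal ≠ 0 := ENNReal.toReal_ne_zero.2 ⟨h, measure_ne_top _ _⟩
    field_simp

theorem strictMono_snoc {M : ℕ} {t : Fin M → ℝ≥0} (ht : StrictMono t) {T : ℝ≥0}
    (hT : ∀ i, t i < T) : StrictMono (Fin.snoc (α := fun _ => ℝ≥0) t T : Fin (M + 1) → ℝ≥0) := by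
  intro i j
  refine Fin.lastCases (fun h => ?_) (fun j => ?_) j
  · refine Fin.lastCases (fun h => absurd h (lt_irrefl _)) (fun i _ => ?_) i h
    simpa using hT i
  · refine Fin.lastCases (fun h => absurd h (not_lt.2 (Fin.le_last _))) (fun i h => ?_) i
    simpa using ht (Fin.castSucc_lt_castSucc_iff.1 h)

/-- The finite-dimensional distributions of the confluent limit. -/
theorem IsRegularBrownian.exists_integral_confluentLimit [IsProbabilityMeasure P₀]
    (hB : IsRegularBrownian B P₀) (hn : 0 < n) {m : ℕ} {u : Fin (m + 1) → I} (hu : StrictMono u)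
    (hu0 : 0 < u 0) (hu1 : u (Fin.last m) < 1) :
    ∃ C : ℝ, ∀ a ∈ chamber n, ∀ μ : Measure (I → Fin n → ℝ), IsConfluentLimit B P₀ a μ →
      ∀ f : Fin (m + 1) → (Fin n → ℝ) →ᵇ ℝ,
        (∫ γ, ∏ i, f i (γ (u i)) ∂μ) * (vandermonde a * gaussWeight 1 a) =
        C * ∫ z : Fin (m + 1) → Fin n → ℝ, (∏ i, (chamber n).indicator (f i) (z i)) *
          pathDensity a (fun i => unitInterval.toNNReal (u i)) z *
          (vandermonde (z (Fin.last m)) * gaussWeight (1 - u (Fin.last m)) (z (Fin.last m))) := by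
  set t : Fin (m + 1) → ℝ≥0 := fun i => unitInterval.toNNReal (u i) with ht
  have htm : StrictMono t := fun i j h => hu h
  have ht1 : ∀ i, t i < 1 := fun i => lt_of_le_of_lt (htm.monotone (Fin.le_last i)) hu1
  set r : ℝ≥0 := 1 - t (Fin.last m) with hr
  have hr0 : 0 < r := tsub_pos_of_lt (ht1 _)
  have hrr : (r : ℝ) = 1 - u (Fin.last m) := by
    rw [hr, NNReal.coe_sub (ht1 _).le]; rfl
  have hr0' : (0 : ℝ) < r := hr0
  have hn' : (0 : ℝ) < n := by exact_mod_cast hn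
  obtain ⟨C₁, hC₁, h₁⟩ := exists_transition_eq hn (one_pos : (0 : ℝ≥0) < 1)
  obtain ⟨C₂, hC₂, h₂⟩ := exists_transition_eq hn hr0
  obtain ⟨C₀, hC₀, h₀⟩ := expDet_zero (n := n)
  obtain ⟨N, hN⟩ := exists_vandermonde_smul n
  obtain ⟨K, hK⟩ := exists_gaussWeight_mul_expDet_le hn hr0' (n / r)
  -- The powers come from the scalings `n / r` and `n` inside `expDet`. The constant of
  -- `expDet_zero` appears on both sides and cancels.
  refine ⟨(C₂ * (n / r) ^ N) / (C₁ * n ^ N), fun a ha μ hμ f => ?_⟩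
  set g : (Fin (m + 1) → Fin n → ℝ) → ℝ := fun z =>
    (∏ i, (chamber n).indicator (f i) (z i)) * pathDensity a t z with hg
  have hgm : Measurable fun z : Fin (m + 1) → Fin n → ℝ =>
      ∏ i, (chamber n).indicator (f i) (z i) :=
    Finset.measurable_prod _ fun i _ => ((f i).continuous.measurable.indicator
      (measurableSet_chamber n)).comp (measurable_pi_apply _)
  have hgi : Integrable g := integrable_prod_mul_pathDensity hn a htm hgm
    fun z => abs_prod_indicator_le f z
  set G : (Fin n → ℝ) → ℝ := fun b => ∫ z, g z * (gaussWeight r (z (Fin.last m)) *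
    expDet b (fun k => n / r * z (Fin.last m) k)) with hG
  set A : (Fin n → ℝ) → ℝ := fun b => C₁ * gaussWeight 1 a * gaussWeight 1 b *
    expDet b (fun k => n * a k) with hA
  set F : (Fin (m + 1) → Fin n → ℝ) →ᵇ ℝ := BoundedContinuousFunction.ofNormedAddCommGroup
    (fun z => ∏ i, f i (z i)) (continuous_finsetProd _ fun i _ =>
      (f i).continuous.comp (continuous_apply i)) (∏ i, ‖f i‖) (fun z => by
        rw [norm_prod]
        exact Finset.prod_le_prod (fun i _ => norm_nonneg _) fun i _ => (f i).norm_coe_le_norm _)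
    with hF
  have hlim := hμ (m + 1) u F
  set q : (Fin n → ℝ) → ℝ := fun b => ∫ ω, F (fun i => bridge B a b (u i) ω)
    ∂P₀[|nonintersecting B a b] with hq
  have hFz : ∀ z, F z = ∏ i, f i (z i) := fun z => rfl
  -- the conditional expectation for almost every endpoint
  have hts : StrictMono (Fin.snoc (α := fun _ => ℝ≥0) t 1 : Fin (m + 2) → ℝ≥0) :=
    strictMono_snoc htm ht1
  have hsnoc0 : (Fin.snoc (α := fun _ => ℝ≥0) t 1 : Fin (m + 2) → ℝ≥0) 0 = t 0 := by
    rw [← Fin.castSucc_zero, Fin.snoc_castSucc]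
  have e1 := hB.ae_integral_bridge_nonintersecting hn ha hts (by rw [hsnoc0]; exact hu0) (by simp)
    (u := u) (fun i => by simp [ht]) f
  -- The case of no intermediate times gives the normalization: `endpointDensity a b` times the
  -- probability of no intersection equals `transition n 1 a b`.
  have e2 := hB.ae_integral_bridge_nonintersecting hn ha (M := 0) (t := fun _ => 1)
    (Subsingleton.strictMono (α := Fin 1) _) one_pos rfl (u := Fin.elim0) (fun i => i.elim0) Fin.elim0
  -- Dividing the two identities and cancelling the factor `vandermonde b`, which is nonzero on the
  -- chamber, leaves quantities continuous at `b = 0` apart from `q`.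
  have key : ∀ᵐ b, b ∈ chamber n → q b * A b = C₂ * gaussWeight r b * G b := by
    filter_upwards [e1, e2] with b h1 h2 hb
    have h1 := h1 hb
    have h2 := h2 hb
    have hv := (vandermonde_pos hb).ne'
    have h3 := integral_cond_mul (P₀ := P₀) (s := nonintersecting B a b)
      (fun ω => F (fun i => bridge B a b (u i) ω))
    simp only [hFz] at h3
    have h4 : ∫ z : Fin 0 → Fin n → ℝ, (∏ i : Fin 0, (chamber n).indicator
        ((Fin.elim0 i : (Fin n → ℝ) →ᵇ ℝ)) (z i)) * pathDensity a (fun _ : Fin 1 => (1 : ℝ≥0))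
          (Fin.snoc (α := fun _ => Fin n → ℝ) z b) = transition n 1 a b := by
      have hd : (volume : Measure (Fin 0 → Fin n → ℝ)) = Measure.dirac Fin.elim0 :=
        Measure.volume_pi_eq_dirac _
      rw [hd, integral_dirac]
      simp [pathDensity, Fin.snoc]
    simp only [Finset.univ_eq_empty, Finset.prod_empty] at h2 h4
    rw [h4, h₁] at h2
    simp only [pathDensity_snoc, Fin.snoc_castSucc, Fin.snoc_last, ← hr] at h1
    have h5 : ∀ z : Fin (m + 1) → Fin n → ℝ, (∏ i, (chamber n).indicator (f i) (z i)) *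
        (pathDensity a t z * transition n r (z (Fin.last m)) b) =
        (C₂ * gaussWeight r b * vandermonde b) * (g z * (gaussWeight r (z (Fin.last m)) *
          expDet b (fun k => n / r * z (Fin.last m) k))) := fun z => by
      rw [h₂]; ring
    simp only [h5, integral_const_mul] at h1
    rw [← h3, mul_left_comm, h2] at h1
    simp only [NNReal.coe_one, div_one] at h1
    have h6 : (q b * A b - C₂ * gaussWeight r b * G b) * vandermonde b = 0 := by
      simp only [hq, hA, hG, hFz]
      linear_combination h1
    exact sub_eq_zero.1 ((mul_eq_zero.1 h6).resolve_right hv)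
  set S : Set (Fin n → ℝ) := {b | b ∈ chamber n → q b * A b = C₂ * gaussWeight r b * G b} with hS
  -- The limit of `q` along the whole chamber is given by hypothesis, so it suffices to approach `0`
  -- within `S`. A set of full measure is dense, and `0` is in the closure of the open chamber.
  have hdense : Dense S := Measure.dense_of_ae key
  have hcl : (0 : Fin n → ℝ) ∈ closure (chamber n ∩ S) :=
    closure_minimal (hdense.open_subset_closure_inter (isOpen_chamber n)) isClosed_closure
      zero_mem_closure_chamber
  have hne : (𝓝[chamber n ∩ S] (0 : Fin n → ℝ)).NeBot := mem_closure_iff_nhdsWithin_neBot.1 hcl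
  have hAc : Continuous A := by
    refine (continuous_const.mul (continuous_gaussWeight 1)).mul ?_
    exact continuous_expDet.comp (continuous_id.prodMk continuous_const)
  have hGc : ContinuousAt G 0 := by
    have hev : ∀ᶠ b : Fin n → ℝ in 𝓝 0, ∀ i, |b i| ≤ 1 := by
      refine eventually_all.2 fun i => ?_
      have hc : Continuous fun b : Fin n → ℝ => |b i| := by fun_prop
      have := (hc.tendsto 0).eventually_le_const (u := 1) (by simp)
      exact this
    have hcont : Continuous fun p : (Fin n → ℝ) × (Fin (m + 1) → Fin n → ℝ) =>
        gaussWeight r (p.2 (Fin.last m)) * expDet p.1 (fun k => n / r * p.2 (Fin.last m) k) := by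
      refine ((continuous_gaussWeight _).comp ((continuous_apply (Fin.last m)).comp
        continuous_snd)).mul (continuous_expDet.comp (continuous_fst.prodMk ?_))
      exact continuous_pi fun k => continuous_const.mul ((continuous_apply k).comp
        ((continuous_apply (Fin.last m)).comp continuous_snd))
    refine continuousAt_of_dominated (bound := fun z => |g z| * K) ?_ ?_ (hgi.abs.mul_const K) ?_
    · exact Eventually.of_forall fun b => hgi.aestronglyMeasurable.mul
        (hcont.comp (continuous_const.prodMk continuous_id)).aestronglyMeasurable
    · filter_upwards [hev] with b hb
      refine ae_of_all _ fun z => ?_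
      rw [norm_mul]
      exact mul_le_mul_of_nonneg_left (hK b hb _) (norm_nonneg _)
    · exact ae_of_all _ fun z => (continuous_const.mul
        (hcont.comp (continuous_id.prodMk continuous_const))).continuousAt
  have hl : Tendsto (fun b => q b * A b) (𝓝[chamber n ∩ S] 0)
      (𝓝 ((∫ γ, F (fun i => γ (u i)) ∂μ) * A 0)) :=
    (hlim.mono_left (nhdsWithin_mono _ Set.inter_subset_left)).mul
      ((hAc.tendsto 0).mono_left nhdsWithin_le_nhds)
  have hrhs : Tendsto (fun b => C₂ * gaussWeight r b * G b) (𝓝[chamber n ∩ S] 0)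
      (𝓝 (C₂ * gaussWeight r (0 : Fin n → ℝ) * G 0)) :=
    ((continuous_const.mul (continuous_gaussWeight _)).continuousAt.mul hGc).tendsto.mono_left
      nhdsWithin_le_nhds
  have heq : (fun b => q b * A b) =ᶠ[𝓝[chamber n ∩ S] 0]
      fun b => C₂ * gaussWeight r b * G b := by
    filter_upwards [self_mem_nhdsWithin] with b hb
    exact hb.2 hb.1
  have hfin := tendsto_nhds_unique (hl.congr' heq) hrhs
  have hw0 : ∀ s : ℝ, gaussWeight s (0 : Fin n → ℝ) = 1 := fun s => by simp [gaussWeight]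
  have hG0 : G 0 = C₀ * (n / r) ^ N * ∫ z, g z * (vandermonde (z (Fin.last m)) *
      gaussWeight r (z (Fin.last m))) := by
    rw [← integral_const_mul]
    refine integral_congr_ae (ae_of_all _ fun z => ?_)
    simp only [h₀, hN]
    ring
  simp only [hA, h₀, hw0, hN, mul_one, hFz] at hfin
  rw [hG0, hrr] at hfin
  have hnN : (n : ℝ) ^ N ≠ 0 := by positivity
  rw [div_mul_eq_mul_div, eq_div_iff (mul_ne_zero hC₁.ne' hnN)]
  rw [hrr]
  refine mul_left_cancel₀ hC₀.ne' ?_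
  linear_combination hfin

end NIBM

namespace NIBM

/-! ### The law of the process at finitely many times -/

/-- Products of bounded continuous functions determine a finite measure. No sign of `h` is known at
this stage, so the comparison is made between the positive measures `Λ + D (-h)` and `D h`, built
from the negative and positive parts of `h`. -/
theorem integral_eq_of_integral_prod_boundedContinuousFunction {ι E Y : Type*} [Fintype ι]
    [MeasurableSpace E] [TopologicalSpace E] [BorelSpace E] [HasOuterApproxClosed E]
    [MeasurableSpace Y] {Λ : Measure (ι → E)} [IsFiniteMeasure Λ] {μ : Measure Y}
    {T : Y → ι → E} (hT : Measurable T) {h : Y → ℝ} (hm : Measurable h) (hh : Integrable h μ)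
    (H : ∀ f : ι → E →ᵇ ℝ, ∫ z, ∏ i, f i (z i) ∂Λ = ∫ y, (∏ i, f i (T y i)) * h y ∂μ)
    {F : (ι → E) → ℝ} (hF : Measurable F) {C : ℝ} (hC : ∀ z, |F z| ≤ C) :
    ∫ z, F z ∂Λ = ∫ y, F (T y) * h y ∂μ := by
  set D : (Y → ℝ) → Measure (ι → E) := fun g =>
    (μ.withDensity fun y => ENNReal.ofReal (g y)).map T with hD
  have hfin : ∀ g : Y → ℝ, Integrable g μ → IsFiniteMeasure (D g) := by
    intro g hg
    have : IsFiniteMeasure (μ.withDensity fun y => ENNReal.ofReal (g y)) :=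
      isFiniteMeasure_withDensity_ofReal hg.2
    infer_instance
  have hf1 := hfin h hh
  have hf2 := hfin _ hh.neg
  have hint : ∀ g : Y → ℝ, Measurable g → ∀ F : (ι → E) → ℝ, Measurable F →
      ∫ z, F z ∂(D g) = ∫ y, F (T y) * max (g y) 0 ∂μ := by
    intro g hg F hF
    rw [hD, integral_map hT.aemeasurable hF.aestronglyMeasurable,
      integral_withDensity_eq_integral_toReal_smul hg.ennreal_ofReal
        (ae_of_all _ fun _ => ENNReal.ofReal_lt_top)]
    simp only [smul_eq_mul, mul_comm, ENNReal.toReal_ofReal']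
  have hI : ∀ F : (ι → E) → ℝ, Measurable F → ∀ C : ℝ, (∀ z, |F z| ≤ C) →
      ∫ y, F (T y) * max (h y) 0 ∂μ - ∫ y, F (T y) * max (-h y) 0 ∂μ =
        ∫ y, F (T y) * h y ∂μ := by
    intro F hF C hC
    have hm1 : AEStronglyMeasurable (fun y => F (T y)) μ := (hF.comp hT).aestronglyMeasurable
    rw [← integral_sub (hh.pos_part.bdd_mul hm1 (ae_of_all _ fun y => hC _))
      (hh.neg_part.bdd_mul hm1 (ae_of_all _ fun y => hC _))]
    congr 1 with y
    rw [← mul_sub, max_zero_sub_max_neg_zero_eq_self]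
  have hpm : ∀ f : ι → E →ᵇ ℝ, Measurable fun z : ι → E => ∏ i, f i (z i) := fun f =>
    Finset.measurable_fun_prod _ fun i _ => (f i).continuous.measurable.comp (measurable_pi_apply i)
  have hpb : ∀ (f : ι → E →ᵇ ℝ) (z : ι → E), |∏ i, f i (z i)| ≤ ∏ i, ‖f i‖ := fun f z => by
    rw [Finset.abs_prod]
    exact Finset.prod_le_prod (fun i _ => abs_nonneg _) fun i _ => (f i).norm_coe_le_norm (z i)
  have hibl : ∀ (ν : Measure (ι → E)) [IsFiniteMeasure ν] (F : (ι → E) → ℝ), Measurable F →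
      ∀ C : ℝ, (∀ z, |F z| ≤ C) → Integrable F ν := fun ν _ F hF C hC =>
    Integrable.of_bound hF.aestronglyMeasurable C (ae_of_all _ hC)
  have heq : Λ + D (-h) = D h := by
    -- The one-point second factor only matches the form of the uniqueness theorem, which is stated
    -- for a product with one further space.
    have he : Measurable fun z : ι → E => (z, ()) := by fun_prop
    have hmap : (Λ + D (-h)).map (fun z => (z, ())) = (D h).map fun z => (z, ()) := by
      refine Measure.ext_of_integral_prod_mul_boundedContinuousFunction fun f g => ?_
      have hgm : Measurable fun p : (ι → E) × Unit => (∏ i, f i (p.1 i)) * g p.2 :=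
        ((hpm f).comp measurable_fst).mul (g.continuous.measurable.comp measurable_snd)
      rw [integral_map he.aemeasurable hgm.aestronglyMeasurable,
        integral_map he.aemeasurable hgm.aestronglyMeasurable]
      simp only [integral_mul_const]
      congr 1
      rw [integral_add_measure (hibl _ _ (hpm f) _ (hpb f)) (hibl _ _ (hpm f) _ (hpb f)),
        hint _ hm.neg _ (hpm f), hint _ hm _ (hpm f), H f, ← hI _ (hpm f) _ (hpb f)]
      simp
    have := congrArg (Measure.map Prod.fst) hmap
    rwa [Measure.map_map measurable_fst he, Measure.map_map measurable_fst he,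
      show (Prod.fst ∘ fun z : ι → E => (z, ())) = id from rfl, Measure.map_id,
      Measure.map_id] at this
  have h1 := congrArg (fun ν => ∫ z, F z ∂ν) heq
  rw [integral_add_measure (hibl _ _ hF _ hC) (hibl _ _ hF _ hC), hint _ hm.neg _ hF,
    hint _ hm _ hF] at h1
  rw [← hI F hF C hC, ← h1]
  simp

theorem integral_bind {α β : Type*} [MeasurableSpace α] [MeasurableSpace β] (μ : Measure α)
    [SFinite μ] (κ : Kernel α β) [IsMarkovKernel κ] {f : β → ℝ} (hf : Measurable f)
    (hi : Integrable f (μ.bind κ)) : ∫ y, f y ∂(μ.bind κ) = ∫ a, ∫ y, f y ∂(κ a) ∂μ := by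
  have h1 := (Measure.integrable_compProd_snd_iff hf.aestronglyMeasurable).2 hi
  have h2 := Measure.integral_compProd h1
  rw [← Measure.snd_compProd, Measure.snd, integral_map measurable_snd.aemeasurable
    hf.aestronglyMeasurable, h2]

theorem integral_cons {n N : ℕ} {F : (Fin (N + 1) → Fin n → ℝ) → ℝ} (hF : Integrable F) :
    ∫ w, F w = ∫ a : Fin n → ℝ, ∫ z : Fin N → Fin n → ℝ,
      F (Fin.cons (α := fun _ => Fin n → ℝ) a z) := by
  have hmp := (volume_preserving_piFinSuccAbove (fun _ : Fin (N + 1) => Fin n → ℝ) 0).symm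
  have hval : ∀ p : (Fin n → ℝ) × (Fin N → Fin n → ℝ),
      (MeasurableEquiv.piFinSuccAbove (fun _ : Fin (N + 1) => Fin n → ℝ) 0).symm p =
        (Fin.cons p.1 p.2 : Fin (N + 1) → Fin n → ℝ) := fun p => by
    simp [MeasurableEquiv.piFinSuccAbove, Fin.insertNthEquiv]
  have h2 := (hmp.integrable_comp_emb (MeasurableEquiv.measurableEmbedding _)).2 hF
  rw [← hmp.integral_comp' (g := F)]
  simp only [Function.comp_def, hval] at h2 ⊢
  exact integral_prod _ h2

variable {n : ℕ}

theorem gaussianPart_eq_gaussianPDFReal (hn : 0 < n) {s t : ℝ} (hst : s < t) (v : ℝ≥0)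
    (hv : (v : ℝ) = t - s) (x y : ℝ) :
    gaussianPart n x y s t = Real.exp (n * x ^ 2 / (2 * (1 - s))) *
      (Real.exp (-(n * y ^ 2 / (2 * (1 - t)))) * gaussianPDFReal x (v / n) y) := by
  have hn' : (0 : ℝ) < n := by exact_mod_cast hn
  have hv0 : 0 < t - s := sub_pos.2 hst
  have h1 : √(n : ℝ) / √(2 * Real.pi * (t - s)) =
      (√(2 * Real.pi * ((v / n : ℝ≥0) : ℝ)))⁻¹ := by
    rw [← Real.sqrt_div hn'.le, ← Real.sqrt_inv]
    congr 1
    push_cast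
    rw [hv]
    field_simp
  have h2 : -(y - x) ^ 2 / (2 * ((v / n : ℝ≥0) : ℝ)) = -(n * (x - y) ^ 2 / (2 * (t - s))) := by
    push_cast
    rw [hv]
    field_simp
    ring
  rw [gaussianPart, gaussianPDFReal, h1, h2, sub_eq_add_neg, Real.exp_add, Real.exp_add]
  ring

/-- `G` is the free Gaussian density multiplied by a function of `x` and a function of `y`, which
come out of the rows and columns. -/
theorem det_gaussianPart (hn : 0 < n) {s t : ℝ} (hst : s < t) (v : ℝ≥0)
    (hv : (v : ℝ) = t - s) (x y : Fin n → ℝ) :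
    (Matrix.of fun k l => gaussianPart n (x k) (y l) s t).det =
      transition n v x y * gaussWeight (1 - t) y / gaussWeight (1 - s) x := by
  have h1 : (Matrix.of fun k l => gaussianPart n (x k) (y l) s t) =
      Matrix.of fun k l => Real.exp (n * x k ^ 2 / (2 * (1 - s))) *
        (Matrix.of fun k l => Real.exp (-(n * y l ^ 2 / (2 * (1 - t)))) *
          (Matrix.of fun k l => gaussianPDFReal (x k) (v / n) (y l)) k l) k l := by
    ext k l
    simp only [Matrix.of_apply, gaussianPart_eq_gaussianPDFReal hn hst v hv]
  rw [h1, Matrix.det_mul_column, Matrix.det_mul_row]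
  have h2 : ∏ k, Real.exp (n * x k ^ 2 / (2 * (1 - s))) = (gaussWeight (1 - s) x)⁻¹ := by
    rw [gaussWeight, ← Finset.prod_inv_distrib]
    simp only [Real.exp_neg, inv_inv]
  rw [h2, transition, show gaussWeight (1 - t) y = ∏ l, Real.exp (-(n * y l ^ 2 / (2 * (1 - t))))
    from rfl, div_eq_inv_mul]
  ring

theorem prod_det_gaussianPart (hn : 0 < n) {m : ℕ} {u : Fin (m + 1) → I} (hu : StrictMono u)
    (hu0 : 0 < u 0) (a : Fin n → ℝ) (z : Fin (m + 1) → Fin n → ℝ) :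
    (∏ i : Fin (m + 1), (Matrix.of fun k l => gaussianPart n
        ((Fin.cons a z : Fin (m + 2) → Fin n → ℝ) i.castSucc k)
        ((Fin.cons a z : Fin (m + 2) → Fin n → ℝ) i.succ l)
        ((Fin.cons 0 (fun i => (u i : ℝ)) : Fin (m + 2) → ℝ) i.castSucc)
        ((Fin.cons 0 (fun i => (u i : ℝ)) : Fin (m + 2) → ℝ) i.succ)).det) =
      pathDensity a (fun i => unitInterval.toNNReal (u i)) z *
        gaussWeight (1 - u (Fin.last m)) (z (Fin.last m)) / gaussWeight 1 a := by
  have hg : ∀ (r : ℝ) (x : Fin n → ℝ), gaussWeight r x ≠ 0 := fun r x => (gaussWeight_pos r x).ne'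
  have htel : ∀ (M : ℕ) (g : Fin (M + 1) → ℝ), (∀ i, g i ≠ 0) →
      ∏ i : Fin M, g i.succ / g i.castSucc = g (Fin.last M) / g 0 := by
    intro M
    induction M with
    | zero => intro g hg; simp [div_self (hg 0)]
    | succ M ih =>
      intro g hg
      rw [Fin.prod_univ_castSucc]
      have := ih (fun i => g i.castSucc) fun i => hg _
      simp only [Fin.succ_castSucc, Fin.castSucc_zero] at this ⊢
      rw [this, Fin.succ_last]
      field_simp [hg]
  rw [Fin.prod_univ_succ]
  simp only [Fin.castSucc_zero, Fin.cons_zero, Fin.cons_succ, ← Fin.succ_castSucc]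
  rw [det_gaussianPart hn (show (0 : ℝ) < u 0 from hu0) (unitInterval.toNNReal (u 0))
    (by simp)]
  have hlt : ∀ i : Fin m, u i.castSucc < u i.succ := fun i => hu i.castSucc_lt_succ
  rw [Finset.prod_congr rfl fun i _ => det_gaussianPart hn
    (show (u i.castSucc : ℝ) < u i.succ from hlt i)
    (unitInterval.toNNReal (u i.succ) - unitInterval.toNNReal (u i.castSucc))
    (by rw [NNReal.coe_sub (le_of_lt (show unitInterval.toNNReal (u i.castSucc) <
          unitInterval.toNNReal (u i.succ) from hlt i))]; rfl)
    (z i.castSucc) (z i.succ)]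
  simp only [mul_div_assoc]
  rw [Finset.prod_mul_distrib, htel m (fun i => gaussWeight (1 - u i) (z i)) fun i => hg _ _,
    pathDensity, sub_zero]
  field_simp [hg]

end NIBM

/-! ### Identification of the joint law of the process -/

namespace NIBM

open Polynomial

variable {n : ℕ} {Ω₀ Ω : Type*} [MeasurableSpace Ω₀] [MeasurableSpace Ω]

theorem ueLaw_integral {V : ℝ → ℝ} (hV : Continuous V) (g : (Fin n → ℝ) → ℝ) :
    ∫ a, g a ∂(ueLaw n V) = (ueZ n V)⁻¹ * ∫ a in chamber n, ueWeight n V a * g a := by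
  have hc : Continuous (ueWeight n V) := by
    unfold ueWeight
    exact (continuous_vandermonde.pow 2).mul (by fun_prop)
  have hw : ∀ a, 0 ≤ ueWeight n V a := fun a =>
    mul_nonneg (sq_nonneg _) (Finset.prod_nonneg fun _ _ => (Real.exp_pos _).le)
  have hZ : 0 ≤ (ueZ n V)⁻¹ := inv_nonneg.2 (integral_nonneg hw)
  rw [ueLaw, integral_withDensity_eq_integral_toReal_smul
    (hc.measurable.const_mul _).ennreal_ofReal (ae_of_all _ fun _ => ENNReal.ofReal_lt_top),
    ← integral_const_mul]
  congr 1 with a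
  rw [ENNReal.toReal_ofReal (mul_nonneg hZ (hw a)), smul_eq_mul, mul_assoc]

/-- The confluent density has `vandermonde a * gaussWeight 1 a` in its denominator. One factor of
`vandermonde a ^ 2` cancels, the Gaussian weights combine with the transition determinants into
those of `G`, and the result is `fullDet` up to a constant. -/
theorem IsConfluentNIBM.exists_integral_prod {V : ℝ → ℝ} (hn : 0 < n) (hV : Continuous V)
    {p : ℕ → ℝ[X]} (hp : IsOrthonormalPolynomials n V p)
    {P₀ : Measure Ω₀} [IsProbabilityMeasure P₀] {B : Fin n → ℝ≥0 → Ω₀ → ℝ}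
    (hB : IsIndepBrownian B P₀) {P : Measure Ω} [IsProbabilityMeasure P] {X : I → Ω → Fin n → ℝ}
    (hX : IsConfluentNIBM B P₀ (ueLaw n V) X P) {m : ℕ} {u : Fin (m + 1) → I} (hu : StrictMono u)
    (hu0 : 0 < u 0) (hu1 : u (Fin.last m) < 1)
    (hK : IsReproducing n (extKernel n p (fun l w => (p l).eval w * Real.exp (-(n * V w)))
      (Fin.cons 0 (fun i => (u i : ℝ)) : Fin (m + 2) → ℝ))) :
    ∃ c : ℝ, ∀ f : Fin (m + 1) → (Fin n → ℝ) →ᵇ ℝ,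
      ∫ ω, ∏ i, f i (X (u i) ω) ∂P = ∫ x, (∏ i : Fin (m + 1), f i (x i.succ)) *
        (c * (configs (Fin (m + 2)) n).indicator (fullDet (extKernel n p
          (fun l w => (p l).eval w * Real.exp (-(n * V w)))
            (Fin.cons 0 (fun i => (u i : ℝ)) : Fin (m + 2) → ℝ))) x) := by
  set τ : Fin (m + 2) → ℝ := Fin.cons 0 (fun i => (u i : ℝ)) with hτ
  set K := extKernel n p (fun l w => (p l).eval w * Real.exp (-(n * V w))) τ with hKdef
  obtain ⟨κ, hκ, hlim, hlaw⟩ := hX.law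
  obtain ⟨B', hB', hBB⟩ := hB.exists_isRegularBrownian
  obtain ⟨C, hC⟩ := hB'.exists_integral_confluentLimit hn hu hu0 hu1
  obtain ⟨ε, hε, hdet⟩ := exists_fullDet_extKernel (m + 1) n (V := V) hp.natDegree_eq
    (fun l => (hp.leadingCoeff_pos l).ne') (τ := τ) rfl
    (by rw [hτ, ← Fin.succ_last, Fin.cons_succ]; exact hu1)
  refine ⟨(ueZ n V)⁻¹ * C * ε⁻¹, fun f => ?_⟩
  have hXm : Measurable fun ω t => X t ω := measurable_pi_lambda _ hX.measurable
  have hfm : Measurable fun γ : I → Fin n → ℝ => ∏ i, f i (γ (u i)) :=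
    Finset.measurable_fun_prod _ fun i _ =>
      (f i).continuous.measurable.comp (measurable_pi_apply (u i))
  have hpb : ∀ z : Fin (m + 1) → Fin n → ℝ, |∏ i, f i (z i)| ≤ ∏ i, ‖f i‖ := fun z => by
    rw [Finset.abs_prod]
    exact Finset.prod_le_prod (fun i _ => abs_nonneg _) fun i _ => (f i).norm_coe_le_norm (z i)
  have hprob : IsProbabilityMeasure ((ueLaw n V).bind κ) :=
    hlaw ▸ Measure.isProbabilityMeasure_map hXm.aemeasurable
  have hs : SFinite (ueLaw n V) := by unfold ueLaw; infer_instance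
  have h1 : ∫ ω, ∏ i, f i (X (u i) ω) ∂P =
      ∫ a, ∫ γ, ∏ i, f i (γ (u i)) ∂(κ a) ∂(ueLaw n V) := by
    rw [← integral_bind _ _ hfm (Integrable.of_bound hfm.aestronglyMeasurable _
      (ae_of_all _ fun γ => hpb fun i => γ (u i))), ← hlaw,
      integral_map hXm.aemeasurable hfm.aestronglyMeasurable]
  have hF : Integrable fun x : Fin (m + 2) → Fin n → ℝ =>
      (∏ i : Fin (m + 1), f i (x i.succ)) * ((ueZ n V)⁻¹ * C * ε⁻¹ *
        (configs (Fin (m + 2)) n).indicator (fullDet K) x) := by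
    have hm : Measurable fun x : Fin (m + 2) → Fin n → ℝ => ∏ i : Fin (m + 1), f i (x i.succ) :=
      Finset.measurable_fun_prod _ fun i _ =>
        (f i).continuous.measurable.comp (measurable_pi_apply i.succ)
    have h2 : Integrable (fullDet K : (Fin (m + 2) → Fin n → ℝ) → ℝ) := by
      simpa using hK.integrable_mul_fullDet (f := fun _ => 1) measurable_const (C := 1) (by simp)
    exact ((h2.indicator (measurableSet_configs _ n)).const_mul _).bdd_mul
      hm.aestronglyMeasurable (ae_of_all _ fun x => hpb fun i => x i.succ)
  rw [h1, ueLaw_integral hV, integral_cons hF, ← integral_indicator (measurableSet_chamber n),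
    ← integral_const_mul]
  congr 1 with a
  by_cases ha : a ∈ chamber n
  swap
  · rw [Set.indicator_of_notMem ha, mul_zero]
    symm
    refine integral_eq_zero_of_ae (ae_of_all _ fun z => ?_)
    have : (Fin.cons a z : Fin (m + 2) → Fin n → ℝ) ∉ configs (Fin (m + 2)) n := fun h => ha (h 0)
    simp [Set.indicator_of_notMem this]
  rw [Set.indicator_of_mem ha]
  have hCa := hC a ha (κ a) ((hlim a ha).congr hBB) f
  have hv := (vandermonde_pos ha).ne'
  have hg := (gaussWeight_pos 1 a).ne'
  set E := ∏ j, Real.exp (-(n * V (a j))) with hE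
  have h3 : ueWeight n V a * ∫ γ, ∏ i, f i (γ (u i)) ∂(κ a) =
      vandermonde a * E / gaussWeight 1 a *
        ((∫ γ, ∏ i, f i (γ (u i)) ∂(κ a)) * (vandermonde a * gaussWeight 1 a)) := by
    rw [ueWeight, ← hE]
    field_simp
  rw [h3, hCa, ← integral_const_mul, ← integral_const_mul, ← integral_const_mul]
  congr 1 with z
  have hconf : (Fin.cons a z : Fin (m + 2) → Fin n → ℝ) ∈ configs (Fin (m + 2)) n ↔
      ∀ i, z i ∈ chamber n := by
    refine ⟨fun h i => h i.succ, fun h i => Fin.cases ha h i⟩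
  simp only [Fin.cons_succ]
  by_cases hz : ∀ i, z i ∈ chamber n
  · rw [Set.indicator_of_mem (hconf.2 hz), hdet,
      Finset.prod_congr rfl fun i _ => Set.indicator_of_mem (hz i) (f i)]
    rw [hτ, prod_det_gaussianPart hn hu hu0 a z, Fin.cons_zero, ← hE, ← Fin.succ_last,
      Fin.cons_succ]
    field_simp
  · rw [Set.indicator_of_notMem (fun h => hz (hconf.1 h))]
    push Not at hz
    obtain ⟨i, hi⟩ := hz
    rw [Finset.prod_eq_zero (Finset.mem_univ i) (Set.indicator_of_notMem hi _)]
    ring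

/-- The joint law of the process at the times `u` is given by a determinantal density on the
ordered configurations that includes the starting points. -/
theorem IsConfluentNIBM.integral_eq {V : ℝ → ℝ} (hn : 0 < n) (hV : Continuous V)
    {p : ℕ → ℝ[X]} (hp : IsOrthonormalPolynomials n V p)
    {P₀ : Measure Ω₀} [IsProbabilityMeasure P₀] {B : Fin n → ℝ≥0 → Ω₀ → ℝ}
    (hB : IsIndepBrownian B P₀) {P : Measure Ω} [IsProbabilityMeasure P] {X : I → Ω → Fin n → ℝ}
    (hX : IsConfluentNIBM B P₀ (ueLaw n V) X P) {m : ℕ} {u : Fin (m + 1) → I} (hu : StrictMono u)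
    (hu0 : 0 < u 0) (hu1 : u (Fin.last m) < 1)
    (hK : IsReproducing n (extKernel n p (fun l w => (p l).eval w * Real.exp (-(n * V w)))
      (Fin.cons 0 (fun i => (u i : ℝ)) : Fin (m + 2) → ℝ)))
    {F : (Fin (m + 1) → Fin n → ℝ) → ℝ} (hF : Measurable F) {C : ℝ} (hC : ∀ z, |F z| ≤ C) :
    ∫ ω, F (fun i => X (u i) ω) ∂P = ∫ x in configs (Fin (m + 2)) n, F (fun i => x i.succ) *
      fullDet (extKernel n p (fun l w => (p l).eval w * Real.exp (-(n * V w)))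
        (Fin.cons 0 (fun i => (u i : ℝ)) : Fin (m + 2) → ℝ)) x := by
  set K := extKernel n p (fun l w => (p l).eval w * Real.exp (-(n * V w)))
    (Fin.cons 0 (fun i => (u i : ℝ)) : Fin (m + 2) → ℝ) with hKdef
  obtain ⟨c, hc⟩ := hX.exists_integral_prod hn hV hp hB hu hu0 hu1 hK
  rw [← hKdef] at hc
  have hXm : Measurable fun ω i => X (u i) ω := measurable_pi_lambda _ fun i => hX.measurable (u i)
  have hprob : IsProbabilityMeasure (P.map fun ω i => X (u i) ω) :=
    Measure.isProbabilityMeasure_map hXm.aemeasurable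
  have hTm : Measurable fun (x : Fin (m + 2) → Fin n → ℝ) (i : Fin (m + 1)) => x i.succ :=
    measurable_pi_lambda _ fun i => measurable_pi_apply i.succ
  have hfull : Integrable (fullDet K : (Fin (m + 2) → Fin n → ℝ) → ℝ) := by
    simpa using hK.integrable_mul_fullDet (f := fun _ => 1) measurable_const (C := 1) (by simp)
  have hfullm : Measurable (fullDet K : (Fin (m + 2) → Fin n → ℝ) → ℝ) :=
    (hK.measurable_corr fun q : Fin (m + 2) × Fin n => q.1).comp
      (measurable_pi_lambda _ fun q => (measurable_pi_apply q.2).comp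
        (measurable_pi_apply (X := fun _ => Fin n → ℝ) q.1))
  have key : ∀ F : (Fin (m + 1) → Fin n → ℝ) → ℝ, Measurable F → ∀ C : ℝ, (∀ z, |F z| ≤ C) →
      ∫ ω, F (fun i => X (u i) ω) ∂P = c * ∫ x in configs (Fin (m + 2)) n,
        F (fun i => x i.succ) * fullDet K x := by
    intro F hF C hC
    have h1 := integral_eq_of_integral_prod_boundedContinuousFunction
      (Λ := P.map fun ω i => X (u i) ω) hTm
      (h := fun x => c * (configs (Fin (m + 2)) n).indicator (fullDet K) x)
      ((hfullm.indicator (measurableSet_configs _ n)).const_mul c)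
      ((hfull.indicator (measurableSet_configs _ n)).const_mul c) (fun f => ?_) hF hC
    · rw [integral_map hXm.aemeasurable hF.aestronglyMeasurable] at h1
      rw [h1, ← integral_indicator (measurableSet_configs _ n), ← integral_const_mul]
      congr 1 with x
      by_cases hx : x ∈ configs (Fin (m + 2)) n
      · rw [Set.indicator_of_mem hx, Set.indicator_of_mem hx]; ring
      · rw [Set.indicator_of_notMem hx, Set.indicator_of_notMem hx]; ring
    · rw [← hc f, integral_map hXm.aemeasurable]
      exact (Finset.measurable_fun_prod _ fun i _ => (f i).continuous.measurable.comp
        (measurable_pi_apply i)).aestronglyMeasurable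
  -- The constant is found by testing with `F = 1`: the correlation identity for zero points says
  -- that `fullDet` integrates to `1` over ordered configurations, so `c = 1`.
  have h1 := key (fun _ => 1) measurable_const 1 (by simp)
  have h2 := hK.correlationIdentity (Fin.elim0 : Fin 0 → Fin (m + 2)) (fun _ => 1)
    measurable_const ⟨1, by simp⟩
  have h3 : (Finset.univ.filter fun q : Fin 0 → Fin n => Function.Injective
      fun l => ((Fin.elim0 : Fin 0 → Fin (m + 2)) l, q l)) = Finset.univ :=
    Finset.filter_true_of_mem fun q _ => Function.injective_of_subsingleton _
  rw [h3] at h2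
  simp only [Finset.sum_const, Finset.card_univ, Fintype.card_unique, one_smul, corr,
    Matrix.det_isEmpty, mul_one, integral_const, probReal_univ, one_mul, smul_eq_mul,
    Measure.volume_pi_eq_dirac Fin.elim0] at h1 h2
  rw [h2, mul_one] at h1
  rw [key F hF C hC, ← h1, one_mul]

end NIBM
-- Assembly
theorem propositionA2 (n : ℕ) (hn : 0 < n)
    (V : ℝ → ℝ) (hV : AnalyticOnNhd ℝ V Set.univ)
    (hVtop : Tendsto (fun x : ℝ => V x / Real.log (1 + |x|)) atTop atTop)
    (hVbot : Tendsto (fun x : ℝ => V x / Real.log (1 + |x|)) atBot atTop)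
    (p : ℕ → Polynomial ℝ) (hp : NIBM.IsOrthonormalPolynomials n V p)
    {Ω₀ : Type*} [MeasurableSpace Ω₀] (P₀ : Measure Ω₀) [IsProbabilityMeasure P₀]
    (B : Fin n → ℝ≥0 → Ω₀ → ℝ) (hB : NIBM.IsIndepBrownian B P₀)
    {Ω : Type*} [MeasurableSpace Ω] (P : Measure Ω) [IsProbabilityMeasure P]
    (X : I → Ω → Fin n → ℝ) (hX : NIBM.IsConfluentNIBM B P₀ (NIBM.ueLaw n V) X P)
    (c : ℝ) (m : ℕ) (t : Fin m → I) (ht : StrictMono t) (ht01 : ∀ i, 0 < t i ∧ t i < 1) :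
    (∀ (i j : Fin m) (x y : ℝ), Integrable fun q : ℝ × ℝ =>
      NIBM.integrand n V p x y (t i) (t j) (c + q.1 * Complex.I) q.2) ∧
    NIBM.IsMultiTimeDeterminantal P X t (NIBM.kernelX n V p c) := by
  have hVc : Continuous V := continuousOn_univ.1 hV.continuousOn
  have hφ : ∀ l, Continuous fun w => (p l).eval w * Real.exp (-(n * V w)) := fun l =>
    (p l).continuous.mul (by fun_prop)
  have hd : ∀ l, NIBM.RapidDecay fun w => (p l).eval w * Real.exp (-(n * V w)) := fun l => by
    simpa only [mul_comm] using (NIBM.rapidDecay_exp_neg hn hVc hVtop hVbot).mul_poly (p l)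
  refine ⟨fun i j x y => NIBM.integrable_integrand hn hφ hd (ht01 i).1 (ht01 i).2 (ht01 j).1
    (ht01 j).2 c x y, fun k s f hf ⟨C, hC⟩ => ?_⟩
  rcases m with _ | m
  -- With no times, only `k = 0` is possible and the identity says that `P` has mass one.
  · rcases k with _ | k
    swap
    · exact (s 0).elim0
    have h1 : (Finset.univ.filter fun q : Fin 0 → Fin n => Function.Injective
        fun l => (s l, q l)) = Finset.univ :=
      Finset.filter_true_of_mem fun q _ => Function.injective_of_subsingleton _
    have h2 : ∀ q : Fin 0 → Fin n, ∀ ω, (fun l => X (t (s l)) ω (q l)) = Fin.elim0 := fun q ω =>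
      Subsingleton.elim _ _
    rw [h1]
    simp only [Matrix.det_isEmpty, mul_one, Measure.volume_pi_eq_dirac Fin.elim0, h2]
    exact ⟨integrable_dirac (by simp), by simp⟩
  -- Layer `0` holds the starting points. Correlations are only taken in the layers `Fin.succ ∘ s`,
  -- so the starting points are integrated out by the correlation identity.
  set τ : Fin (m + 2) → ℝ := Fin.cons 0 (fun i => (t i : ℝ)) with hτ
  have hτm : StrictMono τ := Fin.strictMono_iff_lt_succ.2 fun i => by
    refine Fin.cases ?_ (fun i => ?_) i
    · exact (ht01 0).1
    · exact ht i.castSucc_lt_succ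
  have hτ0 : ∀ i, 0 ≤ τ i := Fin.cases le_rfl fun i => (t i).2.1
  have hτ1 : ∀ i, τ i < 1 := Fin.cases zero_lt_one fun i => (ht01 i).2
  have hpφ : ∀ l k, ∫ w, (p l).eval w * Real.exp (-(n * V w)) * (p k).eval w =
      if l = k then 1 else 0 := fun l k => by
    simpa only [mul_right_comm] using hp.integral_eq l k
  have hK := NIBM.isReproducing_extKernel hn hp.natDegree_eq hφ hd hpφ hτm hτ0 hτ1
  set K := NIBM.extKernel n p (fun l w => (p l).eval w * Real.exp (-(n * V w))) τ with hKdef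
  -- The complex kernel takes real values at the times `t i` and agrees there with the extended
  -- kernel.
  have hdet : ∀ x : Fin k → ℝ, (Matrix.of fun i j =>
      NIBM.kernelX n V p c (x i) (x j) (t (s i)) (t (s j))).det =
      ((NIBM.corr K (Fin.succ ∘ s) x : ℝ) : ℂ) := fun x => by
    rw [NIBM.corr, ← Complex.ofRealHom_eq_coe, RingHom.map_det]
    congr 1
    ext i j
    exact NIBM.kernelX_eq hn hφ hd hτm hτ1 (i := (s i).succ) (j := (s j).succ)
      (ht01 _).1 (ht01 _).1 c (x i) (x j)
  simp only [hdet, ← Complex.ofReal_mul]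
  refine ⟨(hK.integrable_mul_corr _ hf hC).ofReal, ?_⟩
  rw [integral_complex_ofReal, ← hK.correlationIdentity (Fin.succ ∘ s) f hf ⟨C, hC⟩]
  have hinj : ∀ q : Fin k → Fin n, Function.Injective (fun l => ((Fin.succ ∘ s) l, q l)) ↔
      Function.Injective fun l => (s l, q l) := fun q => by
    simp [Function.Injective]
  simp only [hinj]
  congr 1
  symm
  refine hX.integral_eq hn hVc hp hB ht (ht01 0).1 (ht01 (Fin.last m)).2 hK
    (F := fun z => ∑ q : Fin k → Fin n with Function.Injective (fun l => (s l, q l)),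
      f (fun l => z (s l) (q l))) ?_
    (C := ∑ _q : Fin k → Fin n with Function.Injective (fun l => (s l, _q l)), C) ?_
  · exact Finset.measurable_fun_sum _ fun q _ => hf.comp (measurable_pi_lambda _ fun l =>
      (measurable_pi_apply (q l)).comp (measurable_pi_apply (X := fun _ => Fin n → ℝ) (s l)))
  · exact fun z => (Finset.abs_sum_le_sum_abs _ _).trans (Finset.sum_le_sum fun q _ => hC _)
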